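/- **Setting.** Let $\Omega\subset\mathbb R^2$ be a bounded connected open set, $\mathbb T=\mathbb R/\mathbb Z$, and let $\mathcal M$ be a $C^1$ field of symmetric positive definite $2\times2$ matrices on $\overline\Omega$. Write $\|v\|_A=\sqrt{\langle v,Av\rangle}$, $\mathcal R_x(v)=\|v\|_{\mathcal M(x)}$, $\mathrm{curl}\,\omega=\partial_1\omega_2-\partial_2\omega_1$, $(a,b)^\perp=(-b,a)$. For a metric $F$ and $C\in\mathrm{Lip}(\mathbb T,\mathbb R^2)$ put $\mathrm{Length}_F(C)=\int_0^1F_{C(t)}(C'(t))\,dt$, and let $\rho_{\min}(F)$, $\rho_{\max}(F)$ be the minimum and maximum of $F_x(v)$ over $\|v\|=1$ and $x$ in the domain of $F$. Let $\mathscr C\in C^3(\mathbb T,\mathbb R^2)$ be a simple closed curve, counter-clockwise and of unit speed, with normal $\mathscr N=(\mathscr C')^\perp$, and let $\mathrm{lfs}(\mathscr C)$ be its distance to its medial axis (the set of points having at least two nearest points on $\mathscr C$). Fix $0<U\le \mathrm{lfs}(\mathscr C)/3$ such that the tube $\mathscr T=\mathscr T_U=\{\mathscr C(t)+u\mathscr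 N(t): t\in\mathbb T,\ |u|\le U\}$ lies in $\Omega$. Let $\Gamma_1$ be the set of curves in $\mathrm{Lip}(\mathbb T,\mathscr T)$ that are homotopic to $\mathscr C$ in $\mathscr T$, and $\Gamma_0=\{\mathscr C+\mu\mathscr N:\mu\in\mathrm{Lip}(\mathbb T,[-U,U])\}$. Let $\mathcal X_1$ (resp. $\mathcal X_0$) be the set of closed $S\subset\Omega$, homeomorphic to a closed disk, whose boundary is parametrized by an element of $\Gamma_1$ (resp. $\Gamma_0$). For each $S\in\mathcal X_1$ fix $\mathcal C_S\in\Gamma_1$ with image $\partial S$. Let $\Psi$ be a real functional of characteristic functions $\chi_S$ (modulo a.e. equality on $\Omega$), $\xi_{\mathfrak S}\in C^0(\overline\Omega)$ for $\mathfrak S\in\mathcal X_1$, and $K_\Psi>0$, such that for all $\mathfrak S\in\mathcal X_0$, $S\in\mathcal X_1$ $$\Big|\Psi(\chi_{\mathfrak S})+\int_\Omega(\chi_S-\chi_{\mathfrak S})\,\xi_{\mathfrak S}\,dx-\Psi(\chi_S)\Big|\le K_\Psi\|\chi_S-\chi_{\mathfrak S}\|_{L^1(\Omega)}^2 .$$ Put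 $\lambda=48K_\Psi/\rho_{\min}(\mathcal R)$, where $\mathcal R$ is considered on $\overline\Omega$, $E(S)=\Psi(\chi_S)+\mathrm{Length}_{\mathcal R}(\mathcal C_S)$, let $d_{\partial\mathfrak S}$ be the Euclidean distance to $\partial\mathfrak S$, $D(S\|\mathfrak S)=\int_0^1 d_{\partial\mathfrak S}(\mathcal C_S(t))^2\,\mathcal R_{\mathcal C_S(t)}(\mathcal C_S'(t))\,dt$, and for $\mathfrak S,S\in\mathcal X_1$ $$E_{\mathfrak S}(S)=E(\mathfrak S)-\int_{\mathfrak S}\xi_{\mathfrak S}\,dx+\int_S\xi_{\mathfrak S}\,dx+\mathrm{Length}_{\mathcal R}(\mathcal C_S)+2\lambda D(S\|\mathfrak S).$$ **Theorem.** (a) Let $(\omega_{\mathfrak S})_{\mathfrak S\in\mathcal X_1}$ be vector fields of class $C^1$ on $\mathscr T$ (restrictions of $C^1$ vector fields on $\mathbb R^2$) with $\mathrm{curl}\,\omega_{\mathfrak S}=\xi_{\mathfrak S}$ on $\mathscr T$, $\|\omega_{\mathfrak S}(x)\|_{\mathcal M(x)^{-1}}\le\frac12$ for $x\in\mathscr T$,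 and $\mathrm{Lip}(\omega_{\mathfrak S})$ bounded independently of $\mathfrak S$. On $\mathscr T$ put $$\mathcal F^{\mathfrak S}_x(v)=(1+2\lambda\, d_{\partial\mathfrak S}(x)^2)\,\|v\|_{\mathcal M(x)}+\langle\omega_{\mathfrak S}(x),v\rangle .$$ Then for every $\mathfrak S\in\mathcal X_1$ there is a constant $e'_{\mathfrak S}$ such that $$E_{\mathfrak S}(S)=e'_{\mathfrak S}+\mathrm{Length}_{\mathcal F^{\mathfrak S}}(\mathcal C_S)\qquad\text{for all }S\in\mathcal X_1 .$$ Moreover $\mathcal F^{\mathfrak S}$ is a Randers metric on $\mathscr T$: its coefficients, the positive definite tensor field $\mathcal G=(1+2\lambda d_{\partial\mathfrak S}^2)^2\mathcal M$ and the vector field $\omega_{\mathfrak S}$, are Lipschitz and satisfy $\langle\omega_{\mathfrak S},\mathcal G^{-1}\omega_{\mathfrak S}\rangle<1$. Finally there are constants $a>0$, $b$ and $L$, independent of $\mathfrak S\in\mathcal X_1$, such that $a\le\rho_{\min}(\mathcal F^{\mathfrak S})$, $\rho_{\max}(\mathcal F^{\mathfrak S})\le b$ (the minimum and the maximum being attained),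 and both coefficients are $L$-Lipschitz on $\mathscr T$. (b) Such vector fields exist for thin tubes: if, for some $0<\alpha<1$, $\|\xi_{\mathfrak S}\|_\infty$ and the $\alpha$-Hölder seminorm of $\xi_{\mathfrak S}$ on $\overline\Omega$ are bounded independently of $\mathfrak S\in\mathcal X_1$, then there is $U_0\in(0,U]$ such that for every $0<U'\le U_0$ a family $(\omega_{\mathfrak S})$ with the properties listed in (a) exists for the tube $\mathscr T_{U'}$ and the corresponding (smaller) class of shapes. -/

import Mathlib

open Set MeasureTheory
open scoped NNReal Matrix.Norms.L2Operator

noncomputable section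

namespace RandersSeg

/-- The Euclidean plane. -/
abbrev Plane := EuclideanSpace ℝ (Fin 2)

/-- Counter-clockwise rotation by a right angle, `(a, b) ↦ (-b, a)`. -/
def perp (v : Plane) : Plane := !₂[-(v 1), v 0]

/-- `‖v‖_A = √⟨v, A v⟩`. -/
def matNorm (A : Matrix (Fin 2) (Fin 2) ℝ) (v : Plane) : ℝ :=
  Real.sqrt (v.ofLp ⬝ᵥ A.mulVec v.ofLp)

/-- `curl w = ∂₁ w₂ - ∂₂ w₁`. -/
def curl (w : Plane → Plane) (x : Plane) : ℝ :=
  (fderiv ℝ w x (EuclideanSpace.single 0 1)) 1 - (fderiv ℝ w x (EuclideanSpace.single 1 1)) 0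

/-! ### Metrics and lengths -/

/-- The length of a path `γ` (restricted to `[0, 1]`) for the metric `F`. For a Lipschitz path the
derivative exists almost everywhere. -/
def pathLength (F : Plane → Plane → ℝ) (γ : ℝ → Plane) : ℝ :=
  ∫ t in (0 : ℝ)..1, F (γ t) (deriv γ t)

/-- The Riemannian metric of a tensor field. -/
def riemannMetric (M : Plane → Matrix (Fin 2) (Fin 2) ℝ) (x v : Plane) : ℝ := matNorm (M x) v

/-- The values of `F` on Euclidean unit vectors based at points of `A`. -/
def unitValues (F : Plane → Plane → ℝ) (A : Set Plane) : Set ℝ :=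
  {r | ∃ x ∈ A, ∃ v : Plane, ‖v‖ = 1 ∧ r = F x v}

/-- The minimum ratio of `F` on `A`. -/
def rhoMin (F : Plane → Plane → ℝ) (A : Set Plane) : ℝ := sInf (unitValues F A)

/-- The maximum ratio of `F` on `A`. -/
def rhoMax (F : Plane → Plane → ℝ) (A : Set Plane) : ℝ := sSup (unitValues F A)

/-- `F` is, on `A`, the Randers metric with coefficients `N` (a positive definite tensor field) and
`w` (a vector field of `N⁻¹`-norm less than one), both of them `L`-Lipschitz on `A`. Tensors are
measured by the spectral norm. -/
structure IsRandersMetric (A : Set Plane) (F : Plane → Plane → ℝ)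
    (N : Plane → Matrix (Fin 2) (Fin 2) ℝ) (w : Plane → Plane) (L : ℝ≥0) : Prop where
  posDef : ∀ x ∈ A, (N x).PosDef
  compat : ∀ x ∈ A, (w x).ofLp ⬝ᵥ (N x)⁻¹.mulVec (w x).ofLp < 1
  lip_tensor : LipschitzOnWith L N A
  lip_field : LipschitzOnWith L w A
  formula : ∀ x ∈ A, ∀ v : Plane, F x v = matNorm (N x) v + inner ℝ (w x) v

/-! ### The tubular search space

A curve on `𝕋 = ℝ/ℤ` is represented by a `1`-periodic curve on `ℝ`. -/

/-- Winding number of a `1`-periodic curve around a point that it avoids. -/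
def windingNumber (γ : ℝ → Plane) (x : Plane) : ℝ :=
  (1 / (2 * Real.pi)) *
    ∫ t in (0 : ℝ)..1, inner ℝ (perp (γ t - x)) (deriv γ t) / ‖γ t - x‖ ^ 2

/-- A simple closed `C³` curve, parametrized counter-clockwise at unit speed. (The winding numbers
of a simple closed curve are `0` and `1` if it is counter-clockwise, `0` and `-1` otherwise.) -/
structure IsCenterline (c : ℝ → Plane) : Prop where
  contDiff : ContDiff ℝ 3 c
  periodic : Function.Periodic c 1
  simple : InjOn c (Ico 0 1)
  unit_speed : ∀ t, ‖deriv c t‖ = 1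
  counterclockwise : ∃ x, x ∉ range c ∧ windingNumber c x = 1

/-- The unit normal of the centerline. -/
def normal (c : ℝ → Plane) (t : ℝ) : Plane := perp (deriv c t)

/-- The medial axis of a set: points with at least two nearest points in the set. -/
def medialAxis (K : Set Plane) : Set Plane :=
  {x | ∃ p ∈ K, ∃ q ∈ K, p ≠ q ∧ dist x p = Metric.infDist x K ∧ dist x q = Metric.infDist x K}

/-- The local feature size: the distance between a curve and its medial axis. -/
def localFeatureSize (c : ℝ → Plane) : ℝ :=
  sInf {r | ∃ t : ℝ, ∃ m ∈ medialAxis (range c), r = dist (c t) m}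

/-- The closed tubular neighbourhood of width `U` of the centerline. -/
def tube (c : ℝ → Plane) (U : ℝ) : Set Plane :=
  {x | ∃ t : ℝ, ∃ u ∈ Icc (-U) U, x = c t + u • normal c t}

/-- Closed curves `c₀` and `c₁` are (freely) homotopic within `A`. -/
def LoopHomotopicIn (A : Set Plane) (c₀ c₁ : ℝ → Plane) : Prop :=
  ∃ H : ℝ → ℝ → Plane,
    ContinuousOn (fun p : ℝ × ℝ => H p.1 p.2) (Icc (0 : ℝ) 1 ×ˢ univ) ∧
    (∀ s ∈ Icc (0 : ℝ) 1, Function.Periodic (H s) 1 ∧ ∀ t, H s t ∈ A) ∧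
    H 0 = c₀ ∧ H 1 = c₁

/-- The set of Lipschitz closed curves in the tube that are homotopic to the centerline. -/
def Gamma1 (c : ℝ → Plane) (U : ℝ) : Set (ℝ → Plane) :=
  {γ | Function.Periodic γ 1 ∧ (∃ K : ℝ≥0, LipschitzWith K γ) ∧ (∀ t, γ t ∈ tube c U) ∧
    LoopHomotopicIn (tube c U) c γ}

/-- The set of curves `c + μ • normal c` with a Lipschitz deviation `μ : 𝕋 → [-U, U]`. -/
def Gamma0 (c : ℝ → Plane) (U : ℝ) : Set (ℝ → Plane) :=
  {γ | ∃ μ : ℝ → ℝ, Function.Periodic μ 1 ∧ (∃ K : ℝ≥0, LipschitzWith K μ) ∧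
    (∀ t, μ t ∈ Icc (-U) U) ∧ γ = fun t => c t + μ t • normal c t}

/-- A closed simple shape in `Ω`: a closed subset of `Ω` that is homeomorphic to a closed disk. -/
def IsClosedSimpleShape (Ω S : Set Plane) : Prop :=
  S ⊆ Ω ∧ IsClosed S ∧ Nonempty (S ≃ₜ Metric.closedBall (0 : Plane) 1)

/-- Shapes whose boundary is parametrized by an element of `Gamma1`. -/
def shapes1 (Ω : Set Plane) (c : ℝ → Plane) (U : ℝ) : Set (Set Plane) :=
  {S | IsClosedSimpleShape Ω S ∧ ∃ γ ∈ Gamma1 c U, range γ = frontier S}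

/-- Shapes whose boundary is parametrized by an element of `Gamma0`. -/
def shapes0 (Ω : Set Plane) (c : ℝ → Plane) (U : ℝ) : Set (Set Plane) :=
  {S | IsClosedSimpleShape Ω S ∧ ∃ γ ∈ Gamma0 c U, range γ = frontier S}

/-! ### The active contour energy and its approximation -/

/-- Characteristic function of a shape. -/
def chi (S : Set Plane) : Plane → ℝ := S.indicator 1

/-- `Ψ` is a functional of functions on `Ω` modulo almost everywhere equality. -/
def IsFunctionalOn (Ω : Set Plane) (Ψ : (Plane → ℝ) → ℝ) : Prop :=
  ∀ f g : Plane → ℝ, f =ᵐ[volume.restrict Ω] g → Ψ f = Ψ g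

/-- Second order Taylor expansion of `Ψ` with shape gradient `ξ` and regularity constant `K`. -/
def HasShapeGradient (Ω : Set Plane) (c : ℝ → Plane) (U : ℝ) (Ψ : (Plane → ℝ) → ℝ)
    (ξ : Set Plane → Plane → ℝ) (K : ℝ) : Prop :=
  ∀ S₀ ∈ shapes0 Ω c U, ∀ S ∈ shapes1 Ω c U,
    |Ψ (chi S₀) + (∫ x in Ω, (chi S x - chi S₀ x) * ξ S₀ x) - Ψ (chi S)|
      ≤ K * (∫ x in Ω, |chi S x - chi S₀ x|) ^ 2

/-- Euclidean distance to the boundary of a shape. -/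
def bdryDist (S₀ : Set Plane) (x : Plane) : ℝ := Metric.infDist x (frontier S₀)

/-- The divergence `D(S ‖ S₀)`, where `γ` parametrizes the boundary of `S`. -/
def divergence (M : Plane → Matrix (Fin 2) (Fin 2) ℝ) (γ : ℝ → Plane) (S₀ : Set Plane) : ℝ :=
  ∫ t in (0 : ℝ)..1, bdryDist S₀ (γ t) ^ 2 * riemannMetric M (γ t) (deriv γ t)

/-- The hybrid active contour energy of `S`, where `C S` parametrizes the boundary of `S`. -/
def hybridEnergy (M : Plane → Matrix (Fin 2) (Fin 2) ℝ) (Ψ : (Plane → ℝ) → ℝ)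
    (C : Set Plane → ℝ → Plane) (S : Set Plane) : ℝ :=
  Ψ (chi S) + pathLength (riemannMetric M) (C S)

/-- The weight `lam = (48 / ρ_min) K` of the divergence term, where `ρ_min` is the minimum ratio of
the Riemannian metric and `K` is the regularity constant of `Ψ`. -/
def penaltyWeight (Ω : Set Plane) (M : Plane → Matrix (Fin 2) (Fin 2) ℝ) (K : ℝ) : ℝ :=
  48 / rhoMin (riemannMetric M) (closure Ω) * K

/-- The approximate energy of `S` with reference shape `S₀`. -/
def approxEnergy (M : Plane → Matrix (Fin 2) (Fin 2) ℝ) (Ψ : (Plane → ℝ) → ℝ)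
    (ξ : Set Plane → Plane → ℝ) (C : Set Plane → ℝ → Plane) (lam : ℝ) (S₀ S : Set Plane) : ℝ :=
  (hybridEnergy M Ψ C S₀ - ∫ x in S₀, ξ S₀ x) + (∫ x in S, ξ S₀ x)
    + pathLength (riemannMetric M) (C S) + 2 * lam * divergence M (C S) S₀

/-! ### The Randers metric -/

/-- The vector fields `ω S₀` are `C¹` on the tube (restrictions of `C¹` vector fields of the plane;
the derivatives at points of the tube do not depend on the extension), solve `curl (ω S₀) = ξ S₀`
there, have `M⁻¹`-norm at most `1 / 2`, and have a common Lipschitz constant. -/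
def IsRandersField (Ω : Set Plane) (M : Plane → Matrix (Fin 2) (Fin 2) ℝ) (c : ℝ → Plane)
    (U : ℝ) (ξ : Set Plane → Plane → ℝ) (ω : Set Plane → Plane → Plane) : Prop :=
  (∀ S₀ ∈ shapes1 Ω c U,
    (∃ g : Plane → Plane, ContDiff ℝ 1 g ∧ EqOn (ω S₀) g (tube c U) ∧
      ∀ x ∈ tube c U, curl g x = ξ S₀ x) ∧
    ∀ x ∈ tube c U, matNorm (M x)⁻¹ (ω S₀ x) ≤ 1 / 2) ∧
  ∃ L : ℝ≥0, ∀ S₀ ∈ shapes1 Ω c U, LipschitzOnWith L (ω S₀) (tube c U)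

/-- The metric `(1 + 2 lam d(x)²) ‖v‖_{M(x)} + ⟨ω(x), v⟩`, `d` the distance to the boundary. -/
def randersMetric (M : Plane → Matrix (Fin 2) (Fin 2) ℝ) (lam : ℝ)
    (ω : Set Plane → Plane → Plane) (S₀ : Set Plane) (x v : Plane) : ℝ :=
  (1 + 2 * lam * bdryDist S₀ x ^ 2) * matNorm (M x) v + inner ℝ (ω S₀ x) v

/-- The tensor field `(1 + 2 lam d²)² M` of the metric `randersMetric`. -/
def randersTensor (M : Plane → Matrix (Fin 2) (Fin 2) ℝ) (lam : ℝ) (S₀ : Set Plane)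
    (x : Plane) : Matrix (Fin 2) (Fin 2) ℝ :=
  (1 + 2 * lam * bdryDist S₀ x ^ 2) ^ 2 • M x

end RandersSeg

end

open RandersSeg

/-!
The plane is identified with `ℂ` by the isometry `toC`.

**The energy is a length.** Let `S` be a shape with boundary curve `γ`. The curve is contractible in
the disc `S`, so it does not wind around points outside of `S`; and its winding number is constant
in the interior of `S`, which is a connected set because of invariance of domain. Moving away from
the centerline along a normal ray, one stays at the right distance of it until the medial axis is
reached (`infDist_add_smul_eq`); as the tube has a third of this width, the centerline winds once
around some point outside of the tube, and so does `γ`, which is homotopic to it within the tube.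
Hence `γ` winds once around the interior points of `S` (`winds_of_mem_Gamma1`), and the part of `S`
outside of the tube is the set of the points there around which the centerline winds once: it is the
same for all shapes (`mem_iff_winds_of_notMem_tube`).

Inserting the Cauchy-Pompeiu formula in a contour integral and exchanging the integrals gives
Green's formula for Lipschitz loops in terms of winding numbers (`integral_mul_deriv_eq_integral_dbar`). The
circulation of the field `ω` along `γ` thus is the integral over `S` of its curl, up to the
choice of an extension of `ω`. This curl is the shape gradient in the tube, and all shapes agree elsewhere, so
that the circulation and the integral of the shape gradient over `S` differ by a constant
(`setIntegral_sub_circulation_eq`). The other terms of the energy are the Riemannian part of the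
Randers length.

**Uniform bounds.** As `ω` has norm at most `1 / 2`, the Cauchy-Schwarz inequality compares the
Randers metric with the Riemannian one; the remaining constants come from the compactness of the
tube and from the fact that the distance to a set is `1`-Lipschitz.

**Existence for thin tubes.** Multiply the shape gradient by a cutoff that is one on the tube and
zero away from it, and let `ω` be the Biot-Savart field of the product `f`: up to conjugation and a
factor, it is the Cauchy transform of `f`, whose derivatives are `π f` and a Beurling transform of `f`. Both
are continuous and bounded if `f` is Hölder continuous: regularize the kernel `1 / u` as
`ū / (|u|² + ε²)` and observe that the derivatives converge uniformly (`hasFDerivAt_cauchyT`). The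
field is small if the support of `f` has a small area, which is the case when the tube is thin.
-/

namespace RandersSeg

/-! ### Winding numbers of continuous loops -/

section Winding

open Complex Metric Filter Topology

/-- The loop `f : [0, 1] → ℂ ∖ {0}` winds `n` times around the origin: the increment of a continuous
logarithm of `f` over a period is `2πi n`. The path is defined on the whole line, for convenience. -/
def HasWinding (f : ℝ → ℂ) (n : ℤ) : Prop :=
  ∃ L : ℝ → ℂ, Continuous L ∧ (∀ t, exp (L t) = f t) ∧ L 1 - L 0 = n * (2 * Real.pi * I)

theorem exists_continuous_log {E : Type*} [NormedAddCommGroup E] [NormedSpace ℝ E] {f : E → ℂ}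
    (hf : Continuous f) (h0 : ∀ x, f x ≠ 0) : ∃ L : E → ℂ, Continuous L ∧ ∀ x, exp (L x) = f x := by
  obtain ⟨F, ⟨-, hF⟩, -⟩ := isCoveringMapOn_exp.existsUnique_continuousMap_lifts
    (⟨f, hf⟩ : C(E, ℂ)) (a₀ := 0) (exp_log (h0 0)) h0
  exact ⟨F, F.continuous, fun x => congrFun hF x⟩

/-- A continuous function with values in the discrete set `2πi ℤ` is constant. -/
theorem eq_of_forall_mem_two_pi_mul_int {X : Type*} [TopologicalSpace X] [PreconnectedSpace X]
    {u : X → ℂ} (hu : Continuous u) (h : ∀ x, ∃ n : ℤ, u x = n * (2 * Real.pi * I)) (x y : X) :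
    u x = u y := by
  choose n hn using h
  have hc : Continuous n := by
    rw [Int.isClosedEmbedding_coe_real.isInducing.continuous_iff]
    have : (Int.cast : ℤ → ℝ) ∘ n = fun x => (u x / (2 * Real.pi * I)).re := by
      ext x
      simp [hn x]
    rw [this]
    fun_prop
  rw [hn x, hn y, PreconnectedSpace.constant ‹_› hc (x := x) (y := y)]

theorem HasWinding.unique {f : ℝ → ℂ} {m n : ℤ} (hm : HasWinding f m) (hn : HasWinding f n) :
    m = n := by
  obtain ⟨L, hL, hLf, hL1⟩ := hm
  obtain ⟨K, hK, hKf, hK1⟩ := hn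
  have h := eq_of_forall_mem_two_pi_mul_int (u := fun t => L t - K t) (by fun_prop) (fun t => by
    obtain ⟨k, hk⟩ := exp_eq_exp_iff_exists_int.1 ((hLf t).trans (hKf t).symm)
    exact ⟨k, by rw [hk]; ring⟩) 1 0
  have h2 : (m : ℂ) * (2 * Real.pi * I) = n * (2 * Real.pi * I) := by
    rw [← hL1, ← hK1]; linear_combination h
  exact_mod_cast mul_right_cancel₀ two_pi_I_ne_zero h2

theorem exists_hasWinding {f : ℝ → ℂ} (hf : Continuous f) (h0 : ∀ t, f t ≠ 0) (h1 : f 1 = f 0) :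
    ∃ n, HasWinding f n := by
  obtain ⟨L, hL, hLf⟩ := exists_continuous_log hf h0
  obtain ⟨k, hk⟩ := exp_eq_exp_iff_exists_int.1 ((hLf 1).trans (h1.trans (hLf 0).symm))
  exact ⟨k, L, hL, hLf, by rw [hk]; ring⟩

theorem hasWinding_const {z : ℂ} (hz : z ≠ 0) : HasWinding (fun _ => z) 0 :=
  ⟨fun _ => log z, continuous_const, fun _ => exp_log hz, by simp⟩

/-- Homotopy invariance of the winding number. -/
theorem HasWinding.of_homotopy {H : ℝ → ℝ → ℂ} {n : ℤ}
    (hH : ContinuousOn (fun p : ℝ × ℝ => H p.1 p.2) (Icc (0 : ℝ) 1 ×ˢ univ))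
    (h0 : ∀ s ∈ Icc (0 : ℝ) 1, ∀ t, H s t ≠ 0) (hper : ∀ s ∈ Icc (0 : ℝ) 1, H s 1 = H s 0)
    (hn : HasWinding (H 0) n) : HasWinding (H 1) n := by
  have hp (s : ℝ) : ((projIcc 0 1 zero_le_one s : Icc (0 : ℝ) 1) : ℝ) ∈ Icc (0 : ℝ) 1 :=
    Subtype.coe_prop _
  have hc : Continuous fun p : ℝ × ℝ => H (projIcc 0 1 zero_le_one p.1) p.2 :=
    hH.comp_continuous (f := fun p : ℝ × ℝ => ((projIcc 0 1 zero_le_one p.1 : ℝ), p.2))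
      (by fun_prop) (fun p => ⟨hp _, mem_univ _⟩)
  obtain ⟨L, hL, hLf⟩ := exists_continuous_log hc (fun p => h0 _ (hp _) _)
  have e0 : ((projIcc 0 1 zero_le_one 0 : Icc (0 : ℝ) 1) : ℝ) = 0 := by simp
  have e1 : ((projIcc 0 1 zero_le_one 1 : Icc (0 : ℝ) 1) : ℝ) = 1 := by simp
  have key := eq_of_forall_mem_two_pi_mul_int (u := fun s : ℝ => L (s, 1) - L (s, 0)) (by fun_prop)
    (fun s => by
      obtain ⟨k, hk⟩ := exp_eq_exp_iff_exists_int.1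
        ((hLf (s, 1)).trans ((hper _ (hp s)).trans (hLf (s, 0)).symm))
      exact ⟨k, by rw [hk]; ring⟩) 1 0
  obtain ⟨k, hk⟩ := exp_eq_exp_iff_exists_int.1
        ((hLf (0, 1)).trans ((hper _ (hp 0)).trans (hLf (0, 0)).symm))
  have h0' : HasWinding (H 0) k := ⟨fun t => L (0, t), by fun_prop, fun t => by
    simpa using hLf (0, t), by simp only [hk]; ring⟩
  refine ⟨fun t => L (1, t), by fun_prop, fun t => by simpa using hLf (1, t), ?_⟩
  rw [hn.unique h0', key, hk]
  ring

/-- The standard parametrization of the unit circle. -/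
noncomputable def circ (t : ℝ) : ℂ := exp (2 * Real.pi * I * t)

theorem continuous_circ : Continuous circ := by unfold circ; fun_prop

theorem norm_circ (t : ℝ) : ‖circ t‖ = 1 := by
  rw [circ, show (2 * Real.pi * I * t : ℂ) = ((2 * Real.pi * t : ℝ) : ℂ) * I by push_cast; ring,
    norm_exp_ofReal_mul_I]

theorem circ_one : circ 1 = circ 0 := by
  simp [circ, exp_two_pi_mul_I]

theorem circ_add_half (t : ℝ) : circ (t + 1 / 2) = -circ t := by
  rw [circ, circ, show (2 * Real.pi * I * (t + 1 / 2 : ℝ) : ℂ) = 2 * Real.pi * I * t + Real.pi * I by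
    push_cast; ring, exp_add, exp_pi_mul_I]
  ring

theorem hasWinding_circ : HasWinding circ 1 :=
  ⟨fun t => 2 * Real.pi * I * t, by fun_prop, fun t => rfl, by simp⟩

/-- The restriction to the circle of a nonvanishing map of the disc has winding number zero. -/
theorem hasWinding_zero_of_disc {F : ℂ → ℂ} (hF : ContinuousOn F (closedBall 0 1))
    (h0 : ∀ z ∈ closedBall (0 : ℂ) 1, F z ≠ 0) : HasWinding (fun t => F (circ t)) 0 := by
  have hm : ∀ s ∈ Icc (0 : ℝ) 1, ∀ t, (s : ℂ) * circ t ∈ closedBall (0 : ℂ) 1 := fun s hs t => by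
    simp [norm_circ, abs_of_nonneg hs.1, hs.2]
  have := HasWinding.of_homotopy (H := fun s t => F ((s : ℂ) * circ t)) (n := 0)
    (hF.comp (by have := continuous_circ; fun_prop) (fun p hp => hm _ hp.1 _))
    (fun s hs t => h0 _ (hm s hs t)) (fun s _ => by simp [circ_one])
    (by simpa using hasWinding_const (h0 0 (by simp)))
  simpa using this

/-- A map of the closed unit disc to the unit circle has a fixed point. -/
theorem exists_fixed_point_of_norm_eq_one {F : ℂ → ℂ} (hF : ContinuousOn F (closedBall 0 1))
    (h1 : ∀ z ∈ closedBall (0 : ℂ) 1, ‖F z‖ = 1) : ∃ z ∈ closedBall (0 : ℂ) 1, F z = z := by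
  by_contra! hne
  have hm (t : ℝ) : circ t ∈ closedBall (0 : ℂ) 1 := by simp [norm_circ]
  have hFc : Continuous fun t => F (circ t) := hF.comp_continuous continuous_circ hm
  have hd := hasWinding_zero_of_disc (F := fun z => z - F z) (by fun_prop)
    (fun z hz => sub_ne_zero.2 (hne z hz).symm)
  have := HasWinding.of_homotopy (H := fun s t => circ t - (s : ℂ) * F (circ t)) (n := 1)
    (by
      have := continuous_circ
      exact ((this.comp continuous_snd).sub
        ((continuous_ofReal.comp continuous_fst).mul (hFc.comp continuous_snd))).continuousOn) (fun s hs t => by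
      rw [sub_ne_zero]
      intro h
      rcases hs.2.lt_or_eq with hlt | rfl
      · have h2 := congrArg norm h
        rw [norm_circ, norm_mul, h1 _ (hm t), norm_real, Real.norm_of_nonneg hs.1] at h2
        linarith
      · exact hne _ (hm t) (by simpa using h.symm)) (fun s _ => by simp [circ_one])
    (by simpa using hasWinding_circ)
  have := hd.unique (by simpa using this)
  norm_num at this

/-- An antipodal loop has nonzero (in fact odd) winding number. -/
theorem hasWinding_ne_zero_of_antipodal {g : ℝ → ℂ} {n : ℤ} (hodd : ∀ t, g (t + 1 / 2) = -g t)
    (hn : HasWinding g n) : n ≠ 0 := by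
  rintro rfl
  obtain ⟨L, hL, hLg, h1⟩ := hn
  have hex (t : ℝ) : ∃ k : ℤ, L (t + 1 / 2) - L t - Real.pi * I = k * (2 * Real.pi * I) := by
    obtain ⟨k, hk⟩ := exp_eq_exp_iff_exists_int.1
      (show exp (L (t + 1 / 2)) = exp (L t + Real.pi * I) by
        rw [exp_add, hLg, hLg, hodd, exp_pi_mul_I]; ring)
    exact ⟨k, by rw [hk]; ring⟩
  have hc := eq_of_forall_mem_two_pi_mul_int (u := fun t => L (t + 1 / 2) - L t - Real.pi * I)
    (by fun_prop) hex (1 / 2) 0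
  obtain ⟨k, hk⟩ := hex 0
  simp only [zero_add, add_halves] at hc hk
  have : ((2 * k + 1 : ℤ) : ℂ) * (2 * Real.pi * I) = 0 := by
    push_cast
    simp only [Int.cast_zero, zero_mul] at h1
    linear_combination h1 - hc - 2 * hk
  rw [mul_eq_zero, or_iff_left two_pi_I_ne_zero, Int.cast_eq_zero] at this
  omega

/-- Invariance of domain for the disc: its image by a continuous injective map is a neighbourhood
of the image of the centre. The image of the unit circle has odd winding number around the image
of the centre, because it is homotopic to the antipodal loop `f (z / 2) - f (-z / 2)`; and a point
outside the image of the disc has winding number zero. -/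
theorem image_closedBall_mem_nhds {f : ℂ → ℂ} (hf : ContinuousOn f (closedBall 0 1))
    (hinj : InjOn f (closedBall 0 1)) : f '' closedBall 0 1 ∈ 𝓝 (f 0) := by
  have hcc := continuous_circ
  have hm (t : ℝ) : circ t ∈ closedBall (0 : ℂ) 1 := by simp [norm_circ]
  have h0m : (0 : ℂ) ∈ closedBall (0 : ℂ) 1 := by simp
  have hpos : ∀ s ∈ Icc (0 : ℝ) 1, ∀ t, circ t / (1 + s : ℝ) ∈ closedBall (0 : ℂ) 1 := fun s hs t => by
    have : (0 : ℝ) < 1 + s := by linarith [hs.1]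
    rw [mem_closedBall_zero_iff, norm_div, norm_circ, norm_real, Real.norm_of_nonneg this.le,
      div_le_one this]
    linarith [hs.1]
  have hneg : ∀ s ∈ Icc (0 : ℝ) 1, ∀ t, -(s * (circ t / (1 + s : ℝ))) ∈ closedBall (0 : ℂ) 1 :=
    fun s hs t => by
      have h := hpos s hs t
      rw [mem_closedBall_zero_iff] at h ⊢
      rw [norm_neg, norm_mul, norm_real, Real.norm_of_nonneg hs.1]
      exact mul_le_one₀ hs.2 (norm_nonneg _) h
  have hcont : ContinuousOn (fun p : ℝ × ℝ => circ p.2 / ((1 + p.1 : ℝ) : ℂ))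
      (Icc (0 : ℝ) 1 ×ˢ univ) := by
    refine ContinuousOn.div (by fun_prop) (by fun_prop) (fun p hp => ?_)
    rw [ofReal_ne_zero]
    linarith [hp.1.1]
  obtain ⟨n, hn⟩ := exists_hasWinding (f := fun t => f (circ t) - f 0)
    ((hf.comp_continuous hcc hm).sub continuous_const)
    (fun t h => by
      have := hinj (hm t) h0m (sub_eq_zero.1 h)
      simpa [this] using norm_circ t)
    (by simp [circ_one])
  have hn0 : n ≠ 0 := by
    have hodd := HasWinding.of_homotopy (n := n)
      (H := fun s t => f (circ t / (1 + s : ℝ)) - f (-(s * (circ t / (1 + s : ℝ)))))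
      ((hf.comp hcont fun p hp => hpos _ hp.1 _).sub
        (hf.comp ((ContinuousOn.mul (by fun_prop) hcont).neg) fun p hp => hneg _ hp.1 _))
      (fun s hs t h => by
        have h1 := hinj (hpos s hs t) (hneg s hs t) (sub_eq_zero.1 h)
        have h2 : ((1 + s : ℝ) : ℂ) * (circ t / (1 + s : ℝ)) = 0 := by
          push_cast at h1 ⊢
          linear_combination h1
        have h3 : ((1 + s : ℝ) : ℂ) ≠ 0 := by
          rw [ofReal_ne_zero]; linarith [hs.1]
        rw [mul_div_cancel₀ _ h3] at h2
        simpa [h2] using norm_circ t)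
      (fun s _ => by simp [circ_one]) (by simpa using hn)
    refine hasWinding_ne_zero_of_antipodal (fun t => ?_) hodd
    rw [circ_add_half]
    norm_num [neg_div]
  obtain ⟨δ, hδ, hδf⟩ : ∃ δ > 0, ∀ t, δ ≤ ‖f (circ t) - f 0‖ := by
    have hK : IsCompact (sphere (0 : ℂ) 1) := isCompact_sphere _ _
    obtain ⟨z, hz, hmin⟩ := hK.exists_isMinOn ⟨1, by simp⟩
      (f := fun z => ‖f z - f 0‖)
      ((hf.mono sphere_subset_closedBall).sub continuousOn_const).norm
    refine ⟨_, norm_pos_iff.2 (fun h => ?_), fun t => hmin (by simp [norm_circ] : circ t ∈ _)⟩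
    have := hinj (sphere_subset_closedBall hz) h0m (sub_eq_zero.1 h)
    simp [this] at hz
  refine mem_of_superset (ball_mem_nhds (f 0) hδ) (fun y hy => ?_)
  by_contra hyn
  have h1 := hasWinding_zero_of_disc (F := fun z => f z - y) (by fun_prop)
    (fun z hz h => hyn ⟨z, hz, sub_eq_zero.1 h⟩)
  have h2 := HasWinding.of_homotopy (n := n)
    (H := fun s t => f (circ t) - (f 0 + s * (y - f 0)))
    (((hf.comp_continuous hcc hm).comp continuous_snd).sub (by fun_prop)).continuousOn
    (fun s hs t h => by
      have h3 : f (circ t) - f 0 = s * (y - f 0) := by linear_combination h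
      have h4 := hδf t
      rw [h3, norm_mul, norm_real, Real.norm_of_nonneg hs.1] at h4
      have h5 : ‖y - f 0‖ < δ := by simpa [dist_eq_norm] using hy
      nlinarith [hs.2, norm_nonneg (y - f 0)])
    (fun s _ => by simp [circ_one]) (by simpa using hn)
  exact hn0 (h2.unique (by simpa using h1))

end Winding

/-! ### Lipschitz loops and topological discs -/

section LipschitzWinding

open Complex Metric Filter Topology

theorem exists_pos_le_norm_sub {γ : ℝ → ℂ} (hc : Continuous γ) (hper : Function.Periodic γ 1) {w : ℂ}
    (hw : w ∉ range γ) : ∃ δ > 0, ∀ t, δ ≤ ‖γ t - w‖ := by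
  have hK : IsCompact (range γ) := hper.compact_of_continuous one_ne_zero hc
  have hpos := (hK.isClosed.notMem_iff_infDist_pos (range_nonempty γ)).1 hw
  refine ⟨_, hpos, fun t => ?_⟩
  rw [← dist_eq_norm, dist_comm]
  exact infDist_le_dist_of_mem (mem_range_self t)

theorem intervalIntegrable_deriv_div {γ : ℝ → ℂ} {K : ℝ≥0} (hK : LipschitzWith K γ)
    (hper : Function.Periodic γ 1) {w : ℂ} (hw : w ∉ range γ) (a b : ℝ) :
    IntervalIntegrable (fun t => deriv γ t / (γ t - w)) volume a b := by
  obtain ⟨δ, hδ, hle⟩ := exists_pos_le_norm_sub hK.continuous hper hw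
  refine (intervalIntegrable_const (c := (K / δ : ℝ))).mono_fun ?_ (ae_of_all _ fun t => ?_)
  · have := measurable_deriv γ
    have := hK.continuous.measurable
    exact Measurable.aestronglyMeasurable (by fun_prop)
  · refine le_trans (norm_div _ _).le (le_trans ?_ (le_abs_self _))
    exact div_le_div₀ K.2 (norm_deriv_le_of_lipschitz hK) hδ (hle t)

/-- The winding number of a Lipschitz loop as a contour integral. The primitive `Q` of
`γ' / (γ - w)` is a logarithm of `γ - w` up to a constant, as `(γ - w) exp (-Q)` is Lipschitz on
compact intervals and has a vanishing derivative almost everywhere. -/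
theorem exists_hasWinding_integral_eq {γ : ℝ → ℂ} {K : ℝ≥0} (hK : LipschitzWith K γ)
    (hper : Function.Periodic γ 1) {w : ℂ} (hw : w ∉ range γ) :
    ∃ n : ℤ, HasWinding (fun t => γ t - w) n ∧
      ∫ t in (0 : ℝ)..1, deriv γ t / (γ t - w) = n * (2 * Real.pi * I) := by
  have hc := hK.continuous
  obtain ⟨δ, hδ, hle⟩ := exists_pos_le_norm_sub hc hper hw
  have hne (t : ℝ) : γ t - w ≠ 0 := norm_pos_iff.1 (hδ.trans_le (hle t))
  have hbd (t : ℝ) : ‖deriv γ t / (γ t - w)‖ ≤ K / δ := by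
    rw [norm_div]
    exact div_le_div₀ K.2 (norm_deriv_le_of_lipschitz hK) hδ (hle t)
  have hint := intervalIntegrable_deriv_div hK hper hw
  set Q : ℝ → ℂ := fun x => ∫ t in (0 : ℝ)..x, deriv γ t / (γ t - w) with hQ
  have hQsub (x y : ℝ) : Q x - Q y = ∫ t in y..x, deriv γ t / (γ t - w) :=
    intervalIntegral.integral_interval_sub_left (hint _ _) (hint _ _)
  have hQL : LipschitzWith (K / δ).toNNReal Q := by
    refine LipschitzWith.of_dist_le_mul fun x y => ?_
    rw [dist_eq_norm, hQsub, Real.dist_eq, Real.coe_toNNReal _ (by positivity)]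
    exact intervalIntegral.norm_integral_le_of_norm_le_const fun t _ => hbd t
  have hconst (T : ℝ) : (γ T - w) * exp (-Q T) = γ 0 - w := by
    have hΦ : ContDiff ℝ 1 fun p : ℂ × ℂ => (p.1 - w) * exp (-p.2) := by fun_prop
    have hloc := hΦ.locallyLipschitz.comp (hK.prodMk hQL).locallyLipschitz
    obtain ⟨K', hK'⟩ := (hloc.locallyLipschitzOn (s := uIcc 0 T)).exists_lipschitzOnWith_of_compact
      isCompact_uIcc
    obtain ⟨C, hC⟩ := hK'.absolutelyContinuousOnInterval.const_of_ae_hasDerivAt_zero (by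
      filter_upwards [hK.ae_differentiableAt, (hint 0 T).ae_hasDerivAt_integral] with t h1 h2 ht
      have h3 := h2 ht 0 left_mem_uIcc
      have h4 := (h1.hasDerivAt.sub_const w).mul (h3.neg.cexp)
      convert! h4 using 1
      have := hne t
      field_simp
      ring)
    have h0 := (hC T right_mem_uIcc).trans (hC 0 left_mem_uIcc).symm
    simpa [hQ] using h0
  obtain ⟨n, hn⟩ := exists_hasWinding (f := fun t => γ t - w) (by fun_prop) hne
    (by simpa using hper 0)
  refine ⟨n, hn, ?_⟩
  have hlift (t : ℝ) : exp (log (γ 0 - w) + Q t) = γ t - w := by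
    rw [exp_add, exp_log (hne 0), ← hconst t, mul_assoc, ← exp_add]
    simp
  obtain ⟨k, hk⟩ := exp_eq_exp_iff_exists_int.1
    ((hlift 1).trans ((show γ 1 - w = γ 0 - w by simpa using hper 0).trans (hlift 0).symm))
  have hQ0 : Q 0 = 0 := by simp [hQ]
  have hk' : Q 1 = k * (2 * Real.pi * I) := by rw [hQ0] at hk; linear_combination hk
  have : HasWinding (fun t => γ t - w) k :=
    ⟨_, continuous_const.add hQL.continuous, hlift, by simp only [Pi.add_apply, hQ0, hk']; ring⟩
  rw [hn.unique this]
  exact hk'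

theorem HasWinding.integral_eq {γ : ℝ → ℂ} {K : ℝ≥0} (hK : LipschitzWith K γ)
    (hper : Function.Periodic γ 1) {w : ℂ} (hw : w ∉ range γ) {n : ℤ}
    (hn : HasWinding (fun t => γ t - w) n) :
    ∫ t in (0 : ℝ)..1, deriv γ t / (γ t - w) = n * (2 * Real.pi * I) := by
  obtain ⟨m, hm, h⟩ := exists_hasWinding_integral_eq hK hper hw
  rw [h, hn.unique hm]

/-- Winding numbers around the two ends of a path that avoids the loop agree. -/
theorem HasWinding.of_path {γ : ℝ → ℂ} (hc : Continuous γ) (hper : γ 1 = γ 0) {p : ℝ → ℂ}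
    (hp : ContinuousOn p (Icc 0 1)) (hav : ∀ s ∈ Icc (0 : ℝ) 1, p s ∉ range γ) {n : ℤ}
    (hn : HasWinding (fun t => γ t - p 0) n) : HasWinding (fun t => γ t - p 1) n := by
  refine HasWinding.of_homotopy (H := fun s t => γ t - p s) ?_
    (fun s hs t h => hav s hs ⟨t, sub_eq_zero.1 h⟩) (fun s _ => by rw [hper]) hn
  exact Continuous.continuousOn (by fun_prop) |>.sub
    (hp.comp continuousOn_fst fun q hq => hq.1)

/-- A loop in a topological disc `φ '' closedBall 0 1` does not wind around exterior points. -/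
theorem hasWinding_zero_of_notMem_disc {γ : ℝ → ℂ} {φ : ℂ → ℂ}
    (hφ : ContinuousOn φ (closedBall 0 1)) {ψ : ℝ → ℂ} (hψ : Continuous ψ) (hψp : ψ 1 = ψ 0)
    (hψm : ∀ t, ψ t ∈ closedBall (0 : ℂ) 1) (hγ : ∀ t, γ t = φ (ψ t)) {x : ℂ}
    (hx : x ∉ φ '' closedBall 0 1) : HasWinding (fun t => γ t - x) 0 := by
  have hm : ∀ s ∈ Icc (0 : ℝ) 1, ∀ t, (s : ℂ) * ψ t ∈ closedBall (0 : ℂ) 1 := fun s hs t => by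
    have := hψm t
    rw [mem_closedBall_zero_iff] at this ⊢
    rw [norm_mul, norm_real, Real.norm_of_nonneg hs.1]
    exact mul_le_one₀ hs.2 (norm_nonneg _) this
  have := HasWinding.of_homotopy (H := fun s t => φ ((s : ℂ) * ψ t) - x) (n := 0)
    ((hφ.comp (by fun_prop) (fun p hp => hm _ hp.1 _)).sub continuousOn_const)
    (fun s hs t h => hx ⟨_, hm s hs t, sub_eq_zero.1 h⟩) (fun s _ => by simp [hψp])
    (by simpa using hasWinding_const (sub_ne_zero.2
      (fun h => hx ⟨0, by simp, h⟩ : φ 0 ≠ x)))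
  simpa [hγ] using this

theorem image_ball_subset_interior {φ : ℂ → ℂ} (hφ : ContinuousOn φ (closedBall 0 1))
    (hinj : InjOn φ (closedBall 0 1)) : φ '' ball 0 1 ⊆ interior (φ '' closedBall 0 1) := by
  rintro _ ⟨p, hp, rfl⟩
  rw [mem_ball_zero_iff] at hp
  have hr : (0 : ℝ) < 1 - ‖p‖ := by linarith
  have hm : MapsTo (fun z : ℂ => p + (1 - ‖p‖ : ℝ) * z) (closedBall 0 1) (closedBall 0 1) := by
    intro z hz
    rw [mem_closedBall_zero_iff] at hz ⊢
    refine (norm_add_le _ _).trans ?_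
    rw [norm_mul, norm_real, Real.norm_of_nonneg hr.le]
    nlinarith
  have h := image_closedBall_mem_nhds (f := fun z => φ (p + (1 - ‖p‖ : ℝ) * z))
    (hφ.comp (by fun_prop) hm) (fun z hz z' hz' h => by
      have := hinj (hm hz) (hm hz') h
      have hr' : ((1 - ‖p‖ : ℝ) : ℂ) ≠ 0 := ofReal_ne_zero.2 hr.ne'
      exact mul_left_cancel₀ hr' (add_left_cancel this))
  rw [mul_zero, add_zero] at h
  rw [mem_interior_iff_mem_nhds]
  refine mem_of_superset h ?_
  rintro _ ⟨z, hz, rfl⟩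
  exact ⟨_, hm hz, rfl⟩

/-- The winding number of a loop in the frontier of a topological disc is constant on the
interior of the disc. -/
theorem HasWinding.of_mem_interior_disc {γ : ℝ → ℂ} (hc : Continuous γ)
    (hper : γ 1 = γ 0) {φ : ℂ → ℂ} (hφ : ContinuousOn φ (closedBall 0 1))
    (hinj : InjOn φ (closedBall 0 1)) (hγ : ∀ t, γ t ∉ interior (φ '' closedBall 0 1)) {x y : ℂ}
    (hx : x ∈ interior (φ '' closedBall 0 1)) (hy : y ∈ interior (φ '' closedBall 0 1)) {n : ℤ}
    (hn : HasWinding (fun t => γ t - x) n) : HasWinding (fun t => γ t - y) n := by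
  set V := interior (φ '' closedBall 0 1)
  have hav : ∀ z ∈ V, z ∉ range γ := by
    rintro _ hz ⟨t, rfl⟩
    exact hγ t hz
  have hline (a b : ℂ) (hab : ∀ s ∈ Icc (0 : ℝ) 1, a + (s : ℂ) * (b - a) ∈ V) (m : ℤ)
      (hm : HasWinding (fun t => γ t - a) m) : HasWinding (fun t => γ t - b) m := by
    have := HasWinding.of_path hc hper (p := fun s => a + (s : ℂ) * (b - a)) (n := m)
      (Continuous.continuousOn (by fun_prop)) (fun s hs => hav _ (hab s hs)) (by simpa using hm)
    simpa using this
  -- A point of the interior is joined by a segment to the image of a point of the open ball.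
  have hnear : ∀ z ∈ V, ∃ p ∈ ball (0 : ℂ) 1, ∀ m : ℤ,
      HasWinding (fun t => γ t - z) m ↔ HasWinding (fun t => γ t - φ p) m := by
    intro z hz
    obtain ⟨ε, hε, hεV⟩ := Metric.isOpen_iff.1 isOpen_interior z hz
    obtain ⟨q, hq, rfl⟩ := interior_subset hz
    have hcl : q ∈ closure (ball (0 : ℂ) 1) := by rwa [closure_ball _ one_ne_zero]
    have hcw : Tendsto φ (𝓝[ball 0 1] q) (𝓝 (φ q)) :=
      ((hφ q hq).mono ball_subset_closedBall)
    have := mem_closure_iff_nhdsWithin_neBot.1 hcl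
    obtain ⟨p, hp, hpb⟩ := ((hcw.eventually (ball_mem_nhds _ hε)).and self_mem_nhdsWithin).exists
    have hseg : ∀ a ∈ ball (φ q) ε, ∀ b ∈ ball (φ q) ε, ∀ s ∈ Icc (0 : ℝ) 1,
        a + (s : ℂ) * (b - a) ∈ V := fun a ha b hb s hs => hεV (by
      have := (convex_ball (φ q) ε).add_smul_sub_mem ha hb hs
      simpa using this)
    have hqb := mem_ball_self (x := φ q) hε
    exact ⟨p, hpb, fun m => ⟨hline _ _ (hseg _ hqb _ hp) m, hline _ _ (hseg _ hp _ hqb) m⟩⟩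
  obtain ⟨p, hp, hpx⟩ := hnear x hx
  obtain ⟨q, hq, hqy⟩ := hnear y hy
  rw [hqy]
  rw [hpx] at hn
  have hseg : ∀ s ∈ Icc (0 : ℝ) 1, p + (s : ℂ) * (q - p) ∈ ball (0 : ℂ) 1 := fun s hs => by
    simpa using (convex_ball (0 : ℂ) 1).add_smul_sub_mem hp hq hs
  have := HasWinding.of_path hc hper (p := fun s => φ (p + (s : ℂ) * (q - p))) (n := n)
    (hφ.comp (Continuous.continuousOn (by fun_prop)) fun s hs => ball_subset_closedBall (hseg s hs))
    (fun s hs => hav _ (image_ball_subset_interior hφ hinj ⟨_, hseg s hs, rfl⟩)) (by simpa using hn)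
  simpa using this

end LipschitzWinding

/-! ### Nearest points and the medial axis -/

section Reach

open Metric Filter Topology

/-- The identification of the Euclidean plane with `ℂ`. -/
noncomputable def toC : Plane ≃ₗᵢ[ℝ] ℂ := Complex.orthonormalBasisOneI.repr.symm

theorem toC_apply (v : Plane) : toC v = v 0 + v 1 * Complex.I :=
  Complex.orthonormalBasisOneI_repr_symm_apply v

theorem exists_eq_add_smul_of_norm_eq_one {F : Plane → Plane} {x : Plane} {ε : ℝ} (hε : 0 < ε)
    (hF : ContinuousOn F (closedBall x ε)) (h1 : ∀ y ∈ closedBall x ε, ‖F y‖ = 1) :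
    ∃ y ∈ closedBall x ε, y = x + ε • F y := by
  have hm : MapsTo (fun z : ℂ => x + ε • toC.symm z) (closedBall 0 1) (closedBall x ε) := by
    intro z hz
    rw [mem_closedBall_zero_iff] at hz
    rw [mem_closedBall_iff_norm, add_sub_cancel_left, norm_smul, Real.norm_of_nonneg hε.le,
      toC.symm.norm_map]
    nlinarith
  obtain ⟨z, hz, hzF⟩ := exists_fixed_point_of_norm_eq_one
    (F := fun z => toC (F (x + ε • toC.symm z)))
    (toC.continuous.comp_continuousOn (hF.comp (Continuous.continuousOn
      (by have := toC.symm.continuous; fun_prop)) hm))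
    (fun z hz => by rw [toC.norm_map]; exact h1 _ (hm hz))
  refine ⟨_, hm hz, ?_⟩
  change x + ε • toC.symm z = x + ε • F (x + ε • toC.symm z)
  rw [← toC.symm_apply_apply (F (x + ε • toC.symm z)), hzF]

/-- A nearest-point projection is continuous away from the medial axis. -/
theorem continuousAt_nearest {K : Set Plane} (hK : IsCompact K) {p : Plane → Plane}
    (hp : ∀ y, p y ∈ K ∧ infDist y K = dist y (p y)) {y : Plane} (hy : y ∉ medialAxis K) :
    ContinuousAt p y := by
  refine hK.tendsto_nhds_of_unique_mapClusterPt (Eventually.of_forall fun z => (hp z).1) ?_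
  intro q hq hcl
  by_contra hne
  refine hy ⟨q, hq, p y, (hp y).1, hne, le_antisymm ?_ (infDist_le_dist_of_mem hq),
    (hp y).2.symm⟩
  refine le_of_forall_pos_le_add fun η hη => ?_
  have h1 := hcl.frequently (ball_mem_nhds q (show 0 < η / 3 by positivity))
  obtain ⟨z, hz1, hz2⟩ := (h1.and_eventually (ball_mem_nhds y (show 0 < η / 3 by positivity))).exists
  have h3 : infDist z K ≤ infDist y K + dist z y := infDist_le_infDist_add_dist
  have h4 := dist_triangle4 y z (p z) q
  rw [← (hp z).2, dist_comm y z] at h4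
  change dist z y < η / 3 at hz2
  linarith

/-- Along the ray from a nearest point `a`, the point `a` remains nearest at least up to the distance
to the medial axis. Indeed, if `a` is nearest to `x = a + s • v`, let `n` be the unit field pointing
away from the nearest point. It is continuous near `x`, so that some `z` satisfies `z = x + ε • n z`
by the fixed point theorem. Then `x` lies between `z` and a nearest point of `z`, which therefore is
`a`, and `z = a + (s + ε) • v`. -/
theorem infDist_add_smul_eq {K : Set Plane} (hK : IsCompact K) {l : ℝ}
    (hl : ∀ k ∈ K, ∀ m ∈ medialAxis K, l ≤ dist k m) {a v : Plane} (ha : a ∈ K) (hv : ‖v‖ = 1)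
    {r : ℝ} (hr0 : 0 < r) (hr : infDist (a + r • v) K = r) {u : ℝ} (hu : u ∈ Ico r l) :
    infDist (a + u • v) K = u := by
  have hKne : K.Nonempty := ⟨a, ha⟩
  choose p hpK hp using fun y => hK.exists_infDist_eq_dist hKne y
  have hda (s : ℝ) (hs : 0 ≤ s) : dist (a + s • v) a = s := by
    rw [dist_eq_norm, add_sub_cancel_left, norm_smul, hv, mul_one, Real.norm_of_nonneg hs]
  suffices Icc r u ⊆ {s | infDist (a + s • v) K = s} from this (right_mem_Icc.2 hu.1)
  refine IsClosed.Icc_subset_of_forall_exists_gt (IsClosed.inter (isClosed_eq ?_ continuous_id)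
    isClosed_Icc) hr ?_
  · have : Continuous fun y => infDist y K := continuous_infDist_pt K
    exact this.comp (by fun_prop)
  rintro s ⟨hs : infDist (a + s • v) K = s, hrs, hsu⟩ y (hy : s < y)
  have hs0 : 0 < s := hr0.trans_le hrs
  have hsl : s < l := hsu.trans hu.2
  set x := a + s • v with hx
  obtain ⟨ε, hε, hεs, hεl, hεy⟩ : ∃ ε > 0, ε < s ∧ s + ε < l ∧ s + ε ≤ y :=
    ⟨min (s / 2) (min ((l - s) / 2) (y - s)), by
        refine lt_min (by linarith) (lt_min (by linarith) (by linarith)),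
      (min_le_left _ _).trans_lt (by linarith),
      by linarith [(min_le_right (s / 2) (min ((l - s) / 2) (y - s))).trans (min_le_left _ _)],
      by linarith [(min_le_right (s / 2) (min ((l - s) / 2) (y - s))).trans (min_le_right _ _)]⟩
  have hpos : ∀ z ∈ closedBall x ε, 0 < ‖z - p z‖ := fun z hz => by
    have h1 : infDist x K ≤ infDist z K + dist x z := infDist_le_infDist_add_dist
    rw [mem_closedBall, dist_comm] at hz
    rw [← dist_eq_norm, ← hp]
    linarith
  have hcont : ContinuousOn p (closedBall x ε) := fun z hz => by
    refine (continuousAt_nearest hK (fun y => ⟨hpK y, hp y⟩) fun hm => ?_).continuousWithinAt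
    have h1 := hl a ha z hm
    have h2 := dist_triangle a x z
    rw [dist_comm a x, hda s hs0.le, dist_comm x z] at h2
    linarith [mem_closedBall.1 hz]
  obtain ⟨z, hz, hzx⟩ := exists_eq_add_smul_of_norm_eq_one
    (F := fun z => ‖z - p z‖⁻¹ • (z - p z)) hε
    (ContinuousOn.smul (ContinuousOn.inv₀ (by fun_prop) fun z hz => (hpos z hz).ne')
      (by fun_prop)) (fun z hz => by
        rw [norm_smul, norm_inv, norm_norm, inv_mul_cancel₀ (hpos z hz).ne'])
  set d := ‖z - p z‖ with hd
  have hd0 := hpos z hz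
  set n := d⁻¹ • (z - p z) with hn
  have hzp : z - p z = d • n := by rw [hn, smul_inv_smul₀ hd0.ne']
  have hn1 : ‖n‖ = 1 := by
    rw [hn, norm_smul, norm_inv, norm_norm, inv_mul_cancel₀ hd0.ne']
  have hxp : x - p z = (d - ε) • n := by
    rw [sub_smul, ← hzp]
    nth_rewrite 2 [hzx]
    abel
  have hinf : infDist z K = d := by rw [hp, dist_eq_norm]
  have hxz : dist z x = ε := by
    rw [dist_eq_norm]
    nth_rewrite 1 [hzx]
    rw [add_sub_cancel_left, norm_smul, hn1, mul_one, Real.norm_of_nonneg hε.le]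
  have hdε : s ≤ |d - ε| := by
    rw [← hs, ← Real.norm_eq_abs, ← mul_one ‖d - ε‖, ← hn1, ← norm_smul, ← hxp, ← dist_eq_norm]
    exact infDist_le_dist_of_mem (hpK z)
  have hds : d ≤ s + ε := by
    have h1 : infDist z K ≤ infDist x K + dist z x := infDist_le_infDist_add_dist
    rw [hinf, hs, hxz] at h1
    exact h1
  have hd_eq : d = s + ε := by
    rcases abs_cases (d - ε) with ⟨h, -⟩ | ⟨h, -⟩ <;> linarith
  have hpa : p z = a := by
    by_contra hne
    have hm : x ∈ medialAxis K := ⟨p z, hpK z, a, ha, hne, by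
      rw [hs, dist_eq_norm, hxp, norm_smul, hn1, hd_eq]
      simp [abs_of_pos hs0], by rw [hs, hda s hs0.le]⟩
    have := hl a ha x hm
    rw [dist_comm, hda s hs0.le] at this
    linarith
  have hnv : n = v := by
    have : x - a = s • n := by rw [← hpa, hxp, hd_eq]; simp
    rw [hx, add_sub_cancel_left] at this
    exact (smul_right_injective _ hs0.ne' this).symm
  refine ⟨s + ε, ?_, by linarith, hεy⟩
  have : a + (s + ε) • v = z := by
    rw [← hd_eq, ← hnv, ← hzp, hpa]; abel
  change infDist (a + (s + ε) • v) K = s + ε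
  rw [this, hinf, hd_eq]

end Reach

/-! ### Winding numbers of the boundary curves of shapes -/

section Shapes

open Metric Filter Topology

variable {Ω : Set Plane} {c : ℝ → Plane} {U : ℝ}

theorem toC_perp (v : Plane) : toC (perp v) = Complex.I * toC v := by
  simp only [toC_apply, perp]
  apply Complex.ext <;> simp

theorem inner_eq_re (v w : Plane) : inner ℝ v w = (toC w * (starRingEnd ℂ) (toC v)).re := by
  rw [← toC.inner_map_map, Complex.inner, mul_comm]

theorem inner_perp_div_eq_im (v w : Plane) :
    inner ℝ (perp v) w / ‖v‖ ^ 2 = (toC w / toC v).im := by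
  rw [inner_eq_re, toC_perp, ← toC.norm_map v, Complex.div_im, ← Complex.normSq_eq_norm_sq]
  simp
  ring

theorem lipschitzWith_toC_comp {K : ℝ≥0} {γ : ℝ → Plane} (hK : LipschitzWith K γ) :
    LipschitzWith K fun t => toC (γ t) := by
  simpa [Function.comp_def] using toC.lipschitz.comp hK

theorem deriv_toC_comp (γ : ℝ → Plane) (t : ℝ) :
    deriv (fun t => toC (γ t)) t = toC (deriv γ t) := by
  by_cases h : DifferentiableAt ℝ γ t
  · exact ((toC.toContinuousLinearEquiv.hasFDerivAt.comp_hasDerivAt t h.hasDerivAt)).deriv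
  · rw [deriv_zero_of_not_differentiableAt h, map_zero, deriv_zero_of_not_differentiableAt]
    exact fun h' => h (by
      simpa [Function.comp_def] using toC.symm.differentiable.differentiableAt.comp t h')

theorem toC_notMem_range {γ : ℝ → Plane} {x : Plane} (hx : x ∉ range γ) :
    toC x ∉ range fun t => toC (γ t) := by
  rintro ⟨t, ht⟩
  exact hx ⟨t, toC.injective ht⟩

/-- The loop `γ` of the plane winds `n` times around the point `x`. -/
def Winds (γ : ℝ → Plane) (x : Plane) (n : ℤ) : Prop :=
  HasWinding (fun t => toC (γ t) - toC x) n

theorem Winds.windingNumber_eq {γ : ℝ → Plane} {K : ℝ≥0} (hK : LipschitzWith K γ)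
    (hper : Function.Periodic γ 1) {x : Plane} (hx : x ∉ range γ) {n : ℤ} (hn : Winds γ x n) :
    windingNumber γ x = n := by
  have hKC := lipschitzWith_toC_comp hK
  have hperC : Function.Periodic (fun t => toC (γ t)) 1 := fun t => by simp [hper t]
  have hxC := toC_notMem_range hx
  have h := congrArg Complex.im (HasWinding.integral_eq hKC hperC hxC hn)
  have him := intervalIntegral.intervalIntegral_im (intervalIntegrable_deriv_div hKC hperC hxC 0 1)
  simp only [RCLike.im_eq_complex_im] at him
  rw [← him] at h
  simp only [deriv_toC_comp, ← map_sub, ← inner_perp_div_eq_im] at h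
  rw [windingNumber, h]
  simp
  field_simp

theorem exists_winds {γ : ℝ → Plane} (hc : Continuous γ) (hper : Function.Periodic γ 1) {x : Plane}
    (hx : x ∉ range γ) : ∃ n, Winds γ x n :=
  exists_hasWinding (by have := toC.continuous; fun_prop)
    (fun t h => hx ⟨t, toC.injective (sub_eq_zero.1 h)⟩) (by simpa using hper 0)

theorem Winds.of_loopHomotopicIn {A : Set Plane} {γ₀ γ₁ : ℝ → Plane}
    (h : LoopHomotopicIn A γ₀ γ₁) {x : Plane} (hx : x ∉ A) {n : ℤ} (hn : Winds γ₀ x n) :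
    Winds γ₁ x n := by
  obtain ⟨H, hH, hA, rfl, rfl⟩ := h
  refine HasWinding.of_homotopy (H := fun s t => toC (H s t) - toC x)
    ((toC.continuous.comp_continuousOn hH).sub continuousOn_const)
    (fun s hs t h => hx (toC.injective (sub_eq_zero.1 h) ▸ (hA s hs).2 t))
    (fun s hs => by simpa using (hA s hs).1 0) hn

theorem IsCenterline.lipschitzWith (hc : IsCenterline c) : LipschitzWith 1 c :=
  lipschitzWith_of_nnnorm_deriv_le (hc.contDiff.differentiable (by norm_num))
    fun t => by rw [← NNReal.coe_le_coe]; simp [hc.unit_speed t]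

theorem IsCenterline.isCompact_range (hc : IsCenterline c) : IsCompact (range c) :=
  hc.periodic.compact_of_continuous one_ne_zero hc.lipschitzWith.continuous

theorem norm_perp (v : Plane) : ‖perp v‖ = ‖v‖ := by
  rw [← toC.norm_map, toC_perp, norm_mul, Complex.norm_I, one_mul, toC.norm_map]

theorem IsCenterline.norm_normal (hc : IsCenterline c) (t : ℝ) : ‖normal c t‖ = 1 := by
  rw [normal, norm_perp, hc.unit_speed]

theorem IsCenterline.infDist_le_of_mem_tube (hc : IsCenterline c) {x : Plane} (hx : x ∈ tube c U) :
    infDist x (range c) ≤ U := by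
  obtain ⟨t, u, hu, rfl⟩ := hx
  refine (infDist_le_dist_of_mem (mem_range_self t)).trans ?_
  rw [dist_eq_norm, add_sub_cancel_left, norm_smul, hc.norm_normal, mul_one]
  exact abs_le.2 hu

theorem range_subset_tube (hU : 0 < U) : range c ⊆ tube c U := by
  rintro _ ⟨t, rfl⟩
  exact ⟨t, 0, ⟨by linarith, hU.le⟩, by simp⟩

/-- The region enclosed by the centerline is not contained in the tube, as one can move away from the
centerline along a normal ray up to the distance `localFeatureSize c`. -/
theorem IsCenterline.exists_notMem_tube_winds_one (hc : IsCenterline c) (hU0 : 0 < U)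
    (hU : U ≤ localFeatureSize c / 3) : ∃ p ∉ tube c U, Winds c p 1 := by
  obtain ⟨x, hx, hwx⟩ := hc.counterclockwise
  have hx1 : Winds c x 1 := by
    obtain ⟨n, hn⟩ := exists_winds hc.lipschitzWith.continuous hc.periodic hx
    rw [hn.windingNumber_eq hc.lipschitzWith hc.periodic hx] at hwx
    rwa [show n = 1 by exact_mod_cast hwx] at hn
  have hK := hc.isCompact_range
  have hlfs : ∀ k ∈ range c, ∀ m ∈ medialAxis (range c), localFeatureSize c ≤ dist k m := by
    rintro _ ⟨t, rfl⟩ m hm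
    exact csInf_le ⟨0, by rintro _ ⟨t, m, -, rfl⟩; exact dist_nonneg⟩ ⟨t, m, hm, rfl⟩
  by_cases hxT : x ∈ tube c U
  swap
  · exact ⟨x, hxT, hx1⟩
  obtain ⟨a, ha, hxa⟩ := hK.exists_infDist_eq_dist (range_nonempty c) x
  set r := infDist x (range c) with hr
  have hr0 : 0 < r := (hK.isClosed.notMem_iff_infDist_pos (range_nonempty c)).1 hx
  have hrU : r ≤ U := hc.infDist_le_of_mem_tube hxT
  set v := r⁻¹ • (x - a)
  have hv : ‖v‖ = 1 := by
    rw [norm_smul, ← dist_eq_norm, ← hxa, Real.norm_of_nonneg (by positivity),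
      inv_mul_cancel₀ hr0.ne']
  have hxv : a + r • v = x := by rw [smul_inv_smul₀ hr0.ne']; abel
  have key (u : ℝ) (hu : u ∈ Ico r (localFeatureSize c)) : infDist (a + u • v) (range c) = u :=
    infDist_add_smul_eq hK hlfs ha hv hr0 (by rw [hxv]) hu
  have h2U : 2 * U ∈ Ico r (localFeatureSize c) := ⟨by linarith, by linarith⟩
  -- The normal ray leaves the tube after the distance `U`, and `2 * U` still is less than the distance
  -- to the medial axis.
  refine ⟨a + (2 * U) • v, fun h => ?_, ?_⟩
  · have := hc.infDist_le_of_mem_tube h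
    rw [key _ h2U] at this
    linarith
  · have := HasWinding.of_path (γ := fun t => toC (c t)) (n := 1)
      (p := fun s => toC (a + (r + s * (2 * U - r)) • v))
      (lipschitzWith_toC_comp hc.lipschitzWith).continuous
      (by simpa using congrArg toC (hc.periodic 0))
      (Continuous.continuousOn (by have := toC.continuous; fun_prop))
      (fun s hs => toC_notMem_range fun h => by
        have h1 : r + s * (2 * U - r) ∈ Ico r (localFeatureSize c) :=
          ⟨by nlinarith [hs.1], by nlinarith [hs.2, h2U.2]⟩
        have h2 := key _ h1
        rw [infDist_zero_of_mem h] at h2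
        linarith [h1.1]) (by simpa [hxv] using! hx1)
    simpa [Winds] using this

theorem exists_disc_param {S : Set Plane} (hS : Nonempty (S ≃ₜ closedBall (0 : Plane) 1)) :
    ∃ (φ : ℂ → ℂ) (ψ : S → ℂ), ContinuousOn φ (closedBall 0 1) ∧ InjOn φ (closedBall 0 1) ∧
      φ '' closedBall 0 1 = toC '' S ∧ Continuous ψ ∧ (∀ x, ψ x ∈ closedBall (0 : ℂ) 1) ∧
      ∀ x, φ (ψ x) = toC x := by
  classical
  obtain ⟨h⟩ := hS
  have hm : ∀ z : ℂ, z ∈ closedBall (0 : ℂ) 1 ↔ toC.symm z ∈ closedBall (0 : Plane) 1 := by simp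
  set φ : ℂ → ℂ := fun z => if hz : toC.symm z ∈ closedBall (0 : Plane) 1 then
    toC (h.symm ⟨_, hz⟩) else 0 with hφ
  have hφ' : ∀ z (hz : z ∈ closedBall (0 : ℂ) 1), φ z = toC (h.symm ⟨_, (hm z).1 hz⟩) :=
    fun z hz => dif_pos ((hm z).1 hz)
  have hψm : ∀ x : S, toC (h x) ∈ closedBall (0 : ℂ) 1 := fun x => by
    rw [hm, toC.symm_apply_apply]; exact (h x).2
  have hφψ : ∀ x : S, φ (toC (h x)) = toC x := fun x => by
    rw [hφ' _ (hψm x)]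
    simp
  refine ⟨φ, fun x => toC (h x), ?_, ?_, ?_, ?_, hψm, hφψ⟩
  · rw [continuousOn_iff_continuous_domRestrict]
    have : (closedBall (0 : ℂ) 1).domRestrict φ = fun z : closedBall (0 : ℂ) 1 =>
        toC (h.symm ⟨toC.symm z, (hm z).1 z.2⟩) := by
      ext z
      exact hφ' z z.2
    rw [this]
    have := toC.continuous
    have := toC.symm.continuous
    fun_prop
  · intro z hz w hw hzw
    rw [hφ' z hz, hφ' w hw] at hzw
    have := h.symm.injective (Subtype.ext (toC.injective hzw))
    exact toC.symm.injective (Subtype.ext_iff.1 this)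
  · ext w
    constructor
    · rintro ⟨z, hz, rfl⟩
      rw [hφ' z hz]
      exact ⟨_, Subtype.coe_prop _, rfl⟩
    · rintro ⟨x, hx, rfl⟩
      exact ⟨_, hψm ⟨x, hx⟩, hφψ ⟨x, hx⟩⟩
  · have := toC.continuous
    fun_prop

/-- The boundary curve of a shape winds zero times around exterior points (it is contractible in the
shape) and once around interior points: the winding number is constant in the interior, which
contains a point outside of the tube around which the centerline winds once. -/
theorem winds_of_mem_Gamma1 (hc : IsCenterline c) (hU0 : 0 < U) (hU : U ≤ localFeatureSize c / 3)
    {S : Set Plane} (hS : IsClosedSimpleShape Ω S) {γ : ℝ → Plane} (hγ : γ ∈ Gamma1 c U)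
    (hγS : range γ = frontier S) :
    (∀ x ∉ S, Winds γ x 0) ∧ ∀ x ∈ interior S, Winds γ x 1 := by
  obtain ⟨-, hScl, hSd⟩ := hS
  obtain ⟨hper, ⟨K, hK⟩, hγT, hhom⟩ := hγ
  obtain ⟨φ, ψ, hφ, hφi, hφS, hψ, hψm, hφψ⟩ := exists_disc_param hSd
  have hγf (t : ℝ) : γ t ∈ frontier S := hγS ▸ mem_range_self t
  have hmS (t : ℝ) : γ t ∈ S := hScl.frontier_subset (hγf t)
  have hout : ∀ x ∉ S, Winds γ x 0 := fun x hx =>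
    hasWinding_zero_of_notMem_disc hφ (ψ := fun t => ψ ⟨γ t, hmS t⟩)
      (hψ.comp (hK.continuous.subtype_mk _)) (by congr 2; simpa using hper 0) (fun t => hψm _)
      (fun t => (hφψ ⟨γ t, hmS t⟩).symm) (by
        rw [hφS]
        rintro ⟨y, hy, hyx⟩
        exact hx (toC.injective hyx ▸ hy))
  refine ⟨hout, fun x hx => ?_⟩
  obtain ⟨p, hpT, hp⟩ := hc.exists_notMem_tube_winds_one hU0 hU
  have hpγ : Winds γ p 1 := hp.of_loopHomotopicIn hhom hpT
  have hpS : p ∈ S := by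
    by_contra h
    have := hpγ.unique (hout p h)
    norm_num at this
  have hpi : p ∈ interior S := by
    rw [← self_sdiff_frontier]
    refine ⟨hpS, fun h => hpT ?_⟩
    rw [← hγS] at h
    obtain ⟨t, rfl⟩ := h
    exact hγT t
  have hint : interior (φ '' closedBall 0 1) = toC '' interior S := by
    rw [hφS]
    exact (toC.toHomeomorph.image_interior S).symm
  refine HasWinding.of_mem_interior_disc (lipschitzWith_toC_comp hK).continuous
    (by simpa using congrArg toC (hper 0)) hφ hφi (fun t h => ?_) (x := toC p) ?_ ?_ hpγ
  · rw [hint] at h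
    obtain ⟨y, hy, hyt⟩ := h
    rw [toC.injective hyt] at hy
    exact (disjoint_interior_frontier.le_bot ⟨hy, hγf t⟩ : False)
  · rw [hint]; exact mem_image_of_mem _ hpi
  · rw [hint]; exact mem_image_of_mem _ hx

theorem IsClosedSimpleShape.isCompact {S : Set Plane} (hS : IsClosedSimpleShape Ω S) :
    IsCompact S := by
  obtain ⟨h⟩ := hS.2.2
  rw [isCompact_iff_compactSpace]
  have := isCompact_iff_compactSpace.1 (isCompact_closedBall (0 : Plane) 1)
  exact h.symm.compactSpace

/-- All shapes agree outside of the tube. -/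
theorem mem_iff_winds_of_notMem_tube (hc : IsCenterline c) (hU0 : 0 < U)
    (hU : U ≤ localFeatureSize c / 3) {S : Set Plane} (hS : IsClosedSimpleShape Ω S)
    {γ : ℝ → Plane} (hγ : γ ∈ Gamma1 c U) (hγS : range γ = frontier S) {x : Plane}
    (hx : x ∉ tube c U) : x ∈ S ↔ Winds c x 1 := by
  obtain ⟨hout, hin⟩ := winds_of_mem_Gamma1 hc hU0 hU hS hγ hγS
  obtain ⟨n, hn⟩ := exists_winds hc.lipschitzWith.continuous hc.periodic
    (fun h => hx (range_subset_tube hU0 h))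
  have hn' := hn.of_loopHomotopicIn hγ.2.2.2 hx
  constructor
  · intro h
    have : x ∈ interior S := by
      rw [← self_sdiff_frontier]
      refine ⟨h, fun h => hx ?_⟩
      rw [← hγS] at h
      obtain ⟨t, rfl⟩ := h
      exact hγ.2.2.1 t
    rwa [hn'.unique (hin x this)] at hn
  · intro h
    by_contra hxS
    have h1 := (h.of_loopHomotopicIn hγ.2.2.2 hx).unique (hout x hxS)
    norm_num at h1

end Shapes

/-! ### The regularized Cauchy kernel -/

section Kernel

open Metric Filter Topology
open scoped ComplexConjugate

/-- The real-linear map `v ↦ a v̄ - b v` of `ℂ`. -/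
noncomputable def conjPair (a b : ℂ) : ℂ →L[ℝ] ℂ :=
  a • (Complex.conjCLE : ℂ →L[ℝ] ℂ) - b • ContinuousLinearMap.id ℝ ℂ

@[simp] theorem conjPair_apply (a b v : ℂ) : conjPair a b v = a * conj v - b * v := by
  simp [conjPair]

theorem conjPair_sub (a b a' b' : ℂ) :
    conjPair a b - conjPair a' b' = conjPair (a - a') (b - b') := by
  ext v; simp; ring

theorem norm_conjPair_le (a b : ℂ) : ‖conjPair a b‖ ≤ ‖a‖ + ‖b‖ := by
  refine ContinuousLinearMap.opNorm_le_bound _ (by positivity) fun v => ?_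
  rw [conjPair_apply]
  refine (norm_sub_le _ _).trans ?_
  rw [norm_mul, norm_mul, RCLike.norm_conj, add_mul]

theorem continuous_conjPair {X : Type*} [TopologicalSpace X] {a b : X → ℂ} (ha : Continuous a)
    (hb : Continuous b) : Continuous fun x => conjPair (a x) (b x) := by
  unfold conjPair
  fun_prop

/-- The regularization `ū / (|u|² + ε²)` of the Cauchy kernel `1 / u`. -/
noncomputable def kern (ε : ℝ) (u : ℂ) : ℂ := (‖u‖ ^ 2 + ε ^ 2)⁻¹ • conj u

/-- The Poisson type kernel `ε² / (|u|² + ε²)²`, the `∂/∂ū` derivative of `kern ε`. -/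
noncomputable def pois (ε : ℝ) (u : ℂ) : ℝ := ε ^ 2 / (‖u‖ ^ 2 + ε ^ 2) ^ 2

/-- The regularization `ū² / (|u|² + ε²)²` of the Beurling kernel `1 / u²`. -/
noncomputable def beur (ε : ℝ) (u : ℂ) : ℂ := (((‖u‖ ^ 2 + ε ^ 2) ^ 2)⁻¹ : ℝ) • conj u ^ 2

theorem hasFDerivAt_kern {ε : ℝ} (hε : 0 < ε) (u : ℂ) :
    HasFDerivAt (kern ε) (conjPair (pois ε u) (beur ε u)) u := by
  have hD : ‖u‖ ^ 2 + ε ^ 2 ≠ 0 := by positivity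
  have h1 : HasFDerivAt (fun u : ℂ => ‖u‖ ^ 2 + ε ^ 2) _ u :=
    ((hasFDerivAt_id u).norm_sq).add_const (ε ^ 2)
  have h2 := (hasDerivAt_inv hD).comp_hasFDerivAt u h1
  have h3 := h2.smul (Complex.conjCLE : ℂ →L[ℝ] ℂ).hasFDerivAt
  refine h3.congr_fderiv ?_
  ext v
  have hin : ((2 * inner ℝ u v : ℝ) : ℂ) = u * conj v + conj u * v := by
    rw [Complex.inner]
    have := Complex.add_conj (v * conj u)
    simp only [map_mul, Complex.conj_conj] at this
    push_cast at this ⊢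
    linear_combination -this
  have hn : ((‖u‖ : ℂ)) ^ 2 = u * conj u := by
    rw [Complex.mul_conj, Complex.normSq_eq_norm_sq]; push_cast; rfl
  have hD' : u * conj u + (ε : ℂ) ^ 2 ≠ 0 := by
    rw [← hn]; exact_mod_cast hD
  simp [pois, beur] at hin ⊢
  rw [hn]
  field_simp
  linear_combination (-(conj u)) * hin

theorem continuous_kern {ε : ℝ} (hε : 0 < ε) : Continuous (kern ε) :=
  continuous_iff_continuousAt.2 fun u => (hasFDerivAt_kern hε u).continuousAt

theorem continuous_pois {ε : ℝ} (hε : 0 < ε) : Continuous (pois ε) := by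
  unfold pois
  have : ∀ u : ℂ, (‖u‖ ^ 2 + ε ^ 2) ^ 2 ≠ 0 := fun u => by positivity
  fun_prop (disch := assumption)

theorem continuous_beur {ε : ℝ} (hε : 0 < ε) : Continuous (beur ε) := by
  unfold beur
  have : ∀ u : ℂ, (‖u‖ ^ 2 + ε ^ 2) ^ 2 ≠ 0 := fun u => by positivity
  fun_prop (disch := assumption)

theorem norm_kern_le (ε : ℝ) (u : ℂ) : ‖kern ε u‖ ≤ ‖u‖⁻¹ := by
  rcases eq_or_ne u 0 with rfl | hu
  · simp [kern]
  have hu' : 0 < ‖u‖ := norm_pos_iff.2 hu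
  rw [kern, norm_smul, RCLike.norm_conj, Real.norm_of_nonneg (by positivity), inv_mul_le_iff₀
    (by positivity), add_mul, sq, mul_assoc, mul_inv_cancel₀ hu'.ne']
  have : 0 ≤ ε ^ 2 * ‖u‖⁻¹ := by positivity
  linarith

theorem tendsto_kern (u : ℂ) : Tendsto (fun ε => kern ε u) (𝓝[>] 0) (𝓝 u⁻¹) := by
  rcases eq_or_ne u 0 with rfl | hu
  · simp [kern]
  have h : Tendsto (fun ε => kern ε u) (𝓝 0) (𝓝 (kern 0 u)) := by
    unfold kern
    refine Tendsto.smul_const ((Continuous.tendsto (by fun_prop) 0).inv₀ ?_) _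
    positivity
  have h0 : kern 0 u = u⁻¹ := by
    rw [kern, Complex.inv_def, Complex.normSq_eq_norm_sq]
    simp [mul_comm]
  rw [← h0]
  exact h.mono_left nhdsWithin_le_nhds

theorem pois_nonneg (ε : ℝ) (u : ℂ) : 0 ≤ pois ε u := by unfold pois; positivity

theorem pois_one_le (u : ℂ) : pois 1 u ≤ 4 * (1 + ‖u‖) ^ (-4 : ℝ) := by
  have h : (0 : ℝ) < 1 + ‖u‖ := by positivity
  rw [pois, Real.rpow_neg h.le, show (4 : ℝ) = (4 : ℕ) by norm_num, Real.rpow_natCast,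
    div_le_iff₀ (by positivity), mul_assoc, ← div_eq_inv_mul]
  push_cast
  rw [mul_div_assoc', le_div_iff₀ (by positivity)]
  have h1 : (1 + ‖u‖) ^ 2 ≤ 2 * (‖u‖ ^ 2 + 1 ^ 2) := by nlinarith [sq_nonneg (‖u‖ - 1)]
  have h2 := pow_le_pow_left₀ (by positivity) h1 2
  nlinarith

theorem integrable_pois_one_mul_norm_rpow {α : ℝ} (h0 : 0 ≤ α) (h1 : α ≤ 1) :
    Integrable fun u : ℂ => pois 1 u * ‖u‖ ^ α := by
  refine ((integrable_one_add_norm (E := ℂ) (μ := volume) (r := 3)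
    (by rw [Complex.finrank_real_complex]; norm_num)).const_mul 4).mono' ?_ (ae_of_all _ fun u => ?_)
  · refine (Continuous.mul (continuous_pois one_pos) ?_).aestronglyMeasurable
    exact continuous_norm.rpow_const fun u => Or.inr h0
  · have h : (0 : ℝ) < 1 + ‖u‖ := by positivity
    have hp := pois_nonneg 1 u
    rw [Real.norm_of_nonneg (by positivity)]
    have h2 : ‖u‖ ^ α ≤ (1 + ‖u‖) ^ (1 : ℝ) :=
      (Real.rpow_le_rpow (norm_nonneg u) (by linarith) h0).trans
        (Real.rpow_le_rpow_of_exponent_le (by linarith [norm_nonneg u]) h1)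
    calc pois 1 u * ‖u‖ ^ α ≤ 4 * (1 + ‖u‖) ^ (-4 : ℝ) * (1 + ‖u‖) ^ (1 : ℝ) :=
          mul_le_mul (pois_one_le u) h2 (by positivity) (by positivity)
      _ = 4 * (1 + ‖u‖) ^ (-3 : ℝ) := by rw [mul_assoc, ← Real.rpow_add h]; norm_num

theorem integrable_pois_one : Integrable (pois 1) := by
  simpa using integrable_pois_one_mul_norm_rpow le_rfl zero_le_one

theorem integral_pois_one : ∫ u : ℂ, pois 1 u = Real.pi := by
  have h := integral_fun_norm_addHaar (volume : Measure ℂ) (fun r : ℝ => 1 ^ 2 / (r ^ 2 + 1 ^ 2) ^ 2)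
  change ∫ u : ℂ, pois 1 u = _ at h
  have hd (x : ℝ) : HasDerivAt (fun r : ℝ => -(1 / 2) * (r ^ 2 + 1)⁻¹)
      (x ^ (2 - 1) • (1 ^ 2 / (x ^ 2 + 1 ^ 2) ^ 2)) x := by
    have h1 : x ^ 2 + 1 ≠ 0 := by positivity
    convert! ((((hasDerivAt_id x).pow 2).add_const (1 : ℝ)).inv h1).const_mul (-(1 / 2)) using 1
    simp
    field_simp
  have hlim : Tendsto (fun r : ℝ => -(1 / 2) * (r ^ 2 + 1)⁻¹) atTop (𝓝 (-(1 / 2) * 0)) := by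
    refine Tendsto.const_mul _ (tendsto_inv_atTop_zero.comp ?_)
    exact tendsto_atTop_add_const_right _ _ (tendsto_pow_atTop two_ne_zero)
  have hi := integral_Ioi_of_hasDerivAt_of_nonneg (hd 0).continuousAt.continuousWithinAt
    (fun x _ => hd x) (fun x (hx : 0 < x) => by simp only [smul_eq_mul]; positivity) hlim
  rw [h, Complex.finrank_real_complex, hi, Measure.real, Complex.volume_ball]
  simp
  ring

theorem integral_pois_mul {ε : ℝ} (hε : 0 < ε) (F : ℂ → ℂ) :
    ∫ u, (pois ε u : ℂ) * F u = ∫ v, (pois 1 v : ℂ) * F (ε • v) := by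
  have h := Measure.integral_comp_smul (volume : Measure ℂ) (fun u => (pois ε u : ℂ) * F u) ε
  rw [Complex.finrank_real_complex, abs_of_pos (by positivity)] at h
  rw [← inv_smul_smul₀ (pow_ne_zero 2 hε.ne') (∫ u, _), smul_comm, ← h, ← integral_smul]
  congr 1
  ext v
  have : pois 1 v = ε ^ 2 * pois ε (ε • v) := by
    rw [pois, pois, norm_smul, Real.norm_of_nonneg hε.le]
    field_simp
  rw [this]
  simp [mul_assoc]

theorem tendsto_integral_pois_mul {f : ℂ → ℂ} (hf : Continuous f) {B : ℝ} (hB : ∀ z, ‖f z‖ ≤ B)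
    (z : ℂ) : Tendsto (fun ε => ∫ u, (pois ε u : ℂ) * f (z - u)) (𝓝[>] 0) (𝓝 (Real.pi * f z)) := by
  have h : Tendsto (fun ε : ℝ => ∫ v, (pois 1 v : ℂ) * f (z - ε • v)) (𝓝[>] 0)
      (𝓝 (∫ v, (pois 1 v : ℂ) * f z)) := by
    refine tendsto_integral_filter_of_dominated_convergence (fun v => pois 1 v * B) ?_ ?_
      (integrable_pois_one.mul_const B) ?_
    · refine Eventually.of_forall fun ε => Continuous.aestronglyMeasurable ?_
      have := continuous_pois one_pos
      fun_prop
    · refine Eventually.of_forall fun ε => ae_of_all _ fun v => ?_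
      rw [norm_mul, Complex.norm_real, Real.norm_of_nonneg (pois_nonneg _ _)]
      exact mul_le_mul_of_nonneg_left (hB _) (pois_nonneg _ _)
    · refine ae_of_all _ fun v => ?_
      have : Continuous fun ε : ℝ => (pois 1 v : ℂ) * f (z - ε • v) := by fun_prop
      simpa using (this.tendsto 0).mono_left nhdsWithin_le_nhds
  rw [integral_mul_const, integral_complex_ofReal, integral_pois_one] at h
  refine h.congr' ?_
  filter_upwards [self_mem_nhdsWithin] with ε hε
  rw [integral_pois_mul hε fun u => f (z - u)]

theorem integrableOn_ball_norm_rpow {s : ℝ} (hs : s < 2) (R : ℝ) :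
    IntegrableOn (fun u : ℂ => ‖u‖ ^ (-s)) (ball 0 R) := by
  refine integrableOn_ball_of_norm_le_rpow (C := 1) (α := s)
    (by rw [Complex.finrank_real_complex]; norm_num)
    (by rw [Complex.finrank_real_complex]; exact_mod_cast hs) (ae_of_all _ fun u => ?_) ?_
  · rw [one_mul, Real.norm_of_nonneg (by positivity)]
  · exact (measurable_norm.pow_const _).aestronglyMeasurable

theorem integrableOn_ball_inv_norm (R : ℝ) : IntegrableOn (fun u : ℂ => ‖u‖⁻¹) (ball 0 R) := by
  simpa [Real.rpow_neg_one] using integrableOn_ball_norm_rpow (s := 1) (by norm_num) R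

theorem integral_ball_inv_norm {ρ : ℝ} (hρ : 0 < ρ) :
    ∫ u in ball (0 : ℂ) ρ, ‖u‖⁻¹ = 2 * Real.pi * ρ := by
  have h := integral_fun_norm_addHaar (volume : Measure ℂ) ((Iio ρ).indicator fun r : ℝ => r⁻¹)
  have h1 : (fun u : ℂ => (Iio ρ).indicator (fun r : ℝ => r⁻¹) ‖u‖)
      = (ball (0 : ℂ) ρ).indicator fun u => ‖u‖⁻¹ := by
    ext u
    simp [indicator]
  have h2 : EqOn (fun y : ℝ => y ^ (2 - 1) • (Iio ρ).indicator (fun r : ℝ => r⁻¹) y)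
      ((Iio ρ).indicator fun _ => 1) (Ioi 0) := by
    intro y (hy : 0 < y)
    by_cases hyr : y < ρ <;> simp [hyr, hy.ne']
  rw [h1, integral_indicator measurableSet_ball, Complex.finrank_real_complex,
    setIntegral_congr_fun measurableSet_Ioi h2, setIntegral_indicator measurableSet_Iio,
    Ioi_inter_Iio, Measure.real, Complex.volume_ball] at h
  rw [h]
  simp [hρ.le]
  ring

/-- The Cauchy kernel is integrable on a set of finite area, with an integral that is small if the area
is small: split the set at the distance `ρ` from the pole. -/
theorem integrableOn_inv_norm_sub {V : Set ℂ} (hV : volume V ≠ ⊤) (z : ℂ) {ρ : ℝ} (hρ : 0 < ρ) :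
    IntegrableOn (fun w => ‖z - w‖⁻¹) V ∧
      ∫ w in V, ‖z - w‖⁻¹ ≤ 2 * Real.pi * ρ + volume.real V / ρ := by
  have hi : Integrable fun w : ℂ => (ball (0 : ℂ) ρ).indicator (fun u => ‖u‖⁻¹) (z - w) :=
    ((integrable_indicator_iff measurableSet_ball).2 (integrableOn_ball_inv_norm ρ)).comp_sub_left z
  have hc : IntegrableOn (fun _ : ℂ => ρ⁻¹) V := integrableOn_const hV
  have hsum := hi.integrableOn.add hc (s := V)
  have hle (w : ℂ) : ‖z - w‖⁻¹ ≤ (ball (0 : ℂ) ρ).indicator (fun u => ‖u‖⁻¹) (z - w) + ρ⁻¹ := by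
    by_cases h : z - w ∈ ball (0 : ℂ) ρ
    · rw [indicator_of_mem h]
      have : 0 < ρ⁻¹ := by positivity
      linarith
    · rw [indicator_of_notMem h, zero_add]
      rw [mem_ball_zero_iff, not_lt] at h
      exact inv_anti₀ hρ h
  have hint : IntegrableOn (fun w => ‖z - w‖⁻¹) V := by
    refine hsum.mono' (Measurable.aestronglyMeasurable (by fun_prop)) (ae_of_all _ fun w => ?_)
    rw [Real.norm_of_nonneg (by positivity)]
    exact hle w
  refine ⟨hint, (integral_mono hint hsum hle).trans ?_⟩
  simp only [Pi.add_apply]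
  rw [integral_add hi.integrableOn hc, setIntegral_const, smul_eq_mul, ← div_eq_mul_inv]
  gcongr
  calc _ ≤ ∫ w : ℂ, (ball (0 : ℂ) ρ).indicator (fun u => ‖u‖⁻¹) (z - w) :=
        setIntegral_le_integral hi (ae_of_all _ fun w => indicator_nonneg (fun _ _ => by positivity) _)
    _ = _ := by
        rw [integral_sub_left_eq_self (fun u : ℂ => (ball (0 : ℂ) ρ).indicator (fun u => ‖u‖⁻¹) u),
          integral_indicator measurableSet_ball, integral_ball_inv_norm hρ]

end Kernel

/-! ### The Cauchy-Pompeiu formula and Stokes' theorem for Lipschitz loops -/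

section Stokes

open Metric Filter Topology
open scoped ComplexConjugate

/-- The Cauchy-Riemann operator `∂h/∂z̄`. -/
noncomputable def dbar (h : ℂ → ℂ) (w : ℂ) : ℂ :=
  1 / 2 * (fderiv ℝ h w 1 + Complex.I * fderiv ℝ h w Complex.I)

theorem continuous_dbar {h : ℂ → ℂ} (hh : ContDiff ℝ 1 h) : Continuous (dbar h) := by
  have := hh.continuous_fderiv one_ne_zero
  unfold dbar
  fun_prop

theorem hasCompactSupport_dbar {h : ℂ → ℂ} (hc : HasCompactSupport h) :
    HasCompactSupport (dbar h) := by
  refine (hc.fderiv (𝕜 := ℝ)).mono fun w hw => ?_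
  contrapose! hw
  simp only [Function.mem_support, not_not] at hw ⊢
  simp [dbar, hw]

theorem exists_norm_dbar_mul_inv_le {h : ℂ → ℂ} (hh : ContDiff ℝ 1 h) (hc : HasCompactSupport h) :
    ∃ (V : Set ℂ) (M : ℝ), MeasurableSet V ∧ volume V ≠ ⊤ ∧
      0 ≤ M ∧ ∀ w, ∀ z : ℂ, ‖dbar h w‖ * ‖z - w‖⁻¹ ≤ M * V.indicator (fun w => ‖z - w‖⁻¹) w := by
  have hcs := hasCompactSupport_dbar hc
  obtain ⟨M, hM⟩ := (continuous_dbar hh).bounded_above_of_compact_support hcs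
  refine ⟨tsupport (dbar h), |M|, (isClosed_tsupport _).measurableSet, hcs.measure_lt_top.ne,
    abs_nonneg M, fun w z => ?_⟩
  by_cases hw : w ∈ tsupport (dbar h)
  · rw [indicator_of_mem hw]
    exact mul_le_mul_of_nonneg_right ((hM w).trans (le_abs_self M)) (by positivity)
  · rw [indicator_of_notMem hw, image_eq_zero_of_notMem_tsupport hw]
    simp

/-- The Cauchy-Pompeiu formula. It is the limit `ε → 0` of the convolution identity
`kern ε * ∂h/∂z̄ = pois ε * h`. -/
theorem integral_dbar_mul_inv {h : ℂ → ℂ} (hh : ContDiff ℝ 1 h) (hc : HasCompactSupport h)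
    (z : ℂ) : ∫ w, dbar h w * (z - w)⁻¹ = Real.pi * h z := by
  have hdb := continuous_dbar hh
  have hcont := hh.continuous
  have hfd := hh.continuous_fderiv one_ne_zero
  have hreg (ε : ℝ) (hε : 0 < ε) :
      ∫ w, dbar h w * kern ε (z - w) = ∫ u, (pois ε u : ℂ) * h (z - u) := by
    have hk := continuous_kern hε
    have hp := continuous_pois hε
    have hb := continuous_beur hε
    have hder (w : ℂ) : HasFDerivAt (fun w => kern ε (z - w))
        ((conjPair (pois ε (z - w)) (beur ε (z - w))).comp (-ContinuousLinearMap.id ℝ ℂ)) w :=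
      (hasFDerivAt_kern hε (z - w)).comp w ((hasFDerivAt_id w).const_sub z)
    have hfdk (v w : ℂ) : fderiv ℝ (fun w => kern ε (z - w)) w v
        = -conjPair (pois ε (z - w)) (beur ε (z - w)) v := by
      rw [(hder w).fderiv]
      simp
    have hint1 (v : ℂ) : Integrable fun w => kern ε (z - w) * fderiv ℝ h w v :=
      Continuous.integrable_of_hasCompactSupport (by fun_prop)
        (((hc.fderiv_apply (𝕜 := ℝ) v)).mul_left)
    have hint2 (v : ℂ) : Integrable fun w => fderiv ℝ (fun w => kern ε (z - w)) w v * h w := by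
      refine Continuous.integrable_of_hasCompactSupport ?_ hc.mul_left
      simp only [hfdk, conjPair_apply]
      fun_prop
    have hparts (v : ℂ) := integral_mul_fderiv_eq_neg_fderiv_mul_of_integrable (μ := volume)
      (f := fun w => kern ε (z - w)) (g := h) (v := v) (hint2 v) (hint1 v)
      (Continuous.integrable_of_hasCompactSupport (by fun_prop) hc.mul_left)
      (fun w _ => (hder w).differentiableAt)
      (fun w _ => (hh.differentiable one_ne_zero).differentiableAt)
    have hsub := integral_sub_left_eq_self (fun u => (pois ε u : ℂ) * h (z - u)) volume z
    simp only [sub_sub_cancel] at hsub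
    rw [← hsub]
    calc ∫ w, dbar h w * kern ε (z - w)
        = ∫ w, (1 / 2 * (kern ε (z - w) * fderiv ℝ h w 1)
          + 1 / 2 * Complex.I * (kern ε (z - w) * fderiv ℝ h w Complex.I)) := by
          congr 1; ext w; rw [dbar]; ring
      _ = -(1 / 2 * (∫ w, fderiv ℝ (fun w => kern ε (z - w)) w 1 * h w)
          + 1 / 2 * Complex.I * ∫ w, fderiv ℝ (fun w => kern ε (z - w)) w Complex.I * h w) := by
          rw [integral_add ((hint1 1).const_mul _) ((hint1 _).const_mul _), integral_const_mul,
            integral_const_mul, hparts, hparts]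
          ring
      _ = ∫ w, -(1 / 2 * (fderiv ℝ (fun w => kern ε (z - w)) w 1 * h w)
          + 1 / 2 * Complex.I * (fderiv ℝ (fun w => kern ε (z - w)) w Complex.I * h w)) := by
          rw [integral_neg, integral_add ((hint2 1).const_mul _) ((hint2 _).const_mul _),
            integral_const_mul, integral_const_mul]
      _ = _ := by
          congr 1; ext w
          rw [hfdk, hfdk]
          simp
          linear_combination (1 / 2 * h w) * (-(pois ε (z - w) : ℂ) - beur ε (z - w)) * Complex.I_sq
  obtain ⟨V, M, hV, hVt, hM, hle⟩ := exists_norm_dbar_mul_inv_le hh hc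
  have hlim : Tendsto (fun ε => ∫ w, dbar h w * kern ε (z - w)) (𝓝[>] 0)
      (𝓝 (∫ w, dbar h w * (z - w)⁻¹)) := by
    refine tendsto_integral_filter_of_dominated_convergence
      (fun w => M * V.indicator (fun w => ‖z - w‖⁻¹) w) ?_ ?_ ?_ ?_
    · filter_upwards [self_mem_nhdsWithin] with ε hε
      have hk := continuous_kern hε
      exact Continuous.aestronglyMeasurable (by fun_prop)
    · refine Eventually.of_forall fun ε => ae_of_all _ fun w => (norm_mul_le _ _).trans ?_
      exact (mul_le_mul_of_nonneg_left (norm_kern_le _ _) (norm_nonneg _)).trans (hle w z)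
    · exact ((integrable_indicator_iff hV).2 (integrableOn_inv_norm_sub hVt z one_pos).1).const_mul M
    · exact ae_of_all _ fun w => (tendsto_kern (z - w)).const_mul _
  obtain ⟨B, hB⟩ := hcont.bounded_above_of_compact_support hc
  refine tendsto_nhds_unique hlim ((tendsto_integral_pois_mul hcont hB z).congr' ?_)
  filter_upwards [self_mem_nhdsWithin] with ε hε
  rw [hreg ε hε]

theorem volume_range_eq_zero {γ : ℝ → ℂ} {K : ℝ≥0} (hK : LipschitzWith K γ) :
    volume (range γ) = 0 := by
  have h1 : dimH (range γ) ≤ 1 := by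
    simpa [Real.dimH_univ] using hK.dimH_range_le
  have h2 : dimH (range γ) < ((2 : ℝ≥0) : ENNReal) := h1.trans_lt (by norm_num)
  have h3 := hausdorffMeasure_of_dimH_lt h2
  have : (MeasureTheory.Measure.hausdorffMeasure (2 : ℝ) : Measure ℂ).IsAddHaarMeasure := by
    have := isAddHaarMeasure_hausdorffMeasure (E := ℂ)
    rwa [Complex.finrank_real_complex] at this
  exact (Measure.absolutelyContinuous_isAddHaarMeasure volume
    (MeasureTheory.Measure.hausdorffMeasure (2 : ℝ) : Measure ℂ)) h3

/-- Stokes' theorem for a Lipschitz loop that winds once around the points of `A` and zero times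
around other points: insert the Cauchy-Pompeiu formula in the contour integral and exchange the
integrals, so that the winding number appears. -/
theorem integral_mul_deriv_eq_integral_dbar {γ : ℝ → ℂ} {K : ℝ≥0} (hK : LipschitzWith K γ)
    (hper : Function.Periodic γ 1) {h : ℂ → ℂ} (hh : ContDiff ℝ 1 h) (hc : HasCompactSupport h)
    {A : Set ℂ} (hA : MeasurableSet A)
    (hw0 : ∀ w ∉ range γ, w ∉ A → HasWinding (fun t => γ t - w) 0)
    (hw1 : ∀ w ∉ range γ, w ∈ A → HasWinding (fun t => γ t - w) 1) :
    ∫ t in (0 : ℝ)..1, h (γ t) * deriv γ t = 2 * Complex.I * ∫ w in A, dbar h w := by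
  obtain ⟨V, M, hV, hVt, hM, hle⟩ := exists_norm_dbar_mul_inv_le hh hc
  have hdb := (continuous_dbar hh).measurable
  have hγm := hK.continuous.measurable
  have hγ' := measurable_deriv γ
  set f : ℝ → ℂ → ℂ := fun t w => deriv γ t * (dbar h w * (γ t - w)⁻¹)
  have hmeas : Measurable (Function.uncurry f) := by
    simp only [f, Function.uncurry_def]
    fun_prop
  have hbd (t : ℝ) (w : ℂ) : ‖f t w‖ ≤ K * (M * V.indicator (fun w => ‖γ t - w‖⁻¹) w) := by
    rw [norm_mul, norm_mul, norm_inv]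
    exact mul_le_mul (norm_deriv_le_of_lipschitz hK) (hle w _) (by positivity) K.2
  have hbi (t : ℝ) : Integrable fun w => K * (M * V.indicator (fun w => ‖γ t - w‖⁻¹) w) :=
    ((((integrable_indicator_iff hV).2 (integrableOn_inv_norm_sub hVt _ one_pos).1).const_mul
      M).const_mul _)
  have hfi (t : ℝ) : Integrable (f t) :=
    (hbi t).mono' (hmeas.comp measurable_prodMk_left).aestronglyMeasurable (ae_of_all _ (hbd t))
  have hprod : Integrable (Function.uncurry f) ((volume.restrict (Ioc (0 : ℝ) 1)).prod volume) := by
    rw [integrable_prod_iff hmeas.aestronglyMeasurable]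
    refine ⟨ae_of_all _ hfi, ?_⟩
    refine (integrable_const (K * (M * (2 * Real.pi * 1 + volume.real V / 1)))).mono'
      (hmeas.norm.stronglyMeasurable.integral_prod_right').aestronglyMeasurable
      (ae_of_all _ fun t => ?_)
    rw [Real.norm_of_nonneg (by positivity)]
    refine (integral_mono (hfi t).norm (hbi t) (hbd t)).trans ?_
    rw [integral_const_mul, integral_const_mul, integral_indicator hV]
    exact mul_le_mul_of_nonneg_left (mul_le_mul_of_nonneg_left
      (integrableOn_inv_norm_sub hVt _ one_pos).2 hM) K.2
  have hswap := integral_integral_swap hprod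
  have hpi : (Real.pi : ℂ) ≠ 0 := Complex.ofReal_ne_zero.2 Real.pi_ne_zero
  have hleft (t : ℝ) : ∫ w, f t w = Real.pi * (h (γ t) * deriv γ t) := by
    rw [integral_const_mul, integral_dbar_mul_inv hh hc]
    ring
  have hright : ∀ᵐ w : ℂ, ∫ t in Ioc (0 : ℝ) 1, f t w
      = A.indicator (fun w => 2 * Real.pi * Complex.I * dbar h w) w := by
    filter_upwards [measure_eq_zero_iff_ae_notMem.1 (volume_range_eq_zero hK)] with w hw
    have h1 : ∫ t in Ioc (0 : ℝ) 1, f t w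
        = dbar h w * ∫ t in (0 : ℝ)..1, deriv γ t / (γ t - w) := by
      rw [intervalIntegral.integral_of_le zero_le_one, ← integral_const_mul]
      congr 1
      ext t
      simp only [f]
      ring
    rw [h1]
    by_cases hwA : w ∈ A
    · rw [indicator_of_mem hwA, (hw1 w hw hwA).integral_eq hK hper hw]
      push_cast
      ring
    · rw [indicator_of_notMem hwA, (hw0 w hw hwA).integral_eq hK hper hw]
      simp
  simp only [hleft] at hswap
  rw [integral_congr_ae hright, integral_indicator hA, integral_const_mul, integral_const_mul,
    ← intervalIntegral.integral_of_le zero_le_one] at hswap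
  refine mul_left_cancel₀ hpi (hswap.trans ?_)
  ring

end Stokes

/-! ### Circulation along the boundary of a shape -/

section Circulation

open Metric Filter Topology
open scoped ComplexConjugate

variable {Ω : Set Plane} {c : ℝ → Plane} {U : ℝ}

theorem toC_symm_one : toC.symm 1 = EuclideanSpace.single 0 1 := by
  rw [LinearIsometryEquiv.symm_apply_eq, toC_apply]
  simp

theorem toC_symm_I : toC.symm Complex.I = EuclideanSpace.single 1 1 := by
  rw [LinearIsometryEquiv.symm_apply_eq, toC_apply]
  simp

theorem toC_re (v : Plane) : (toC v).re = v 0 := by simp [toC_apply]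

theorem toC_im (v : Plane) : (toC v).im = v 1 := by simp [toC_apply]

theorem continuous_curl {g : Plane → Plane} (hg : ContDiff ℝ 1 g) : Continuous (curl g) := by
  have := hg.continuous_fderiv one_ne_zero
  unfold curl
  fun_prop

theorem setIntegral_toC_image (S : Set Plane) (F : ℂ → ℝ) :
    ∫ w in toC '' S, F w = ∫ x in S, F (toC x) :=
  toC.measurePreserving.setIntegral_image_emb toC.toHomeomorph.measurableEmbedding F S

theorem measurableSet_toC_image {S : Set Plane} (hS : MeasurableSet S) :
    MeasurableSet (toC '' S) :=
  toC.toHomeomorph.measurableEmbedding.measurableSet_image.2 hS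

/-- Green's formula for a Lipschitz loop that traverses the boundary of a compact set once. -/
theorem integral_inner_deriv_eq_integral_curl {γ : ℝ → Plane} {K : ℝ≥0} (hK : LipschitzWith K γ)
    (hper : Function.Periodic γ 1) {g : Plane → Plane} (hg : ContDiff ℝ 1 g) {S : Set Plane}
    (hS : IsCompact S) (hγS : range γ = frontier S) (h0 : ∀ x ∉ S, Winds γ x 0)
    (h1 : ∀ x ∈ interior S, Winds γ x 1) :
    ∫ t in (0 : ℝ)..1, inner ℝ (g (γ t)) (deriv γ t) = ∫ x in S, curl g x := by
  obtain ⟨R, hR0, hR⟩ := (hS.image toC.continuous).isBounded.subset_ball_lt 0 0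
  let b : ContDiffBump (0 : ℂ) := ⟨R, R + 1, hR0, by linarith⟩
  set h₀ : ℂ → ℂ := fun z => conj (toC (g (toC.symm z))) with hh₀
  set h : ℂ → ℂ := fun z => (b z : ℂ) * h₀ z with hh
  have hh₀c : ContDiff ℝ 1 h₀ := Complex.conjCLE.contDiff.comp
    (toC.contDiff.comp (hg.comp toC.symm.contDiff))
  have hhc : ContDiff ℝ 1 h := (Complex.ofRealCLM.contDiff.comp b.contDiff).mul hh₀c
  have hhs : HasCompactSupport h := by
    refine HasCompactSupport.mul_right ?_
    exact b.hasCompactSupport.comp_left (g := ((↑) : ℝ → ℂ)) Complex.ofReal_zero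
  have hKC := lipschitzWith_toC_comp hK
  have hfr : ∀ t, γ t ∈ S := fun t => hS.isClosed.frontier_subset (hγS ▸ mem_range_self t)
  have key := integral_mul_deriv_eq_integral_dbar hKC (fun t => by simp [hper t]) hhc hhs
    (measurableSet_toC_image hS.measurableSet)
    (fun w hw hwS => by
      have := h0 (toC.symm w) (fun hx => hwS ⟨_, hx, by simp⟩)
      simpa [Winds] using this)
    (fun w hw hwS => by
      obtain ⟨x, hx, rfl⟩ := hwS
      refine h1 x ?_
      rw [← self_sdiff_frontier]
      refine ⟨hx, fun hf => hw ?_⟩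
      rw [← hγS] at hf
      obtain ⟨t, rfl⟩ := hf
      exact ⟨t, rfl⟩)
  have hleft (t : ℝ) : (h (toC (γ t)) * deriv (fun t => toC (γ t)) t).re
      = inner ℝ (g (γ t)) (deriv γ t) := by
    rw [deriv_toC_comp, inner_eq_re, hh]
    simp only [hh₀]
    rw [b.one_of_mem_closedBall (ball_subset_closedBall (hR ⟨_, hfr t, rfl⟩))]
    simp
    ring
  have hdb : ∀ w ∈ toC '' S, (2 * Complex.I * dbar h w).re = curl g (toC.symm w) := by
    intro w hw
    have hev : h =ᶠ[𝓝 w] h₀ := by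
      filter_upwards [isOpen_ball.mem_nhds (hR hw)] with z hz
      simp [hh, b.one_of_mem_closedBall (ball_subset_closedBall hz)]
    have hfd (v : ℂ) : fderiv ℝ h₀ w v = conj (toC (fderiv ℝ g (toC.symm w) (toC.symm v))) := by
      have h2 : HasFDerivAt h₀ _ w := Complex.conjCLE.hasFDerivAt.comp w
        (toC.toContinuousLinearEquiv.hasFDerivAt.comp w
          (((hg.differentiable one_ne_zero) (toC.symm w)).hasFDerivAt.comp w
            toC.symm.toContinuousLinearEquiv.hasFDerivAt))
      rw [h2.fderiv]
      rfl
    rw [dbar, hev.fderiv_eq, hfd, hfd, toC_symm_one, toC_symm_I, curl, ← toC_im, ← toC_re]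
    simp
    ring
  have hdbi : IntegrableOn (fun w => 2 * Complex.I * dbar h w) (toC '' S) := by
    have := continuous_dbar hhc
    exact (Continuous.continuousOn (by fun_prop)).integrableOn_compact (hS.image toC.continuous)
  have hli : IntervalIntegrable (fun t => h (toC (γ t)) * deriv (fun t => toC (γ t)) t)
      volume 0 1 := by
    obtain ⟨B, hB⟩ := hhc.continuous.bounded_above_of_compact_support hhs
    refine (intervalIntegrable_const (c := (B * K : ℝ))).mono_fun ?_ (ae_of_all _ fun t => ?_)
    · have := measurable_deriv fun t => toC (γ t)
      have := hKC.continuous.measurable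
      have := hhc.continuous.measurable
      exact Measurable.aestronglyMeasurable (by fun_prop)
    · refine (norm_mul_le _ _).trans (le_trans ?_ (le_abs_self _))
      exact mul_le_mul (hB _) (norm_deriv_le_of_lipschitz hKC) (norm_nonneg _)
        ((norm_nonneg _).trans (hB 0))
  rw [← integral_const_mul] at key
  have hre := congrArg Complex.re key
  have e1 := intervalIntegral.intervalIntegral_re hli
  have e2 := Complex.reCLM.integral_comp_comm hdbi
  simp only [RCLike.re_eq_complex_re, hleft] at e1
  simp only [Complex.reCLM_apply] at e2
  rw [← e1, ← e2, setIntegral_congr_fun (measurableSet_toC_image hS.measurableSet) hdb,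
    setIntegral_toC_image S fun w => curl g (toC.symm w)] at hre
  simpa using hre

theorem continuous_perp : Continuous perp := by
  have : perp = fun v => toC.symm (Complex.I * toC v) := by
    ext1 v
    rw [← toC_perp, toC.symm_apply_apply]
  rw [this]
  have := toC.continuous
  have := toC.symm.continuous
  fun_prop

theorem IsCenterline.continuous_normal (hc : IsCenterline c) : Continuous (normal c) :=
  continuous_perp.comp (hc.contDiff.continuous_deriv (by norm_num))

theorem IsCenterline.isCompact_tube (hc : IsCenterline c) (U : ℝ) : IsCompact (tube c U) := by
  have hn := hc.continuous_normal
  have hcc := hc.lipschitzWith.continuous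
  have : tube c U = (fun p : ℝ × ℝ => c p.1 + p.2 • normal c p.1) '' (Icc 0 1 ×ˢ Icc (-U) U) := by
    ext x
    constructor
    · rintro ⟨t, u, hu, rfl⟩
      have hnper : Function.Periodic (normal c) 1 := fun s => by
        have : deriv c (s + 1) = deriv c s := by
          rw [← deriv_comp_add_const]
          congr 1
          exact funext hc.periodic
        simp [normal, this]
      refine ⟨(Int.fract t, u), ⟨⟨Int.fract_nonneg t, (Int.fract_lt_one t).le⟩, hu⟩, ?_⟩
      have h1 := hc.periodic.sub_int_mul_eq ⌊t⌋ (x := t)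
      have h2 := hnper.sub_int_mul_eq ⌊t⌋ (x := t)
      rw [mul_one] at h1 h2
      simp only [Int.fract, h1, h2]
    · rintro ⟨⟨t, u⟩, ⟨-, hu⟩, rfl⟩
      exact ⟨t, u, hu, rfl⟩
  rw [this]
  exact (isCompact_Icc.prod isCompact_Icc).image (by fun_prop)

theorem integral_inner_boundary_eq (hc : IsCenterline c) (hU0 : 0 < U)
    (hU : U ≤ localFeatureSize c / 3) {S : Set Plane} (hS : IsClosedSimpleShape Ω S)
    {γ : ℝ → Plane} (hγ : γ ∈ Gamma1 c U) (hγS : range γ = frontier S) {g : Plane → Plane}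
    (hg : ContDiff ℝ 1 g) :
    ∫ t in (0 : ℝ)..1, inner ℝ (g (γ t)) (deriv γ t) = ∫ x in S, curl g x := by
  obtain ⟨h0, h1⟩ := winds_of_mem_Gamma1 hc hU0 hU hS hγ hγS
  obtain ⟨hper, ⟨K, hK⟩, -, -⟩ := hγ
  exact integral_inner_deriv_eq_integral_curl hK hper hg
    hS.isCompact hγS h0 h1

/-- The difference between the area integral of `ξ` and the circulation of `g` does not depend on the
shape, if `ξ` is the curl of `g` on the tube: the shapes agree outside of the tube. -/
theorem setIntegral_sub_circulation_eq (hc : IsCenterline c) (hU0 : 0 < U)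
    (hU : U ≤ localFeatureSize c / 3) {g : Plane → Plane} (hg : ContDiff ℝ 1 g)
    {ξ : Plane → ℝ} (hξ : ContinuousOn ξ (closure Ω)) (hcurl : ∀ x ∈ tube c U, curl g x = ξ x)
    {S S' : Set Plane} (hS : IsClosedSimpleShape Ω S) {γ : ℝ → Plane} (hγ : γ ∈ Gamma1 c U)
    (hγS : range γ = frontier S) (hS' : IsClosedSimpleShape Ω S') {γ' : ℝ → Plane}
    (hγ' : γ' ∈ Gamma1 c U) (hγS' : range γ' = frontier S') :
    (∫ x in S, ξ x) - ∫ t in (0 : ℝ)..1, inner ℝ (g (γ t)) (deriv γ t)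
      = (∫ x in S', ξ x) - ∫ t in (0 : ℝ)..1, inner ℝ (g (γ' t)) (deriv γ' t) := by
  rw [integral_inner_boundary_eq hc hU0 hU hS hγ hγS hg,
    integral_inner_boundary_eq hc hU0 hU hS' hγ' hγS' hg]
  have hT := (hc.isCompact_tube U).measurableSet
  have hout : S \ tube c U = S' \ tube c U := by
    ext x
    simp only [Set.mem_sdiff, and_congr_left_iff]
    intro hx
    rw [mem_iff_winds_of_notMem_tube hc hU0 hU hS hγ hγS hx,
      mem_iff_winds_of_notMem_tube hc hU0 hU hS' hγ' hγS' hx]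
  have hsplit : ∀ S : Set Plane, IsClosedSimpleShape Ω S →
      (∫ x in S, ξ x) - ∫ x in S, curl g x
        = (∫ x in S \ tube c U, ξ x) - ∫ x in S \ tube c U, curl g x := by
    intro S hS
    have hSc := hS.isCompact
    have h1 : IntegrableOn ξ S :=
      (hξ.mono (hS.1.trans subset_closure)).integrableOn_compact hSc
    have h2 : IntegrableOn (curl g) S := (continuous_curl hg).continuousOn.integrableOn_compact hSc
    rw [← integral_inter_add_sdiff hT h1, ← integral_inter_add_sdiff hT h2,
      setIntegral_congr_fun (hSc.measurableSet.inter hT) fun x hx => hcurl x hx.2]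
    ring
  rw [hsplit S hS, hsplit S' hS', hout]

end Circulation

/-! ### Norms defined by matrices -/

section MatNorm

open Metric Filter Topology Matrix

theorem continuous_matNorm :
    Continuous fun p : Matrix (Fin 2) (Fin 2) ℝ × Plane => matNorm p.1 p.2 := by
  unfold matNorm
  fun_prop

theorem matNorm_smul_vec (A : Matrix (Fin 2) (Fin 2) ℝ) (r : ℝ) (v : Plane) :
    matNorm A (r • v) = |r| * matNorm A v := by
  rw [matNorm, matNorm, ← Real.sqrt_sq_eq_abs, ← Real.sqrt_mul (sq_nonneg r)]
  congr 1
  simp [mulVec_smul]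
  ring

theorem matNorm_sq_smul {s : ℝ} (hs : 0 ≤ s) (A : Matrix (Fin 2) (Fin 2) ℝ) (v : Plane) :
    matNorm (s ^ 2 • A) v = s * matNorm A v := by
  rw [matNorm, matNorm, smul_mulVec, dotProduct_smul, smul_eq_mul, Real.sqrt_mul (sq_nonneg s),
    Real.sqrt_sq hs]

theorem matNorm_nonneg (A : Matrix (Fin 2) (Fin 2) ℝ) (v : Plane) : 0 ≤ matNorm A v :=
  Real.sqrt_nonneg _

theorem quadForm_pos {A : Matrix (Fin 2) (Fin 2) ℝ} (hA : A.PosDef) {v : Plane} (hv : v ≠ 0) :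
    0 < v.ofLp ⬝ᵥ A *ᵥ v.ofLp := by
  have := hA.dotProduct_mulVec_pos (x := v.ofLp) (fun h => hv (by ext i; simp [h]))
  simpa using this

theorem matNorm_pos {A : Matrix (Fin 2) (Fin 2) ℝ} (hA : A.PosDef) {v : Plane} (hv : v ≠ 0) :
    0 < matNorm A v :=
  Real.sqrt_pos.2 (quadForm_pos hA hv)

/-- The Cauchy-Schwarz inequality for the norms of `A⁻¹` and `A`. -/
theorem abs_inner_le_matNorm_mul {A : Matrix (Fin 2) (Fin 2) ℝ} (hA : A.PosDef) (w v : Plane) :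
    |inner ℝ w v| ≤ matNorm A⁻¹ w * matNorm A v := by
  have hdet := hA.det_pos
  have hsym : A 1 0 = A 0 1 := by simpa using hA.isHermitian.apply 0 1
  have hq : 0 ≤ v.ofLp ⬝ᵥ A *ᵥ v.ofLp := by
    rcases eq_or_ne v 0 with rfl | hv
    · simp
    · exact (quadForm_pos hA hv).le
  rw [matNorm, matNorm, ← Real.sqrt_mul' _ hq, ← Real.sqrt_sq_eq_abs]
  refine Real.sqrt_le_sqrt ?_
  have hin : inner ℝ w v = w 0 * v 0 + w 1 * v 1 := by
    rw [PiLp.inner_apply]; simp [Fin.sum_univ_two]; ring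
  rw [hin, Matrix.inv_def, Ring.inverse_eq_inv', Matrix.adjugate_fin_two, smul_mulVec,
    dotProduct_smul, smul_eq_mul, mul_assoc, ← div_eq_inv_mul, le_div_iff₀ hdet]
  rw [Matrix.det_fin_two]
  simp [dotProduct, mulVec, Fin.sum_univ_two, hsym]
  -- The difference of the two sides is the square of the determinant of `(w, A v)`.
  nlinarith [sq_nonneg (w 0 * (A 0 1 * v 0 + A 1 1 * v 1) - w 1 * (A 0 0 * v 0 + A 0 1 * v 1))]

end MatNorm

/-! ### The approximate energy as a Randers length -/

section Energy

open Metric Filter Topology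

variable {Ω : Set Plane} {c : ℝ → Plane} {U : ℝ}

theorem intervalIntegrable_comp_deriv {γ : ℝ → Plane} {K : ℝ≥0} (hK : LipschitzWith K γ)
    {F : ℝ × Plane → ℝ} (hF : Continuous F) :
    IntervalIntegrable (fun t => F (t, deriv γ t)) volume 0 1 := by
  obtain ⟨B, hB⟩ := ((isCompact_Icc (a := (0 : ℝ)) (b := 1)).prod
    (isCompact_closedBall (0 : Plane) K)).exists_bound_of_continuousOn hF.continuousOn
  have hm := measurable_deriv γ
  rw [intervalIntegrable_iff_integrableOn_Ioc_of_le zero_le_one]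
  refine (integrableOn_const (C := B) (by simp)).mono' ?_ ?_
  · exact (hF.measurable.comp (measurable_id.prodMk hm)).aestronglyMeasurable
  · filter_upwards [ae_restrict_mem measurableSet_Ioc] with t ht
    exact hB _ ⟨⟨ht.1.le, ht.2⟩, by simpa using norm_deriv_le_of_lipschitz hK⟩

theorem pathLength_randersMetric_eq {M : Plane → Matrix (Fin 2) (Fin 2) ℝ}
    (hM : ContinuousOn M (tube c U)) {γ : ℝ → Plane} (hγ : γ ∈ Gamma1 c U) (lam : ℝ)
    (S₀ : Set Plane) {ω : Set Plane → Plane → Plane} {g : Plane → Plane} (hg : Continuous g)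
    (hgω : EqOn (ω S₀) g (tube c U)) :
    pathLength (randersMetric M lam ω S₀) γ = pathLength (riemannMetric M) γ
      + 2 * lam * divergence M γ S₀ + ∫ t in (0 : ℝ)..1, inner ℝ (g (γ t)) (deriv γ t) := by
  obtain ⟨-, ⟨K, hK⟩, hγT, -⟩ := hγ
  have hγc := hK.continuous
  have hMγ : Continuous fun t => M (γ t) := hM.comp_continuous hγc hγT
  have hN : Continuous fun p : ℝ × Plane => matNorm (M (γ p.1)) p.2 :=
    continuous_matNorm.comp ((hMγ.comp continuous_fst).prodMk continuous_snd)
  have hd : Continuous fun x => bdryDist S₀ x := continuous_infDist_pt _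
  have h1 := intervalIntegrable_comp_deriv hK hN
  have h2 := intervalIntegrable_comp_deriv hK
    (F := fun p => bdryDist S₀ (γ p.1) ^ 2 * matNorm (M (γ p.1)) p.2) (by fun_prop)
  have h3 := intervalIntegrable_comp_deriv hK (F := fun p => inner ℝ (g (γ p.1)) p.2) (by fun_prop)
  have h (t : ℝ) : randersMetric M lam ω S₀ (γ t) (deriv γ t)
      = matNorm (M (γ t)) (deriv γ t)
        + 2 * lam * (bdryDist S₀ (γ t) ^ 2 * matNorm (M (γ t)) (deriv γ t))
        + inner ℝ (g (γ t)) (deriv γ t) := by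
    rw [randersMetric, hgω (hγT t)]
    ring
  simp only [pathLength, divergence, riemannMetric, h]
  rw [intervalIntegral.integral_add (h1.add (h2.const_mul _)) h3,
    intervalIntegral.integral_add h1 (h2.const_mul _), intervalIntegral.integral_const_mul]

/-- Up to a constant, the approximate energy is the length of the boundary for the Randers metric. -/
theorem exists_approxEnergy_eq (hc : IsCenterline c) (hU0 : 0 < U)
    (hU : U ≤ localFeatureSize c / 3) {M : Plane → Matrix (Fin 2) (Fin 2) ℝ}
    (hM : ContinuousOn M (tube c U)) (Ψ : (Plane → ℝ) → ℝ) {ξ : Set Plane → Plane → ℝ}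
    {S₀ : Set Plane} (hξ : ContinuousOn (ξ S₀) (closure Ω)) {C : Set Plane → ℝ → Plane}
    (hC : ∀ S ∈ shapes1 Ω c U, C S ∈ Gamma1 c U ∧ range (C S) = frontier S) (lam : ℝ)
    {ω : Set Plane → Plane → Plane} {g : Plane → Plane} (hg : ContDiff ℝ 1 g)
    (hgω : EqOn (ω S₀) g (tube c U)) (hcurl : ∀ x ∈ tube c U, curl g x = ξ S₀ x)
    (hS₀ : S₀ ∈ shapes1 Ω c U) :
    ∃ e : ℝ, ∀ S ∈ shapes1 Ω c U, approxEnergy M Ψ ξ C lam S₀ S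
      = e + pathLength (randersMetric M lam ω S₀) (C S) := by
  refine ⟨(hybridEnergy M Ψ C S₀ - ∫ x in S₀, ξ S₀ x)
    + ((∫ x in S₀, ξ S₀ x) - ∫ t in (0 : ℝ)..1, inner ℝ (g (C S₀ t)) (deriv (C S₀) t)),
    fun S hS => ?_⟩
  have h := setIntegral_sub_circulation_eq hc hU0 hU hg hξ hcurl hS.1 (hC S hS).1 (hC S hS).2
    hS₀.1 (hC S₀ hS₀).1 (hC S₀ hS₀).2
  rw [pathLength_randersMetric_eq hM (hC S hS).1 lam S₀ hg.continuous hgω, approxEnergy]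
  linear_combination h

end Energy

/-! ### Uniform bounds for the Randers metric -/

section Randers

open Metric Filter Topology Matrix

variable {Ω : Set Plane} {c : ℝ → Plane} {U : ℝ}

theorem penaltyWeight_nonneg (Ω : Set Plane) (M : Plane → Matrix (Fin 2) (Fin 2) ℝ) {K : ℝ}
    (hK : 0 ≤ K) : 0 ≤ penaltyWeight Ω M K := by
  have : 0 ≤ rhoMin (riemannMetric M) (closure Ω) := by
    refine Real.sInf_nonneg ?_
    rintro _ ⟨x, -, v, -, rfl⟩
    exact matNorm_nonneg _ _
  unfold penaltyWeight
  positivity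

theorem exists_lipschitzOnWith_of_contDiffOn {E : Type*} [NormedAddCommGroup E] [NormedSpace ℝ E]
    {M : Plane → E} (hΩ : IsOpen Ω) (hM : ContDiffOn ℝ 1 M Ω) {T : Set Plane}
    (hT : IsCompact T) (hTΩ : T ⊆ Ω) : ∃ L, LipschitzOnWith L M T := by
  refine LocallyLipschitzOn.exists_lipschitzOnWith_of_compact hT fun x hx => ?_
  obtain ⟨K, t, ht, hKt⟩ := (hM.contDiffAt (hΩ.mem_nhds (hTΩ hx))).exists_lipschitzOnWith
  exact ⟨K, t, mem_nhdsWithin_of_mem_nhds ht, hKt⟩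

theorem unitValues_eq_image (F : Plane → Plane → ℝ) (A : Set Plane) :
    unitValues F A = (fun p : Plane × Plane => F p.1 p.2) '' (A ×ˢ sphere 0 1) := by
  ext r
  constructor
  · rintro ⟨x, hx, v, hv, rfl⟩
    exact ⟨(x, v), ⟨hx, by simpa using hv⟩, rfl⟩
  · rintro ⟨⟨x, v⟩, ⟨hx, hv⟩, rfl⟩
    exact ⟨x, hx, v, by simpa using hv, rfl⟩

theorem isCompact_unitValues {F : Plane → Plane → ℝ} {A : Set Plane} (hA : IsCompact A)
    (hF : ContinuousOn (fun p : Plane × Plane => F p.1 p.2) (A ×ˢ univ)) :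
    IsCompact (unitValues F A) := by
  rw [unitValues_eq_image]
  exact (hA.prod (isCompact_sphere _ _)).image_of_continuousOn
    (hF.mono (prod_mono_right (subset_univ _)))

theorem unitValues_nonempty (F : Plane → Plane → ℝ) {A : Set Plane} (hA : A.Nonempty) :
    (unitValues F A).Nonempty := by
  obtain ⟨x, hx⟩ := hA
  exact ⟨_, x, hx, EuclideanSpace.single 0 1, by simp, rfl⟩

theorem continuousOn_riemannMetric {M : Plane → Matrix (Fin 2) (Fin 2) ℝ} {A : Set Plane}
    (hM : ContinuousOn M A) :
    ContinuousOn (fun p : Plane × Plane => matNorm (M p.1) p.2) (A ×ˢ univ) :=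
  continuous_matNorm.comp_continuousOn
    ((hM.comp continuousOn_fst fun _ hp => hp.1).prodMk continuousOn_snd)

theorem randersMetric_mem_Icc {M : Plane → Matrix (Fin 2) (Fin 2) ℝ} {lam R : ℝ} (hlam : 0 ≤ lam)
    {S₀ : Set Plane} {ω : Set Plane → Plane → Plane} {x : Plane} (hMx : (M x).PosDef)
    (hR : bdryDist S₀ x ≤ R) (hω : matNorm (M x)⁻¹ (ω S₀ x) ≤ 1 / 2) (v : Plane) :
    randersMetric M lam ω S₀ x v ∈
      Icc (1 / 2 * matNorm (M x) v) ((2 + 2 * lam * R ^ 2) * matNorm (M x) v) := by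
  have hcs := abs_le.1 (abs_inner_le_matNorm_mul hMx (ω S₀ x) v)
  have hN := matNorm_nonneg (M x) v
  have hd : 0 ≤ bdryDist S₀ x := infDist_nonneg
  have h1 := mul_le_mul_of_nonneg_right hω hN
  have h2 : 0 ≤ lam * bdryDist S₀ x ^ 2 * matNorm (M x) v := by positivity
  have h3 : lam * bdryDist S₀ x ^ 2 * matNorm (M x) v ≤ lam * R ^ 2 * matNorm (M x) v := by gcongr
  rw [randersMetric]
  constructor <;> nlinarith [hcs.1, hcs.2]

theorem lipschitzOnWith_randersTensor {M : Plane → Matrix (Fin 2) (Fin 2) ℝ} {lam R m : ℝ}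
    {L : ℝ≥0} (hlam : 0 ≤ lam) {S₀ A : Set Plane} (hL : LipschitzOnWith L M A) (hR0 : 0 ≤ R)
    (hR : ∀ x ∈ A, bdryDist S₀ x ≤ R) (hm : ∀ x ∈ A, ‖M x‖ ≤ m) :
    LipschitzOnWith (8 * lam * R * (1 + 2 * lam * R ^ 2) * |m|
      + (1 + 2 * lam * R ^ 2) ^ 2 * L).toNNReal (randersTensor M lam S₀) A := by
  refine LipschitzOnWith.of_dist_le_mul fun x hx y hy => ?_
  rw [Real.coe_toNNReal _ (by positivity), dist_eq_norm, randersTensor, randersTensor]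
  have hMxy := hL.dist_le_mul x hx y hy
  have hm' := (hm x hx).trans (le_abs_self m)
  have hdx : 0 ≤ bdryDist S₀ x := infDist_nonneg
  have hdy : 0 ≤ bdryDist S₀ y := infDist_nonneg
  have hxR := hR x hx
  have hyR := hR y hy
  have hdxy : |bdryDist S₀ x - bdryDist S₀ y| ≤ dist x y := by
    simpa [Real.dist_eq, bdryDist] using (lipschitz_infDist_pt (frontier S₀)).dist_le_mul x y
  rw [dist_eq_norm] at hMxy
  set p := bdryDist S₀ x
  set q := bdryDist S₀ y
  have hp2 : p ^ 2 ≤ R ^ 2 := by gcongr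
  have hq2 : q ^ 2 ≤ R ^ 2 := by gcongr
  have e : (1 + 2 * lam * p ^ 2) ^ 2 • M x - (1 + 2 * lam * q ^ 2) ^ 2 • M y
      = (2 * lam * ((p - q) * ((p + q) * (2 + 2 * lam * p ^ 2 + 2 * lam * q ^ 2)))) • M x
        + (1 + 2 * lam * q ^ 2) ^ 2 • (M x - M y) := by
    module
  rw [e]
  refine (norm_add_le _ _).trans ?_
  rw [norm_smul, norm_smul]
  refine (add_le_add ?_ ?_).trans_eq (add_mul _ _ _).symm
  · have h1 : |2 * lam * ((p - q) * ((p + q) * (2 + 2 * lam * p ^ 2 + 2 * lam * q ^ 2)))|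
        ≤ 2 * lam * (dist x y * ((R + R) * (2 + 2 * lam * R ^ 2 + 2 * lam * R ^ 2))) := by
      rw [abs_mul (2 * lam), abs_mul (p - q), abs_of_nonneg (show 0 ≤ 2 * lam by positivity),
        abs_of_nonneg (show 0 ≤ (p + q) * (2 + 2 * lam * p ^ 2 + 2 * lam * q ^ 2) by positivity)]
      gcongr
    rw [Real.norm_eq_abs]
    refine (mul_le_mul h1 hm' (norm_nonneg _) (by positivity)).trans (le_of_eq ?_)
    ring
  · rw [Real.norm_of_nonneg (by positivity), mul_assoc ((1 + 2 * lam * R ^ 2) ^ 2)]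
    gcongr

/-- The Randers metrics have uniformly bounded ratios and uniformly Lipschitz coefficients. -/
theorem exists_uniform_bounds_randersMetric (hΩ : IsOpen Ω)
    {M : Plane → Matrix (Fin 2) (Fin 2) ℝ} (hM : ContDiffOn ℝ 1 M Ω)
    (hMpos : ∀ x ∈ Ω, (M x).PosDef) (hc : IsCenterline c) (hU0 : 0 < U) (hT : tube c U ⊆ Ω)
    {lam : ℝ} (hlam : 0 ≤ lam) {ξ : Set Plane → Plane → ℝ} {ω : Set Plane → Plane → Plane}
    (hω : IsRandersField Ω M c U ξ ω) :
    ∃ (a b : ℝ) (L : ℝ≥0), 0 < a ∧ ∀ S₀ ∈ shapes1 Ω c U,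
      IsRandersMetric (tube c U) (randersMetric M lam ω S₀) (randersTensor M lam S₀) (ω S₀) L ∧
      IsLeast (unitValues (randersMetric M lam ω S₀) (tube c U))
        (rhoMin (randersMetric M lam ω S₀) (tube c U)) ∧
      IsGreatest (unitValues (randersMetric M lam ω S₀) (tube c U))
        (rhoMax (randersMetric M lam ω S₀) (tube c U)) ∧
      a ≤ rhoMin (randersMetric M lam ω S₀) (tube c U) ∧
      rhoMax (randersMetric M lam ω S₀) (tube c U) ≤ b := by
  have hTc := hc.isCompact_tube U
  have hTne : (tube c U).Nonempty := ⟨_, range_subset_tube hU0 (mem_range_self 0)⟩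
  have hMT : ContinuousOn M (tube c U) := hM.continuousOn.mono hT
  obtain ⟨L₁, hL₁⟩ := exists_lipschitzOnWith_of_contDiffOn hΩ hM hTc hT
  obtain ⟨m, hm⟩ := hTc.exists_bound_of_continuousOn hMT
  obtain ⟨hω, L₂, hL₂⟩ := hω
  have hNc := isCompact_unitValues (F := fun x v => matNorm (M x) v) hTc
    (continuousOn_riemannMetric hMT)
  have hNne := unitValues_nonempty (fun x v => matNorm (M x) v) hTne
  obtain ⟨a, ⟨x₀, hx₀, v₀, hv₀, ha⟩, hamin⟩ := hNc.exists_isLeast hNne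
  obtain ⟨b, -, hbmax⟩ := hNc.exists_isGreatest hNne
  have ha0 : 0 < a := by
    rw [ha]
    exact matNorm_pos (hMpos _ (hT hx₀)) (fun h => by simp [h] at hv₀)
  -- The boundary of a shape lies in the tube, hence at distance at most `R` from the points of the tube.
  set R := diam (tube c U)
  refine ⟨1 / 2 * a, (2 + 2 * lam * R ^ 2) * b, max (8 * lam * R * (1 + 2 * lam * R ^ 2) * |m|
      + (1 + 2 * lam * R ^ 2) ^ 2 * L₁).toNNReal L₂, by positivity, fun S₀ hS₀ => ?_⟩
  obtain ⟨-, hω2⟩ := hω S₀ hS₀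
  have hR : ∀ x ∈ tube c U, bdryDist S₀ x ≤ R := by
    obtain ⟨-, γ, hγ, hγS⟩ := hS₀
    intro x hx
    refine (infDist_le_dist_of_mem (hγS ▸ mem_range_self 0)).trans ?_
    exact dist_le_diam_of_mem hTc.isBounded hx (hγ.2.2.1 0)
  have hs (x : Plane) : 1 ≤ 1 + 2 * lam * bdryDist S₀ x ^ 2 := by
    have : 0 ≤ lam * bdryDist S₀ x ^ 2 := by positivity
    linarith
  have hmem : ∀ r ∈ unitValues (randersMetric M lam ω S₀) (tube c U),
      1 / 2 * a ≤ r ∧ r ≤ (2 + 2 * lam * R ^ 2) * b := by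
    rintro _ ⟨x, hx, v, hv, rfl⟩
    have h := randersMetric_mem_Icc hlam (hMpos _ (hT hx)) (hR x hx) (hω2 x hx) v
    have h1 : a ≤ matNorm (M x) v := hamin ⟨x, hx, v, hv, rfl⟩
    have h2 : matNorm (M x) v ≤ b := hbmax ⟨x, hx, v, hv, rfl⟩
    exact ⟨by linarith [h.1], h.2.trans (by gcongr)⟩
  have hcomp : IsCompact (unitValues (randersMetric M lam ω S₀) (tube c U)) := by
    refine isCompact_unitValues hTc ?_
    have h1 := continuousOn_riemannMetric hMT
    have h2 : ContinuousOn (fun p : Plane × Plane => ω S₀ p.1) (tube c U ×ˢ univ) :=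
      (hL₂ S₀ hS₀).continuousOn.comp continuousOn_fst fun _ hp => hp.1
    have h3 : Continuous fun p : Plane × Plane => bdryDist S₀ p.1 :=
      (continuous_infDist_pt _).comp continuous_fst
    exact ((continuous_const.add (continuous_const.mul (h3.pow 2))).continuousOn.mul h1).add
      (h2.inner continuousOn_snd)
  have hne := unitValues_nonempty (randersMetric M lam ω S₀) hTne
  have hleast := hcomp.isLeast_sInf hne
  have hgreat := hcomp.isGreatest_sSup hne
  refine ⟨⟨fun x hx => ?_, fun x hx => ?_, ?_, ?_, fun x hx v => ?_⟩, hleast, hgreat,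
    (hmem _ hleast.1).1, (hmem _ hgreat.1).2⟩
  · exact (hMpos _ (hT hx)).smul (pow_pos (by linarith [hs x]) 2)
  · have hA := hMpos _ (hT hx)
    have hq : (ω S₀ x).ofLp ⬝ᵥ (M x)⁻¹ *ᵥ (ω S₀ x).ofLp ≤ 1 / 4 := by
      have := Real.sqrt_le_iff.1 (hω2 x hx)
      linarith [this.2]
    have hs2 : 1 ≤ (1 + 2 * lam * bdryDist S₀ x ^ 2) ^ 2 := one_le_pow₀ (hs x)
    have hu : IsUnit (M x).det := hA.det_pos.ne'.isUnit
    have hinv : (randersTensor M lam S₀ x)⁻¹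
        = ((1 + 2 * lam * bdryDist S₀ x ^ 2) ^ 2)⁻¹ • (M x)⁻¹ := by
      refine Matrix.inv_eq_left_inv ?_
      rw [randersTensor, Matrix.smul_mul, Matrix.mul_smul, Matrix.nonsing_inv_mul _ hu,
        inv_smul_smul₀ (by positivity)]
    rw [hinv, smul_mulVec, dotProduct_smul, smul_eq_mul, inv_mul_lt_iff₀ (by positivity)]
    linarith
  · exact (lipschitzOnWith_randersTensor hlam hL₁ diam_nonneg hR hm).weaken (le_max_left _ _)
  · exact (hL₂ S₀ hS₀).weaken (le_max_right _ _)
  · rw [randersMetric, randersTensor, matNorm_sq_smul (by linarith [hs x])]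

end Randers

/-! ### The Cauchy transform of a Hölder continuous density -/

section CauchyTransform

open Metric Filter Topology
open scoped ComplexConjugate

theorem norm_beur (ε : ℝ) (u : ℂ) : ‖beur ε u‖ = ‖u‖ ^ 2 / (‖u‖ ^ 2 + ε ^ 2) ^ 2 := by
  rw [beur, norm_smul, norm_pow, RCLike.norm_conj, Real.norm_of_nonneg (by positivity)]
  ring

theorem norm_beur_le (ε : ℝ) (u : ℂ) : ‖beur ε u‖ ≤ (‖u‖ ^ 2)⁻¹ := by
  rcases eq_or_ne u 0 with rfl | hu
  · simp [norm_beur]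
  have hu' : 0 < ‖u‖ := norm_pos_iff.2 hu
  rw [norm_beur, div_le_iff₀ (by positivity), inv_mul_eq_div, le_div_iff₀ (by positivity)]
  nlinarith [sq_nonneg ε, sq_nonneg ‖u‖, mul_nonneg (sq_nonneg ε) (sq_nonneg ‖u‖),
    mul_nonneg (sq_nonneg ε) (sq_nonneg ε)]

theorem norm_beur_le_of_pos {ε : ℝ} (hε : 0 < ε) (u : ℂ) : ‖beur ε u‖ ≤ (ε ^ 2)⁻¹ := by
  rw [norm_beur, div_le_iff₀ (by positivity), inv_mul_eq_div, le_div_iff₀ (by positivity)]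
  nlinarith [sq_nonneg ε, sq_nonneg ‖u‖, mul_nonneg (sq_nonneg ε) (sq_nonneg ‖u‖),
    mul_nonneg (sq_nonneg ‖u‖) (sq_nonneg ‖u‖), mul_nonneg (sq_nonneg ε) (sq_nonneg ε)]

theorem pois_le_of_pos {ε : ℝ} (hε : 0 < ε) (u : ℂ) : pois ε u ≤ (ε ^ 2)⁻¹ := by
  rw [pois, div_le_iff₀ (by positivity), inv_mul_eq_div, le_div_iff₀ (by positivity)]
  nlinarith [sq_nonneg ε, sq_nonneg ‖u‖, mul_nonneg (sq_nonneg ε) (sq_nonneg ‖u‖),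
    mul_nonneg (sq_nonneg ‖u‖) (sq_nonneg ‖u‖)]

theorem norm_beur_sub_le (ε : ℝ) (u : ℂ) :
    ‖beur ε u - beur 0 u‖ ≤ 2 * ε ^ 2 / (‖u‖ ^ 2 + ε ^ 2) * (‖u‖ ^ 2)⁻¹ := by
  rcases eq_or_ne u 0 with rfl | hu
  · simp [beur]
  have hu' : 0 < ‖u‖ := norm_pos_iff.2 hu
  rw [beur, beur, ← sub_smul, norm_smul, norm_pow, RCLike.norm_conj, Real.norm_eq_abs, abs_sub_comm]
  have h : ((‖u‖ ^ 2 + 0 ^ 2) ^ 2)⁻¹ - ((‖u‖ ^ 2 + ε ^ 2) ^ 2)⁻¹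
      = (2 * ‖u‖ ^ 2 * ε ^ 2 + ε ^ 2 * ε ^ 2) / (‖u‖ ^ 4 * (‖u‖ ^ 2 + ε ^ 2) ^ 2) := by
    field_simp
    ring
  rw [h, abs_of_nonneg (by positivity), div_mul_eq_mul_div, div_le_iff₀ (by positivity)]
  field_simp
  nlinarith [sq_nonneg ε, mul_nonneg (sq_nonneg ε) (sq_nonneg ε)]

theorem beur_I_mul (ε : ℝ) (u : ℂ) : beur ε (Complex.I * u) = -beur ε u := by
  rw [beur, beur, norm_mul, Complex.norm_I, one_mul, ← smul_neg, map_mul, mul_pow, Complex.conj_I,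
    neg_sq, Complex.I_sq, neg_one_mul]

theorem measurable_beur (ε : ℝ) : Measurable (beur ε) := by
  unfold beur
  have : Measurable fun u : ℂ => conj u := Complex.continuous_conj.measurable
  fun_prop

/-- The Beurling kernel has mean value zero on the unit disc, as a rotation by a right angle changes its
sign. -/
theorem integral_ball_beur (ε : ℝ) : ∫ u in ball (0 : ℂ) 1, beur ε u = 0 := by
  set G : ℂ → ℂ := (ball (0 : ℂ) 1).indicator (beur ε)
  have hG (u : ℂ) : G (Complex.I * u) = -G u := by
    by_cases hu : u ∈ ball (0 : ℂ) 1
    · simp only [G]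
      rw [indicator_of_mem hu, indicator_of_mem (by simpa using hu), beur_I_mul]
    · simp only [G]
      rw [indicator_of_notMem hu, indicator_of_notMem (by simpa using hu), neg_zero]
  set r := rotation ⟨Complex.I, by simp [Submonoid.unitSphere]⟩
  have hr (u : ℂ) : r u = Complex.I * u := rotation_apply _ _
  have hrot := r.measurePreserving.integral_comp r.toHomeomorph.measurableEmbedding G
  rw [← integral_indicator measurableSet_ball]
  simp only [hr, hG, integral_neg] at hrot
  exact neg_eq_self.1 hrot

/-- The density of the singular integral at `z`: the value at `z` is subtracted near the pole. -/
noncomputable def compensated (f : ℂ → ℂ) (z u : ℂ) : ℂ :=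
  f (z - u) - (ball (0 : ℂ) 1).indicator (fun _ => f z) u

/-- The Beurling transform for `ε = 0`, and its regularization. The principal value of the convolution
with `1 / u²` is encoded as an absolutely convergent integral, by compensating the density. -/
noncomputable def beurT (ε : ℝ) (f : ℂ → ℂ) (z : ℂ) : ℂ := ∫ u, beur ε u * compensated f z u

variable {f : ℂ → ℂ} {V : Set ℂ} {α B H : ℝ}

theorem continuous_of_holder (hα : 0 < α) (hH : ∀ z w, ‖f z - f w‖ ≤ H * ‖z - w‖ ^ α) :
    Continuous f := by
  refine continuous_iff_continuousAt.2 fun z => tendsto_iff_norm_sub_tendsto_zero.2 ?_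
  have : Continuous fun w : ℂ => H * ‖w - z‖ ^ α :=
    continuous_const.mul ((continuous_id.sub continuous_const).norm.rpow_const fun _ => Or.inr hα.le)
  have h := this.tendsto z
  simp only [sub_self, norm_zero, Real.zero_rpow hα.ne', mul_zero] at h
  exact squeeze_zero (fun _ => norm_nonneg _) (fun w => hH w z) h

theorem norm_compensated_le (hB : ∀ z, ‖f z‖ ≤ B) (hfV : ∀ z ∉ V, f z = 0)
    (hH : ∀ z w, ‖f z - f w‖ ≤ H * ‖z - w‖ ^ α) (z u : ℂ) :
    (u ∈ ball (0 : ℂ) 1 → ‖compensated f z u‖ ≤ H * ‖u‖ ^ α) ∧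
    (u ∉ ball (0 : ℂ) 1 → ‖compensated f z u‖ ≤ V.indicator (fun _ => B) (z - u)) := by
  constructor <;> intro hu
  · rw [compensated, indicator_of_mem hu]
    refine (hH _ _).trans (le_of_eq ?_)
    simp
  · rw [compensated, indicator_of_notMem hu, sub_zero]
    by_cases h : z - u ∈ V
    · rw [indicator_of_mem h]; exact hB _
    · rw [indicator_of_notMem h, hfV _ h, norm_zero]

/-- An integrable bound for singular integrals with a kernel of size `s / |u|²`. -/
theorem norm_mul_compensated_le (hα2 : α < 2) (hB : ∀ z, ‖f z‖ ≤ B) (hfV : ∀ z ∉ V, f z = 0)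
    (hH : ∀ z w, ‖f z - f w‖ ≤ H * ‖z - w‖ ^ α) (z u k : ℂ) {s s' : ℝ} (hs' : 0 ≤ s')
    (hk : ‖k‖ ≤ s * (‖u‖ ^ 2)⁻¹) (hss : u ∉ ball (0 : ℂ) 1 → s ≤ s') :
    ‖k * compensated f z u‖ ≤ s * (ball (0 : ℂ) 1).indicator (fun u => H * ‖u‖ ^ (-(2 - α))) u
      + s' * V.indicator (fun _ => B) (z - u) := by
  obtain ⟨h1, h2⟩ := norm_compensated_le hB hfV hH z u
  have hB0 : 0 ≤ B := (norm_nonneg _).trans (hB 0)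
  have hind : 0 ≤ V.indicator (fun _ => B) (z - u) := indicator_nonneg (fun _ _ => hB0) _
  have hsum : 0 ≤ s' * V.indicator (fun _ => B) (z - u) := mul_nonneg hs' hind
  rcases eq_or_ne u 0 with rfl | hu0
  · have h0 : (0 : ℂ) ∈ ball (0 : ℂ) 1 := by simp
    rw [indicator_of_mem h0, norm_zero, Real.zero_rpow (by linarith), compensated,
      indicator_of_mem h0]
    simpa using hsum
  have hu' : 0 < ‖u‖ := norm_pos_iff.2 hu0
  rw [norm_mul]
  by_cases hu : u ∈ ball (0 : ℂ) 1
  · rw [indicator_of_mem hu]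
    have hmain : ‖k‖ * ‖compensated f z u‖ ≤ s * (H * ‖u‖ ^ (-(2 - α))) :=
      calc ‖k‖ * ‖compensated f z u‖ ≤ s * (‖u‖ ^ 2)⁻¹ * (H * ‖u‖ ^ α) :=
            mul_le_mul hk (h1 hu) (norm_nonneg _) ((norm_nonneg _).trans hk)
        _ = _ := by
            rw [show -(2 - α) = α - (2 : ℕ) by push_cast; ring, Real.rpow_sub_natCast hu'.ne']
            ring
    linarith
  · rw [indicator_of_notMem hu, mul_zero, zero_add]
    have hu1 : 1 ≤ ‖u‖ := by simpa using hu
    have hk' : ‖k‖ ≤ s' := by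
      have h3 : (‖u‖ ^ 2)⁻¹ ≤ 1 := inv_le_one_of_one_le₀ (one_le_pow₀ hu1)
      have h4 : 0 < (‖u‖ ^ 2)⁻¹ := by positivity
      have h5 := hss hu
      refine hk.trans ((mul_le_mul_of_nonneg_right h5 h4.le).trans ?_)
      exact mul_le_of_le_one_right hs' h3
    exact mul_le_mul hk' (h2 hu) (norm_nonneg _) hs'

theorem integrable_indicator_comp_sub (hV : MeasurableSet V) (hVt : volume V ≠ ⊤) (B : ℝ) (z : ℂ) :
    Integrable (fun u => V.indicator (fun _ => B) (z - u)) ∧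
      ∫ u, V.indicator (fun _ => B) (z - u) = B * volume.real V := by
  have hi : Integrable (V.indicator fun _ : ℂ => B) :=
    (integrable_indicator_iff hV).2 (integrableOn_const hVt)
  refine ⟨hi.comp_sub_left z, ?_⟩
  rw [integral_sub_left_eq_self (fun u => V.indicator (fun _ => B) u), integral_indicator hV,
    setIntegral_const, smul_eq_mul, mul_comm]

theorem integrable_indicator_ball_rpow (hα : 0 < α) (H : ℝ) :
    Integrable ((ball (0 : ℂ) 1).indicator fun u => H * ‖u‖ ^ (-(2 - α))) :=
  (integrable_indicator_iff measurableSet_ball).2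
    ((integrableOn_ball_norm_rpow (by linarith) 1).const_mul H)

theorem measurable_compensated (hf : Continuous f) (z : ℂ) : Measurable (compensated f z) := by
  have := hf.measurable
  exact (this.comp (measurable_const.sub measurable_id)).sub
    (measurable_const.indicator measurableSet_ball)

theorem beurT_bounds (hα : 0 < α) (hα2 : α < 2) (hV : MeasurableSet V) (hVt : volume V ≠ ⊤)
    (hB : ∀ z, ‖f z‖ ≤ B) (hfV : ∀ z ∉ V, f z = 0)
    (hH : ∀ z w, ‖f z - f w‖ ≤ H * ‖z - w‖ ^ α) (ε : ℝ) (z : ℂ) :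
    Integrable (fun u => beur ε u * compensated f z u) ∧
      ‖beurT ε f z‖ ≤ H * (∫ u in ball (0 : ℂ) 1, ‖u‖ ^ (-(2 - α))) + B * volume.real V := by
  have hf := continuous_of_holder hα hH
  obtain ⟨hi1, hi2⟩ := integrable_indicator_comp_sub hV hVt B z
  have hmaj := (integrable_indicator_ball_rpow hα H).add hi1
  have hle (u : ℂ) : ‖beur ε u * compensated f z u‖ ≤
      (ball (0 : ℂ) 1).indicator (fun u => H * ‖u‖ ^ (-(2 - α))) u
        + V.indicator (fun _ => B) (z - u) := by
    have := norm_mul_compensated_le hα2 hB hfV hH z u (beur ε u) zero_le_one (s := 1)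
      (by rw [one_mul]; exact norm_beur_le ε u) (fun _ => le_rfl)
    simpa using this
  refine ⟨hmaj.mono' ((measurable_beur ε).mul (measurable_compensated hf z)).aestronglyMeasurable
    (ae_of_all _ hle), (norm_integral_le_of_norm_le hmaj (ae_of_all _ hle)).trans (le_of_eq ?_)⟩
  simp only [Pi.add_apply]
  rw [integral_add (integrable_indicator_ball_rpow hα H) hi1, hi2,
    integral_indicator measurableSet_ball, integral_const_mul]

/-- The regularized Beurling transforms converge uniformly. -/
theorem tendstoUniformly_beurT (hα : 0 < α) (hα2 : α < 2) (hV : MeasurableSet V)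
    (hVt : volume V ≠ ⊤) (hB : ∀ z, ‖f z‖ ≤ B) (hfV : ∀ z ∉ V, f z = 0)
    (hH : ∀ z w, ‖f z - f w‖ ≤ H * ‖z - w‖ ^ α) :
    TendstoUniformly (fun ε => beurT ε f) (beurT 0 f) (𝓝[>] 0) := by
  set W := (ball (0 : ℂ) 1).indicator fun u => H * ‖u‖ ^ (-(2 - α)) with hW
  have hWi : Integrable W := integrable_indicator_ball_rpow hα H
  set s : ℝ → ℂ → ℝ := fun ε u => 2 * ε ^ 2 / (‖u‖ ^ 2 + ε ^ 2) with hs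
  have hs0 (ε : ℝ) (u : ℂ) : 0 ≤ s ε u := by positivity
  have hs2 (ε : ℝ) (u : ℂ) : s ε u ≤ 2 := div_le_of_le_mul₀ (by positivity) zero_le_two
    (by nlinarith [sq_nonneg ‖u‖])
  have hsm (ε : ℝ) : Measurable (s ε) := by fun_prop
  have hsW (ε : ℝ) : Integrable fun u => s ε u * W u := by
    refine (hWi.norm.const_mul 2).mono' ((hsm ε).aestronglyMeasurable.mul hWi.1)
      (ae_of_all _ fun u => ?_)
    rw [norm_mul, Real.norm_of_nonneg (hs0 _ _)]
    exact mul_le_mul_of_nonneg_right (hs2 _ _) (norm_nonneg _)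
  have hlim : Tendsto (fun ε => (∫ u, s ε u * W u) + 2 * ε ^ 2 * (B * volume.real V)) (𝓝[>] 0)
      (𝓝 ((∫ _ : ℂ, (0 : ℝ)) + 2 * 0 ^ 2 * (B * volume.real V))) := by
    refine Tendsto.add ?_ ?_
    · refine tendsto_integral_filter_of_dominated_convergence (fun u => 2 * ‖W u‖)
        (Eventually.of_forall fun ε => (hsW ε).1) (Eventually.of_forall fun ε => ae_of_all _ fun u => ?_)
        (hWi.norm.const_mul 2) (ae_of_all _ fun u => ?_)
      · rw [norm_mul, Real.norm_of_nonneg (hs0 _ _)]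
        exact mul_le_mul_of_nonneg_right (hs2 _ _) (norm_nonneg _)
      · rcases eq_or_ne u 0 with rfl | hu
        · have : W 0 = 0 := by
            rw [hW, indicator_of_mem (by simp), norm_zero, Real.zero_rpow (by linarith), mul_zero]
          simp [this]
        · have hu' : ‖u‖ ^ 2 + (0 : ℝ) ^ 2 ≠ 0 := by
            have := norm_pos_iff.2 hu
            positivity
          have : ContinuousAt (fun ε : ℝ => s ε u * W u) 0 :=
            ContinuousAt.mul (ContinuousAt.div (by fun_prop) (by fun_prop) hu') (by fun_prop)
          simpa [s, ContinuousAt] using this.mono_left (nhdsWithin_le_nhds (s := Ioi 0))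
    · have : Continuous fun ε : ℝ => 2 * ε ^ 2 * (B * volume.real V) := by fun_prop
      exact (this.tendsto 0).mono_left nhdsWithin_le_nhds
  simp only [integral_zero, ne_eq, OfNat.ofNat_ne_zero, not_false_eq_true, zero_pow, mul_zero,
    zero_mul, add_zero] at hlim
  rw [Metric.tendstoUniformly_iff]
  intro η hη
  filter_upwards [hlim.eventually (gt_mem_nhds hη)] with ε hε z
  refine lt_of_le_of_lt ?_ hε
  obtain ⟨hi1, hi2⟩ := integrable_indicator_comp_sub hV hVt B z
  rw [dist_comm, dist_eq_norm, beurT, beurT, ← integral_sub (beurT_bounds hα hα2 hV hVt hB hfV hH ε z).1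
    (beurT_bounds hα hα2 hV hVt hB hfV hH 0 z).1]
  have hle (u : ℂ) : ‖beur ε u * compensated f z u - beur 0 u * compensated f z u‖
      ≤ s ε u * W u + 2 * ε ^ 2 * V.indicator (fun _ => B) (z - u) := by
    rw [← sub_mul]
    refine norm_mul_compensated_le hα2 hB hfV hH z u _ (by positivity) (norm_beur_sub_le ε u)
      fun hu => ?_
    have hu1 : 1 ≤ ‖u‖ := by simpa using hu
    refine div_le_self (by positivity) ?_
    nlinarith [sq_nonneg ε]
  refine (norm_integral_le_of_norm_le ((hsW ε).add (hi1.const_mul _)) (ae_of_all _ hle)).trans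
    (le_of_eq ?_)
  simp only [Pi.add_apply]
  rw [integral_add (hsW ε) (hi1.const_mul _), integral_const_mul, hi2]

theorem beurT_eq_integral_mul {ε : ℝ} (hε : 0 < ε)
    (hi : Integrable f) (z : ℂ) :
    beurT ε f z = ∫ w, f w * beur ε (z - w) := by
  have h1 : Integrable fun u => beur ε u * f (z - u) :=
    (hi.comp_sub_left z).bdd_mul (continuous_beur hε).aestronglyMeasurable
      (ae_of_all _ fun u => norm_beur_le_of_pos hε u)
  have h2 : Integrable ((ball (0 : ℂ) 1).indicator fun u => beur ε u * f z) :=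
    (integrable_indicator_iff measurableSet_ball).2
      ((((continuous_beur hε).mul continuous_const).continuousOn.integrableOn_compact
        (isCompact_closedBall 0 1)).mono_set ball_subset_closedBall)
  have h3 := integral_sub_left_eq_self (fun u => beur ε u * f (z - u)) volume z
  simp only [sub_sub_cancel] at h3
  calc beurT ε f z
      = ∫ u, (beur ε u * f (z - u) - (ball (0 : ℂ) 1).indicator (fun u => beur ε u * f z) u) := by
        rw [beurT]
        congr 1
        ext u
        by_cases hu : u ∈ ball (0 : ℂ) 1
        · rw [compensated, indicator_of_mem hu, indicator_of_mem hu]; ring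
        · rw [compensated, indicator_of_notMem hu, indicator_of_notMem hu]; ring
    _ = ∫ u, beur ε u * f (z - u) := by
        rw [integral_sub h1 h2, integral_indicator measurableSet_ball, integral_mul_const,
          integral_ball_beur, zero_mul, sub_zero]
    _ = _ := by rw [← h3]; congr 1; ext w; ring

/-- The mollifications by `pois ε` converge uniformly to `π f`. -/
theorem tendstoUniformly_integral_pois (hα : 0 < α) (hα1 : α ≤ 1) (hB : ∀ z, ‖f z‖ ≤ B)
    (hH : ∀ z w, ‖f z - f w‖ ≤ H * ‖z - w‖ ^ α) :
    TendstoUniformly (fun ε z => ∫ w, f w * pois ε (z - w)) (fun z => Real.pi * f z) (𝓝[>] 0) := by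
  have hf := continuous_of_holder hα hH
  have hp := continuous_pois one_pos
  set J := ∫ v : ℂ, pois 1 v * ‖v‖ ^ α
  have hlim : Tendsto (fun ε : ℝ => H * ε ^ α * J) (𝓝[>] 0) (𝓝 (H * 0 ^ α * J)) := by
    have : Continuous fun ε : ℝ => H * ε ^ α * J :=
      (continuous_const.mul (Real.continuous_rpow_const hα.le)).mul continuous_const
    exact (this.tendsto 0).mono_left nhdsWithin_le_nhds
  rw [Real.zero_rpow hα.ne', mul_zero, zero_mul] at hlim
  rw [Metric.tendstoUniformly_iff]
  intro η hη
  filter_upwards [hlim.eventually (gt_mem_nhds hη), self_mem_nhdsWithin] with ε hεη hε z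
  refine lt_of_le_of_lt ?_ hεη
  have hε0 : 0 < ε := hε
  have h3 := integral_sub_left_eq_self (fun u => (pois ε u : ℂ) * f (z - u)) volume z
  simp only [sub_sub_cancel] at h3
  have h4 : ∫ w, f w * pois ε (z - w) = ∫ v, (pois 1 v : ℂ) * f (z - ε • v) := by
    rw [← integral_pois_mul hε0 fun u => f (z - u), ← h3]
    congr 1; ext w; ring
  have h5 : Real.pi * f z = ∫ v, (pois 1 v : ℂ) * f z := by
    rw [integral_mul_const, integral_complex_ofReal, integral_pois_one]
  have hint (g : ℂ → ℂ) (hg : Continuous g) (hgB : ∀ v, ‖g v‖ ≤ B) :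
      Integrable fun v => (pois 1 v : ℂ) * g v :=
    (integrable_pois_one.ofReal (𝕜 := ℂ)).mul_bdd hg.aestronglyMeasurable (ae_of_all _ hgB)
  rw [dist_comm, dist_eq_norm, h4, h5, ← integral_sub
    (hint (fun v => f (z - ε • v)) (by fun_prop) fun v => hB _) (hint _ continuous_const fun _ => hB z)]
  have hle (v : ℂ) : ‖(pois 1 v : ℂ) * f (z - ε • v) - (pois 1 v : ℂ) * f z‖
      ≤ H * ε ^ α * (pois 1 v * ‖v‖ ^ α) := by
    rw [← mul_sub, norm_mul, Complex.norm_real, Real.norm_of_nonneg (pois_nonneg _ _)]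
    refine (mul_le_mul_of_nonneg_left (hH _ _) (pois_nonneg _ _)).trans (le_of_eq ?_)
    rw [sub_sub_cancel_left, norm_neg, norm_smul, Real.norm_of_nonneg hε0.le,
      Real.mul_rpow hε0.le (norm_nonneg v)]
    ring
  refine (norm_integral_le_of_norm_le
    ((integrable_pois_one_mul_norm_rpow hα.le hα1).const_mul _) (ae_of_all _ hle)).trans_eq ?_
  rw [integral_const_mul]

/-- The Cauchy transform of the density `f`, up to the factor `1 / π`. -/
noncomputable def cauchyT (f : ℂ → ℂ) (z : ℂ) : ℂ := ∫ w, f w * (z - w)⁻¹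

theorem norm_cauchyT_le (hV : MeasurableSet V) (hVt : volume V ≠ ⊤) (hB : ∀ z, ‖f z‖ ≤ B)
    (hfV : ∀ z ∉ V, f z = 0) (z : ℂ) {ρ : ℝ} (hρ : 0 < ρ) :
    ‖cauchyT f z‖ ≤ B * (2 * Real.pi * ρ + volume.real V / ρ) := by
  obtain ⟨h1, h2⟩ := integrableOn_inv_norm_sub hVt z hρ
  have hB0 : 0 ≤ B := (norm_nonneg _).trans (hB 0)
  have hi := ((integrable_indicator_iff hV).2 h1).const_mul B
  refine (norm_integral_le_of_norm_le hi (ae_of_all _ fun w => ?_)).trans ?_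
  · by_cases hw : w ∈ V
    · rw [indicator_of_mem hw, norm_mul, norm_inv]
      exact mul_le_mul_of_nonneg_right (hB w) (by positivity)
    · rw [indicator_of_notMem hw, hfV w hw]
      simp
  · rw [integral_const_mul, integral_indicator hV]
    exact mul_le_mul_of_nonneg_left h2 hB0

/-- Differentiation under the integral sign for the regularized Cauchy transform. -/
theorem hasFDerivAt_integral_kern {ε : ℝ} (hε : 0 < ε) (hi : Integrable f) (z : ℂ) :
    HasFDerivAt (fun z => ∫ w, f w * kern ε (z - w))
      (conjPair (∫ w, f w * pois ε (z - w)) (∫ w, f w * beur ε (z - w))) z := by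
  have hk := continuous_kern hε
  have hp := continuous_pois hε
  have hb := continuous_beur hε
  have hpi : Integrable fun w => f w * (pois ε (z - w) : ℂ) :=
    hi.mul_bdd (c := (ε ^ 2)⁻¹) (Continuous.aestronglyMeasurable (by fun_prop)) (ae_of_all _ fun w => by
      rw [Complex.norm_real, Real.norm_of_nonneg (pois_nonneg _ _)]
      exact pois_le_of_pos hε _)
  have hbi : Integrable fun w => f w * beur ε (z - w) :=
    hi.mul_bdd (c := (ε ^ 2)⁻¹) (Continuous.aestronglyMeasurable (by fun_prop))
      (ae_of_all _ fun w => norm_beur_le_of_pos hε _)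
  have hbound (z w : ℂ) : ‖f w • conjPair (pois ε (z - w)) (beur ε (z - w))‖
      ≤ ‖f w‖ * ((ε ^ 2)⁻¹ + (ε ^ 2)⁻¹) := by
    rw [norm_smul]
    refine mul_le_mul_of_nonneg_left ((norm_conjPair_le _ _).trans (add_le_add ?_ ?_)) (norm_nonneg _)
    · rw [Complex.norm_real, Real.norm_of_nonneg (pois_nonneg _ _)]
      exact pois_le_of_pos hε _
    · exact norm_beur_le_of_pos hε _
  have hcp : Continuous fun w => conjPair (pois ε (z - w)) (beur ε (z - w)) :=
    continuous_conjPair (by fun_prop) (by fun_prop)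
  have hmeas : AEStronglyMeasurable (fun w => f w • conjPair (pois ε (z - w)) (beur ε (z - w))) :=
    hi.1.smul hcp.aestronglyMeasurable
  have hbdi : Integrable fun w => ‖f w‖ * ((ε ^ 2)⁻¹ + (ε ^ 2)⁻¹) := hi.norm.mul_const _
  -- By the arithmetic-geometric mean inequality, `|u| / (|u|² + ε²) ≤ 1 / ε`.
  have hkb (w : ℂ) : ‖kern ε (z - w)‖ ≤ ε⁻¹ := by
    rw [kern, norm_smul, RCLike.norm_conj, Real.norm_of_nonneg (by positivity), inv_mul_le_iff₀
      (by positivity), ← div_eq_mul_inv, le_div_iff₀ hε]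
    nlinarith [sq_nonneg (‖z - w‖ - ε), norm_nonneg (z - w)]
  have h := hasFDerivAt_integral_of_dominated_of_fderiv_le (𝕜 := ℝ) (μ := volume) (s := univ)
    (F := fun z w => f w * kern ε (z - w))
    (F' := fun z w => f w • conjPair (pois ε (z - w)) (beur ε (z - w))) (x₀ := z)
    (bound := fun w => ‖f w‖ * ((ε ^ 2)⁻¹ + (ε ^ 2)⁻¹)) univ_mem
    (Eventually.of_forall fun z => hi.1.mul (Continuous.aestronglyMeasurable (by fun_prop)))
    (hi.mul_bdd (Continuous.aestronglyMeasurable (by fun_prop)) (ae_of_all _ hkb))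
    hmeas (ae_of_all _ fun w z _ => hbound z w) hbdi
    (ae_of_all _ fun w z _ => by
      have h1 : HasFDerivAt (fun z => kern ε (z - w)) (conjPair (pois ε (z - w)) (beur ε (z - w))) z := by
        simpa using! (hasFDerivAt_kern hε (z - w)).comp z ((hasFDerivAt_id z).sub_const w)
      exact h1.const_smul (f w))
  refine h.congr_fderiv ?_
  ext1 v
  have hI : Integrable fun w => f w • conjPair (pois ε (z - w)) (beur ε (z - w)) :=
    hbdi.mono' hmeas (ae_of_all _ (hbound z))
  rw [ContinuousLinearMap.integral_apply hI, conjPair_apply, ← integral_mul_const,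
    ← integral_mul_const, ← integral_sub (hpi.mul_const _) (hbi.mul_const _)]
  congr 1
  ext w
  simp
  ring

/-- The Cauchy transform of a bounded Hölder continuous density that vanishes off a set of finite area is
continuously differentiable. Its `∂/∂z̄` derivative is `π f`, and its `∂/∂z` derivative is the opposite
of the Beurling transform. -/
theorem hasFDerivAt_cauchyT (hα : 0 < α) (hα1 : α ≤ 1) (hV : MeasurableSet V)
    (hVt : volume V ≠ ⊤) (hB : ∀ z, ‖f z‖ ≤ B) (hfV : ∀ z ∉ V, f z = 0)
    (hH : ∀ z w, ‖f z - f w‖ ≤ H * ‖z - w‖ ^ α) :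
    Continuous (beurT 0 f) ∧
      ∀ z, HasFDerivAt (cauchyT f) (conjPair (Real.pi * f z) (beurT 0 f z)) z := by
  have hα2 : α < 2 := by linarith
  have hf := continuous_of_holder hα hH
  have hfi : Integrable f := by
    have h : f = V.indicator f := by
      ext z
      by_cases hz : z ∈ V
      · rw [indicator_of_mem hz]
      · rw [indicator_of_notMem hz, hfV z hz]
    rw [h, integrable_indicator_iff hV]
    exact Measure.integrableOn_of_bounded hVt hf.aestronglyMeasurable (ae_of_all _ hB)
  set e : ℕ → ℝ := fun n => 1 / ((n : ℝ) + 1)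
  have he0 (n : ℕ) : 0 < e n := by positivity
  have he : Tendsto e atTop (𝓝[>] 0) := tendsto_nhdsWithin_iff.2
    ⟨tendsto_one_div_add_atTop_nhds_zero_nat, Eventually.of_forall he0⟩
  have hQ : TendstoUniformly (fun n z => ∫ w, f w * beur (e n) (z - w)) (beurT 0 f) atTop := by
    have h1 := tendstoUniformly_beurT hα hα2 hV hVt hB hfV hH
    intro u hu
    filter_upwards [he.eventually (h1 u hu)] with n hn z
    rw [← beurT_eq_integral_mul (he0 n) hfi]
    exact hn z
  have hP : TendstoUniformly (fun n z => ∫ w, f w * pois (e n) (z - w)) (fun z => Real.pi * f z)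
      atTop := fun u hu => he.eventually (tendstoUniformly_integral_pois hα hα1 hB hH u hu)
  have hQc : Continuous (beurT 0 f) := by
    refine hQ.continuous (Frequently.of_forall fun n => ?_)
    refine continuous_of_dominated (bound := fun w => ‖f w‖ * ((e n) ^ 2)⁻¹) (fun z => ?_)
      (fun z => ae_of_all _ fun w => ?_) (hfi.norm.mul_const _) (ae_of_all _ fun w => ?_)
    · have := continuous_beur (he0 n)
      exact Continuous.aestronglyMeasurable (by fun_prop)
    · rw [norm_mul]
      exact mul_le_mul_of_nonneg_left (norm_beur_le_of_pos (he0 n) _) (norm_nonneg _)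
    · have := continuous_beur (he0 n)
      fun_prop
  refine ⟨hQc, fun z => ?_⟩
  refine hasFDerivAt_of_tendstoUniformly (l := atTop)
    (f := fun n z => ∫ w, f w * kern (e n) (z - w))
    (f' := fun n z => conjPair (∫ w, f w * pois (e n) (z - w)) (∫ w, f w * beur (e n) (z - w)))
    (g := cauchyT f) (g' := fun z => conjPair (Real.pi * f z) (beurT 0 f z)) ?_
    (fun n z => hasFDerivAt_integral_kern (he0 n) hfi z) (fun z => ?_) z
  · rw [Metric.tendstoUniformly_iff] at hP hQ ⊢
    intro η hη
    filter_upwards [hP (η / 2) (half_pos hη), hQ (η / 2) (half_pos hη)] with n h1 h2 z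
    rw [dist_eq_norm, conjPair_sub]
    refine (norm_conjPair_le _ _).trans_lt ?_
    have h3 := h1 z
    have h4 := h2 z
    rw [dist_eq_norm] at h3 h4
    linarith
  · refine tendsto_integral_filter_of_dominated_convergence
      (fun w => B * V.indicator (fun w => ‖z - w‖⁻¹) w) (Eventually.of_forall fun n => ?_)
      (Eventually.of_forall fun n => ae_of_all _ fun w => ?_)
      (((integrable_indicator_iff hV).2 (integrableOn_inv_norm_sub hVt z one_pos).1).const_mul B)
      (ae_of_all _ fun w => ((tendsto_kern (z - w)).comp he).const_mul _)
    · have := continuous_kern (he0 n)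
      exact Continuous.aestronglyMeasurable (by fun_prop)
    · by_cases hw : w ∈ V
      · rw [indicator_of_mem hw, norm_mul]
        exact mul_le_mul (hB w) (norm_kern_le _ _) (norm_nonneg _) ((norm_nonneg _).trans (hB 0))
      · rw [indicator_of_notMem hw, hfV w hw]
        simp

end CauchyTransform

/-! ### The Biot-Savart field -/

section Curl

open Metric Filter Topology
open scoped ComplexConjugate

/-- The Biot-Savart field: a bounded Hölder continuous density `f` that vanishes off a set `V` of finite
area is the curl of a `C¹` field, which is small if the area of `V` is small. It is the conjugate of the
Cauchy transform of `f`, up to a factor. -/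
theorem exists_contDiff_curl_eq {α B H : ℝ} (hα : 0 < α) (hα1 : α ≤ 1) {V : Set Plane}
    (hV : MeasurableSet V) (hVt : volume V ≠ ⊤) {f : Plane → ℝ} (hB : ∀ x, |f x| ≤ B)
    (hfV : ∀ x ∉ V, f x = 0) (hH : ∀ x y, |f x - f y| ≤ H * ‖x - y‖ ^ α) :
    ∃ g : Plane → Plane, ContDiff ℝ 1 g ∧ (∀ x, curl g x = f x) ∧
      (∀ ρ > 0, ∀ x, ‖g x‖ ≤ B * (2 * Real.pi * ρ + volume.real V / ρ)) ∧
      LipschitzWith (Real.pi * B + (H * (∫ u in ball (0 : ℂ) 1, ‖u‖ ^ (-(2 - α)))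
        + B * volume.real V)).toNNReal g := by
  set F : ℂ → ℂ := fun z => (f (toC.symm z) : ℂ) with hF
  have hpre : toC.symm ⁻¹' V = toC '' V := (toC.toEquiv.image_eq_preimage_symm V).symm
  have hvol : volume (toC.symm ⁻¹' V) = volume V :=
    toC.symm.measurePreserving.measure_preimage hV.nullMeasurableSet
  have hV' : MeasurableSet (toC.symm ⁻¹' V) := toC.symm.continuous.measurable hV
  have hvolr : volume.real (toC.symm ⁻¹' V) = volume.real V := by rw [Measure.real, hvol, Measure.real]
  have hVt' : volume (toC.symm ⁻¹' V) ≠ ⊤ := by rwa [hvol]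
  have hB' (z : ℂ) : ‖F z‖ ≤ B := by rw [hF, Complex.norm_real]; exact hB _
  have hfV' : ∀ z ∉ toC.symm ⁻¹' V, F z = 0 := fun z hz => by
    simp only [hF, hfV _ hz, Complex.ofReal_zero]
  have hH' (z w : ℂ) : ‖F z - F w‖ ≤ H * ‖z - w‖ ^ α := by
    simp only [hF]
    rw [← Complex.ofReal_sub, Complex.norm_real, ← toC.symm.norm_map, map_sub]
    exact hH _ _
  obtain ⟨hQc, hder⟩ := hasFDerivAt_cauchyT hα hα1 hV' hVt' hB' hfV' hH'
  have hQb (z : ℂ) := (beurT_bounds hα (by linarith : α < 2) hV' hVt' hB' hfV' hH' 0 z).2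
  rw [hvolr] at hQb
  have hFc := continuous_of_holder hα hH'
  have hpi := Real.pi_pos
  set k : ℂ := Complex.I / (2 * Real.pi) with hk
  have hkn : ‖k‖ ≤ 1 := by
    rw [hk, norm_div, Complex.norm_I, norm_mul, Complex.norm_real, Real.norm_of_nonneg hpi.le,
      div_le_one (by simp [hpi])]
    have := Real.pi_gt_three
    simp
    linarith
  set g : Plane → Plane := fun x => toC.symm (k * conj (cauchyT F (toC x))) with hg
  have hgF (x : Plane) : HasFDerivAt g
      ((toC.symm.toContinuousLinearEquiv : ℂ →L[ℝ] Plane) ∘L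
        (k • ((Complex.conjCLE : ℂ →L[ℝ] ℂ) ∘L
          ((conjPair (Real.pi * F (toC x)) (beurT 0 F (toC x))) ∘L
            (toC.toContinuousLinearEquiv : Plane →L[ℝ] ℂ))))) x := by
    have h1 := (hder (toC x)).comp x toC.toContinuousLinearEquiv.hasFDerivAt
    have h2 := (Complex.conjCLE.hasFDerivAt.comp x h1).const_smul k
    exact toC.symm.toContinuousLinearEquiv.hasFDerivAt.comp x h2
  have hgD (x v : Plane) : fderiv ℝ g x v = toC.symm (k * conj
      (Real.pi * F (toC x) * conj (toC v) - beurT 0 F (toC x) * toC v)) := by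
    rw [(hgF x).fderiv]
    simp
  refine ⟨g, ?_, fun x => ?_, fun ρ hρ x => ?_, ?_⟩
  · rw [contDiff_one_iff_fderiv]
    refine ⟨fun x => (hgF x).differentiableAt, ?_⟩
    have : fderiv ℝ g = fun x => _ := funext fun x => (hgF x).fderiv
    rw [this]
    have hcp : Continuous fun x : Plane =>
        conjPair (Real.pi * F (toC x)) (beurT 0 F (toC x)) :=
      continuous_conjPair (continuous_const.mul (hFc.comp toC.continuous))
        (hQc.comp toC.continuous)
    fun_prop
  · rw [curl, ← toC_im, ← toC_re, hgD, hgD, toC.apply_symm_apply, toC.apply_symm_apply,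
      ← toC_symm_one, ← toC_symm_I, toC.apply_symm_apply, toC.apply_symm_apply]
    have hFx : F (toC x) = f x := by simp [hF]
    have hk' : k = ((2 * Real.pi)⁻¹ : ℝ) * Complex.I := by
      rw [hk]; push_cast; ring
    rw [hFx, hk']
    simp
    field_simp
    ring
  · rw [hg]
    simp only
    rw [toC.symm.norm_map, norm_mul, RCLike.norm_conj]
    have := norm_cauchyT_le hV' hVt' hB' hfV' (toC x) hρ
    rw [hvolr] at this
    exact (mul_le_of_le_one_left (norm_nonneg _) hkn).trans this
  · refine lipschitzWith_of_nnnorm_fderiv_le (𝕜 := ℝ) (fun x => (hgF x).differentiableAt) fun x => ?_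
    rw [← NNReal.coe_le_coe, coe_nnnorm]
    refine le_trans ?_ (Real.le_coe_toNNReal _)
    have hnn := (norm_nonneg _).trans (hQb (toC x))
    have hB0 : 0 ≤ B := (abs_nonneg _).trans (hB 0)
    refine ContinuousLinearMap.opNorm_le_bound _ (by positivity) fun v => ?_
    rw [hgD, toC.symm.norm_map, norm_mul, RCLike.norm_conj]
    refine (mul_le_of_le_one_left (norm_nonneg _) hkn).trans ((norm_sub_le _ _).trans ?_)
    rw [norm_mul, norm_mul, norm_mul, RCLike.norm_conj, toC.norm_map, Complex.norm_real,
      Real.norm_of_nonneg hpi.le, add_mul]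
    have h1 := hB' (toC x)
    have h2 := hQb (toC x)
    gcongr

end Curl

/-! ### Small Randers fields on thin tubes -/

section ThinTubes

open Metric Filter Topology Matrix

variable {Ω : Set Plane} {c : ℝ → Plane} {U U' : ℝ}

theorem tube_mono (h : U' ≤ U) : tube c U' ⊆ tube c U := by
  rintro _ ⟨t, u, hu, rfl⟩
  exact ⟨t, u, ⟨by linarith [hu.1], hu.2.trans h⟩, rfl⟩

theorem shapes1_mono (h : U' ≤ U) : shapes1 Ω c U' ⊆ shapes1 Ω c U := by
  rintro S ⟨hS, γ, ⟨hper, hL, hγT, H, hH, hHT, h0, h1⟩, hγS⟩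
  exact ⟨hS, γ, ⟨hper, hL, fun t => tube_mono h (hγT t), H, hH,
    fun s hs => ⟨(hHT s hs).1, fun t => tube_mono h ((hHT s hs).2 t)⟩, h0, h1⟩, hγS⟩

theorem exists_matNorm_inv_le {M : Plane → Matrix (Fin 2) (Fin 2) ℝ} {T : Set Plane}
    (hT : IsCompact T) (hM : ContinuousOn M T) (hMpos : ∀ x ∈ T, (M x).PosDef) :
    ∃ C > 0, ∀ x ∈ T, ∀ v, matNorm (M x)⁻¹ v ≤ C * ‖v‖ := by
  have hdet : ContinuousOn (fun x => (M x).det) T := continuous_id.matrix_det.comp_continuousOn hM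
  have hadj : ContinuousOn (fun x => (M x).adjugate) T :=
    continuous_id.matrix_adjugate.comp_continuousOn hM
  have hinv : ContinuousOn (fun x => (M x)⁻¹) T := by
    simp only [Matrix.inv_def, Ring.inverse_eq_inv']
    exact (hdet.inv₀ fun x hx => (hMpos x hx).det_pos.ne').smul hadj
  obtain ⟨b, hb⟩ : BddAbove (unitValues (fun x v => matNorm (M x)⁻¹ v) T) :=
    (isCompact_unitValues hT (continuousOn_riemannMetric hinv)).bddAbove
  refine ⟨|b| + 1, by positivity, fun x hx v => ?_⟩
  rcases eq_or_ne v 0 with rfl | hv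
  · simp only [matNorm, norm_zero, mul_zero]
    simp
  have hv' : 0 < ‖v‖ := norm_pos_iff.2 hv
  have h : matNorm (M x)⁻¹ (‖v‖⁻¹ • v) ≤ b := by
    refine hb ⟨x, hx, _, ?_, rfl⟩
    rw [norm_smul, norm_inv, norm_norm, inv_mul_cancel₀ hv'.ne']
  rw [matNorm_smul_vec, abs_of_pos (by positivity), inv_mul_le_iff₀ hv'] at h
  nlinarith [le_abs_self b]

/-- A Lipschitz cutoff, equal to one on `T` and to zero at distance at least `τ` from `T`. -/
noncomputable def cutoff (T : Set Plane) (τ : ℝ) (x : Plane) : ℝ := max 0 (1 - infDist x T / τ)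

theorem cutoff_nonneg (T : Set Plane) (τ : ℝ) (x : Plane) : 0 ≤ cutoff T τ x := le_max_left _ _

theorem cutoff_le_one (T : Set Plane) {τ : ℝ} (hτ : 0 < τ) (x : Plane) : cutoff T τ x ≤ 1 := by
  refine max_le zero_le_one ?_
  have : 0 ≤ infDist x T / τ := div_nonneg infDist_nonneg hτ.le
  linarith

theorem cutoff_eq_one {T : Set Plane} {τ : ℝ} {x : Plane} (hx : x ∈ T) : cutoff T τ x = 1 := by
  simp [cutoff, infDist_zero_of_mem hx]

theorem infDist_lt_of_cutoff_ne_zero {T : Set Plane} {τ : ℝ} (hτ : 0 < τ) {x : Plane}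
    (hx : cutoff T τ x ≠ 0) : infDist x T < τ := by
  by_contra! h
  refine hx (max_eq_left ?_)
  have : 1 ≤ infDist x T / τ := (one_le_div hτ).2 h
  linarith

theorem abs_cutoff_sub_le (T : Set Plane) {τ : ℝ} (hτ : 0 < τ) (x y : Plane) :
    |cutoff T τ x - cutoff T τ y| ≤ ‖x - y‖ / τ := by
  have h1 := abs_max_sub_max_le_abs (1 - infDist x T / τ) (1 - infDist y T / τ) 0
  have h2 : |infDist x T - infDist y T| ≤ dist x y := by
    simpa [Real.dist_eq] using (lipschitz_infDist_pt T).dist_le_mul x y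
  rw [cutoff, cutoff, max_comm 0, max_comm 0, ← dist_eq_norm]
  refine h1.trans ?_
  rw [sub_sub_sub_cancel_left, ← sub_div, abs_div, abs_of_pos hτ, abs_sub_comm]
  gcongr

/-- The product of a cutoff and of a Hölder continuous function is Hölder continuous. -/
theorem abs_cutoff_mul_sub_le {T D : Set Plane} {τ α B : ℝ} (hτ : 0 < τ) (hα : 0 < α) (hα1 : α ≤ 1)
    (hB0 : 0 ≤ B) (hD : ∀ x, cutoff T τ x ≠ 0 → x ∈ D) {ξ : Plane → ℝ} (hB : ∀ x ∈ D, |ξ x| ≤ B)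
    (hξ : ∀ x ∈ D, ∀ y ∈ D, |ξ x - ξ y| ≤ B * ‖x - y‖ ^ α) (x y : Plane) :
    |cutoff T τ x * ξ x| ≤ B ∧
      |cutoff T τ x * ξ x - cutoff T τ y * ξ y| ≤ (2 * B + B / τ) * ‖x - y‖ ^ α := by
  have hbd (x : Plane) : |cutoff T τ x * ξ x| ≤ B := by
    by_cases hx : cutoff T τ x = 0
    · simpa [hx] using hB0
    · rw [abs_mul, abs_of_nonneg (cutoff_nonneg _ _ _)]
      exact (mul_le_of_le_one_left (abs_nonneg _) (cutoff_le_one _ hτ _)).trans (hB x (hD x hx))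
  refine ⟨hbd x, ?_⟩
  have hpow : 0 ≤ ‖x - y‖ ^ α := by positivity
  rcases le_total 1 ‖x - y‖ with h1 | h1
  · have h2 : 1 ≤ ‖x - y‖ ^ α := Real.one_le_rpow h1 hα.le
    have h3 : 0 ≤ B / τ := by positivity
    calc |cutoff T τ x * ξ x - cutoff T τ y * ξ y| ≤ B + B :=
          (abs_sub _ _).trans (add_le_add (hbd x) (hbd y))
      _ ≤ (2 * B + B / τ) * 1 := by linarith
      _ ≤ _ := by gcongr
  have hle : ‖x - y‖ ≤ ‖x - y‖ ^ α := by
    simpa using Real.rpow_le_rpow_of_exponent_ge' (norm_nonneg (x - y)) h1 hα.le hα1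
  -- The estimate is symmetric, and it suffices to treat the points `x` in the support of the cutoff.
  have key (x y : Plane) (hle : ‖x - y‖ ≤ ‖x - y‖ ^ α) (hx : cutoff T τ x ≠ 0) :
      |cutoff T τ x * ξ x - cutoff T τ y * ξ y| ≤ (2 * B + B / τ) * ‖x - y‖ ^ α := by
    have hpow : 0 ≤ ‖x - y‖ ^ α := by positivity
    have e : cutoff T τ x * ξ x - cutoff T τ y * ξ y
        = (cutoff T τ x - cutoff T τ y) * ξ x + cutoff T τ y * (ξ x - ξ y) := by ring
    have h2 : |(cutoff T τ x - cutoff T τ y) * ξ x| ≤ ‖x - y‖ ^ α / τ * B := by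
      rw [abs_mul]
      refine mul_le_mul ((abs_cutoff_sub_le T hτ x y).trans ?_) (hB x (hD x hx)) (abs_nonneg _)
        (by positivity)
      gcongr
    have h3 : |cutoff T τ y * (ξ x - ξ y)| ≤ B * ‖x - y‖ ^ α := by
      by_cases hy : cutoff T τ y = 0
      · rw [hy, zero_mul, abs_zero]; positivity
      · rw [abs_mul, abs_of_nonneg (cutoff_nonneg _ _ _)]
        exact (mul_le_of_le_one_left (abs_nonneg _) (cutoff_le_one _ hτ _)).trans
          (hξ x (hD x hx) y (hD y hy))
    rw [e]
    refine (abs_add_le _ _).trans ((add_le_add h2 h3).trans ?_)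
    have h4 : 0 ≤ B * ‖x - y‖ ^ α := by positivity
    calc _ = (B + B / τ) * ‖x - y‖ ^ α := by ring
      _ ≤ _ := by gcongr; linarith
  by_cases hx : cutoff T τ x = 0
  · by_cases hy : cutoff T τ y = 0
    · rw [hx, hy]
      simp only [zero_mul, sub_self, abs_zero]
      positivity
    · rw [abs_sub_comm, norm_sub_rev]
      exact key y x (by rwa [norm_sub_rev]) hy
  · exact key x y hle hx

/-- On thin tubes, the Biot-Savart fields of the cut off shape gradients are small, because the
area of the tube tends to zero with its width. -/
theorem exists_isRandersField_of_thin (hΩ : IsOpen Ω) {M : Plane → Matrix (Fin 2) (Fin 2) ℝ}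
    (hM : ContinuousOn M (tube c U)) (hMpos : ∀ x ∈ tube c U, (M x).PosDef)
    (hc : IsCenterline c) (hU0 : 0 < U) (hT : tube c U ⊆ Ω) {ξ : Set Plane → Plane → ℝ}
    {α B : ℝ} (hα : 0 < α) (hα1 : α ≤ 1) (hξ : ∀ S₀ ∈ shapes1 Ω c U,
      (∀ x ∈ closure Ω, |ξ S₀ x| ≤ B) ∧
      ∀ x ∈ closure Ω, ∀ y ∈ closure Ω, |ξ S₀ x - ξ S₀ y| ≤ B * ‖x - y‖ ^ α) :
    ∃ U₀ : ℝ, 0 < U₀ ∧ U₀ ≤ U ∧ ∀ U' : ℝ, 0 < U' → U' ≤ U₀ →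
      ∃ ω : Set Plane → Plane → Plane, IsRandersField Ω M c U' ξ ω := by
  have hpi := Real.pi_pos
  obtain ⟨C, hC, hCM⟩ := exists_matNorm_inv_le (hc.isCompact_tube U) hM hMpos
  -- The radius `ρ` and the area bound `η` make the bound of the Biot-Savart field at most `1 / (2 C)`.
  set ρ : ℝ := 1 / (8 * Real.pi * (|B| * C + 1)) with hρ
  have hBC : 0 < |B| * C + 1 := by positivity
  have hρ0 : 0 < ρ := by positivity
  set η : ℝ := ρ / (4 * (|B| * C + 1)) with hη
  have hη0 : 0 < η := by positivity
  have hrange : volume (range c) = 0 := by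
    have h1 := volume_range_eq_zero (lipschitzWith_toC_comp hc.lipschitzWith)
    have h2 : range c = toC ⁻¹' (range fun t => toC (c t)) := by
      ext x
      constructor
      · rintro ⟨t, rfl⟩; exact ⟨t, rfl⟩
      · rintro ⟨t, ht⟩; exact ⟨t, toC.injective ht⟩
    rw [h2]
    exact toC.measurePreserving.quasiMeasurePreserving.preimage_null h1
  have hlim := tendsto_measure_cthickening_of_isCompact (μ := (volume : Measure Plane))
    hc.isCompact_range
  rw [hrange] at hlim
  have hev := (hlim.mono_left (nhdsWithin_le_nhds (s := Ioi 0))).eventually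
    (gt_mem_nhds (ENNReal.ofReal_pos.2 hη0))
  obtain ⟨δ, hδ, hδ0 : 0 < δ⟩ := (hev.and self_mem_nhdsWithin).exists
  set V := cthickening δ (range c)
  have hVt : volume V ≠ ⊤ := (hδ.trans ENNReal.ofReal_lt_top).ne
  have hVη : volume.real V ≤ η := ENNReal.toReal_le_of_le_ofReal hη0.le hδ.le
  refine ⟨min U (δ / 2), lt_min hU0 (by positivity), min_le_left _ _, fun U' hU' hU'le => ?_⟩
  have hU'U : U' ≤ U := hU'le.trans (min_le_left _ _)
  have hU'δ : U' ≤ δ / 2 := hU'le.trans (min_le_right _ _)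
  have hTne : (tube c U').Nonempty := ⟨_, range_subset_tube hU' (mem_range_self 0)⟩
  obtain ⟨τ₀, hτ₀, hτ₀Ω⟩ := (hc.isCompact_tube U').exists_thickening_subset_open hΩ
    ((tube_mono hU'U).trans hT)
  -- The cut off gradient is supported in `Ω`, where its Hölder seminorm is controlled, and in `V`.
  set τ := min τ₀ (δ / 2)
  have hτ : 0 < τ := lt_min hτ₀ (by positivity)
  have hsupp (x : Plane) (hx : cutoff (tube c U') τ x ≠ 0) : x ∈ Ω ∧ x ∈ V := by
    have h := infDist_lt_of_cutoff_ne_zero hτ hx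
    refine ⟨hτ₀Ω ((mem_thickening_iff_infDist_lt hTne).2 (h.trans_le (min_le_left _ _))), ?_⟩
    obtain ⟨y, hy, hxy⟩ := (infDist_lt_iff hTne).1 h
    have h1 : infDist x (range c) ≤ infDist y (range c) + dist x y := infDist_le_infDist_add_dist
    have h2 := hc.infDist_le_of_mem_tube hy
    have h3 : τ ≤ δ / 2 := min_le_right _ _
    obtain ⟨z, hz, hxz⟩ := hc.isCompact_range.exists_infDist_eq_dist (range_nonempty c) x
    exact mem_cthickening_of_dist_le x z δ _ hz (by linarith)
  have hfield : ∀ S₀ ∈ shapes1 Ω c U', ∃ g : Plane → Plane, ContDiff ℝ 1 g ∧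
      (∀ x ∈ tube c U', curl g x = ξ S₀ x) ∧ (∀ x, ‖g x‖ * C ≤ 1 / 2) ∧
      LipschitzWith (Real.pi * |B| + ((2 * |B| + |B| / τ)
        * (∫ u in ball (0 : ℂ) 1, ‖u‖ ^ (-(2 - α))) + |B| * volume.real V)).toNNReal g := by
    intro S₀ hS₀
    obtain ⟨h1, h2⟩ := hξ S₀ (shapes1_mono hU'U hS₀)
    have hf := abs_cutoff_mul_sub_le (T := tube c U') (D := closure Ω) (B := |B|) (ξ := ξ S₀) hτ hα
      hα1 (abs_nonneg B) (fun x hx => subset_closure (hsupp x hx).1)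
      (fun x hx => (h1 x hx).trans (le_abs_self B)) (fun x hx y hy => (h2 x hx y hy).trans (by
        gcongr
        exact le_abs_self B))
    obtain ⟨g, hg, hcurl, hgb, hgL⟩ := exists_contDiff_curl_eq hα hα1 (V := V)
      isClosed_cthickening.measurableSet hVt (fun x => (hf x x).1)
      (fun x hx => by
        by_contra h
        exact hx (hsupp x (left_ne_zero_of_mul h)).2) (fun x y => (hf x y).2)
    refine ⟨g, hg, fun x hx => ?_, fun x => ?_, hgL⟩
    · rw [hcurl, cutoff_eq_one hx, one_mul]
    · have h3 : |B| * (2 * Real.pi * ρ + volume.real V / ρ)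
          ≤ |B| * (2 * Real.pi * ρ + η / ρ) := by gcongr
      have h4 : 2 * Real.pi * ρ + η / ρ = 1 / (2 * (|B| * C + 1)) := by
        rw [hη, hρ]
        field_simp
        norm_num
      rw [h4] at h3
      refine (mul_le_mul_of_nonneg_right ((hgb ρ hρ0 x).trans h3) hC.le).trans ?_
      rw [mul_one_div, div_mul_eq_mul_div, div_le_div_iff₀ (by positivity) (by positivity)]
      linarith
  choose! ω hω using hfield
  refine ⟨ω, fun S₀ hS₀ => ⟨⟨ω S₀, (hω S₀ hS₀).1, fun x _ => rfl, (hω S₀ hS₀).2.1⟩,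
    fun x hx => ?_⟩, _, fun S₀ hS₀ => (hω S₀ hS₀).2.2.2.lipschitzOnWith⟩
  refine (hCM x (tube_mono hU'U hx) _).trans ?_
  rw [mul_comm]
  exact (hω S₀ hS₀).2.2.1 x

end ThinTubes

end RandersSeg

theorem mainTheorem5
    (Ω : Set Plane) (hΩo : IsOpen Ω) (hΩc : IsConnected Ω) (hΩb : Bornology.IsBounded Ω)
    (M : Plane → Matrix (Fin 2) (Fin 2) ℝ) (hM : ContDiffOn ℝ 1 M (closure Ω))
    (hMpos : ∀ x ∈ closure Ω, (M x).PosDef)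
    (c : ℝ → Plane) (hc : IsCenterline c)
    (U : ℝ) (hU0 : 0 < U) (hU : U ≤ localFeatureSize c / 3) (hT : tube c U ⊆ Ω)
    (Ψ : (Plane → ℝ) → ℝ) (hΨ : IsFunctionalOn Ω Ψ)
    (ξ : Set Plane → Plane → ℝ)
    (hξ : ∀ S₀ ∈ shapes1 Ω c U, ContinuousOn (ξ S₀) (closure Ω))
    (K : ℝ) (hK : 0 < K) (hTaylor : HasShapeGradient Ω c U Ψ ξ K)
    (C : Set Plane → ℝ → Plane)
    (hC : ∀ S ∈ shapes1 Ω c U, C S ∈ Gamma1 c U ∧ range (C S) = frontier S) :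
    (∀ ω : Set Plane → Plane → Plane, IsRandersField Ω M c U ξ ω →
      (∀ S₀ ∈ shapes1 Ω c U, ∃ e : ℝ, ∀ S ∈ shapes1 Ω c U,
        approxEnergy M Ψ ξ C (penaltyWeight Ω M K) S₀ S
          = e + pathLength (randersMetric M (penaltyWeight Ω M K) ω S₀) (C S)) ∧
      ∃ (a b : ℝ) (L : ℝ≥0), 0 < a ∧ ∀ S₀ ∈ shapes1 Ω c U,
        IsRandersMetric (tube c U) (randersMetric M (penaltyWeight Ω M K) ω S₀)
          (randersTensor M (penaltyWeight Ω M K) S₀) (ω S₀) L ∧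
        IsLeast (unitValues (randersMetric M (penaltyWeight Ω M K) ω S₀) (tube c U))
          (rhoMin (randersMetric M (penaltyWeight Ω M K) ω S₀) (tube c U)) ∧
        IsGreatest (unitValues (randersMetric M (penaltyWeight Ω M K) ω S₀) (tube c U))
          (rhoMax (randersMetric M (penaltyWeight Ω M K) ω S₀) (tube c U)) ∧
        a ≤ rhoMin (randersMetric M (penaltyWeight Ω M K) ω S₀) (tube c U) ∧
        rhoMax (randersMetric M (penaltyWeight Ω M K) ω S₀) (tube c U) ≤ b) ∧
    ((∃ α B : ℝ, 0 < α ∧ α < 1 ∧ ∀ S₀ ∈ shapes1 Ω c U,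
        (∀ x ∈ closure Ω, |ξ S₀ x| ≤ B) ∧
        ∀ x ∈ closure Ω, ∀ y ∈ closure Ω, |ξ S₀ x - ξ S₀ y| ≤ B * ‖x - y‖ ^ α) →
      ∃ U₀ : ℝ, 0 < U₀ ∧ U₀ ≤ U ∧ ∀ U' : ℝ, 0 < U' → U' ≤ U₀ →
        ∃ ω : Set Plane → Plane → Plane, IsRandersField Ω M c U' ξ ω) := by
  have hMT : ContinuousOn M (tube c U) := hM.continuousOn.mono (hT.trans subset_closure)
  refine ⟨fun ω hω => ⟨fun S₀ hS₀ => ?_, ?_⟩, ?_⟩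
  · obtain ⟨⟨g, hg, hgω, hcurl⟩, -⟩ := hω.1 S₀ hS₀
    exact exists_approxEnergy_eq hc hU0 hU hMT Ψ (hξ S₀ hS₀) hC _ hg hgω hcurl hS₀
  · exact exists_uniform_bounds_randersMetric hΩo (hM.mono subset_closure)
      (fun x hx => hMpos x (subset_closure hx)) hc hU0 hT (penaltyWeight_nonneg Ω M hK.le) hω
  · rintro ⟨α, B, hα, hα1, hB⟩
    exact exists_isRandersField_of_thin hΩo hMT (fun x hx => hMpos x (subset_closure (hT hx))) hc
      hU0 hT hα hα1.le hB
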